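/- Let $k\ge 1$ and let $A_1,\dots,A_k$ be independent random matrices, $A_i$ of size $n_i\times n_{i+1}$, with $n_{k+1}=n_1=\min\{n_1,\dots,n_k\}$, whose entries are i.i.d. standard complex Gaussian variables (density $\pi^{-1}e^{-|z|^2}$ on $\mathbb C$). Let $z_1,\dots,z_{n_1}$ be the eigenvalues, counted with algebraic multiplicity, of the $n_1\times n_1$ matrix $A=A_1A_2\cdots A_k$. Then the following hold. (a) The eigenvalues form a determinantal point process on $\mathbb C$: they are almost surely distinct, and there is a measurable Hermitian nonnegative definite kernel $K:\mathbb C\times\mathbb C\to\mathbb C$ such that, for all $m$ and all pairwise disjoint Borel sets $B_1,\dots,B_m\subseteq\mathbb C$, with $N(B)$ denoting the number of eigenvalues in $B$, $$\mathbb E\Big[\prod_{i=1}^m N(B_i)\Big]=\int_{B_1\times\cdots\times B_m}\det\big(K(x_i,x_j)\big)_{i,j=1}^m\,|dx_1|^2\cdots|dx_m|^2,$$ where $|dx|^2$ is Lebesgue measure on $\mathbb C$. (b) There is a measurable function $\omega:\mathbb C\to[0,\infty)$ such that $\omega(z)\,|dz|^2$ is the push-forward, under the map $(x_1,\dots,x_k)\mapsto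 x_1x_2\cdots x_k$, of the measure $$e^{-\sum_{j=1}^k|x_j|^2}\prod_{j=1}^k|x_j|^{2(n_j-n_1)}\prod_{j=1}^k|dx_j|^2$$ on $\mathbb C^k$; and for every such $\omega$, the vector of the eigenvalues of $A$, listed in uniformly random order, has density, with respect to Lebesgue measure on $\mathbb C^{n_1}$, equal to $$c\,\prod_{\ell=1}^{n_1}\omega(z_\ell)\prod_{1\le i<j\le n_1}|z_i-z_j|^2$$ for some constant $c>0$. -/

import Mathlib

open MeasureTheory ProbabilityTheory
open scoped ComplexOrder

/-- The product `A 0 * A 1 * ⋯ * A (k-1)` of rectangular complex matrices of compatible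
dimensions, `A i` being of size `n i × n (i+1)`. -/
def rectProd : (k : ℕ) → (n : Fin (k + 1) → ℕ) →
    ((i : Fin k) → Matrix (Fin (n i.castSucc)) (Fin (n i.succ)) ℂ) →
    Matrix (Fin (n 0)) (Fin (n (Fin.last k))) ℂ
  | 0, n, _ => (1 : Matrix (Fin (n 0)) (Fin (n 0)) ℂ)
  | k + 1, n, A =>
      rectProd k (fun i => n i.castSucc) (fun i => A i.castSucc) * A (Fin.last k)

/-- When the last dimension equals the first one, the product as a square matrix. -/
def squareProd {k : ℕ} {n : Fin (k + 1) → ℕ} (h : n (Fin.last k) = n 0)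
    (A : (i : Fin k) → Matrix (Fin (n i.castSucc)) (Fin (n i.succ)) ℂ) :
    Matrix (Fin (n 0)) (Fin (n 0)) ℂ :=
  (rectProd k n A).submatrix id (Fin.cast h.symm)

/-- The eigenvalues of a complex square matrix, with algebraic multiplicities. -/
noncomputable def eigenvalueMultiset {N : ℕ} (M : Matrix (Fin N) (Fin N) ℂ) : Multiset ℂ :=
  M.charpoly.roots

/-- The standard complex Gaussian law on `ℂ`: density `π⁻¹ exp (-|z|²)`. -/
noncomputable def stdComplexGaussian : Measure ℂ :=
  volume.withDensity fun z => ENNReal.ofReal (Real.pi⁻¹ * Real.exp (-‖z‖ ^ 2))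

/-- `Z` is a random vector whose coordinates list (in some order) the points of the random
multiset `X`. -/
def IsEnumeration {Ω : Type*} [MeasurableSpace Ω] (P : Measure Ω) {N : ℕ}
    (X : Ω → Multiset ℂ) (Z : Ω → Fin N → ℂ) : Prop :=
  AEMeasurable Z P ∧ ∀ᵐ ω ∂P, (Finset.univ : Finset (Fin N)).val.map (Z ω) = X ω

/-- The law of the vector obtained from `Z` by listing its coordinates in uniformly random
order (independently of everything else). -/
noncomputable def symmetrizedLaw {Ω : Type*} [MeasurableSpace Ω] (P : Measure Ω) {N : ℕ}
    (Z : Ω → Fin N → ℂ) : Measure (Fin N → ℂ) :=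
  ((N.factorial : ENNReal))⁻¹ •
    ∑ σ : Equiv.Perm (Fin N), P.map (fun ω => fun i => Z ω (σ i))

/-- The vector of the `N` points of the random multiset `X`, listed in uniformly random order,
has density `p` with respect to Lebesgue measure on `ℂ^N`. -/
def HasPointsDensity {Ω : Type*} [MeasurableSpace Ω] (P : Measure Ω) {N : ℕ}
    (X : Ω → Multiset ℂ) (p : (Fin N → ℂ) → ℝ) : Prop :=
  (∃ Z : Ω → Fin N → ℂ, IsEnumeration P X Z) ∧
    ∀ Z : Ω → Fin N → ℂ, IsEnumeration P X Z →
      symmetrizedLaw P Z = volume.withDensity fun z => ENNReal.ofReal (p z)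

open Classical in
/-- The number of points of `X ω` (with multiplicity) that lie in `B`. -/
noncomputable def pointCount {Ω : Type*} (X : Ω → Multiset ℂ) (B : Set ℂ) (ω : Ω) : ℕ :=
  (X ω).countP (fun z => z ∈ B)

/-- The random finite multiset `X` is a determinantal point process on `ℂ` with kernel `K`, with
respect to Lebesgue measure: it is a simple point process whose joint intensities are
`ρ_m (x_1, …, x_m) = det (K (x_i, x_j))`. The kernel is Hermitian and nonnegative definite, so that
these determinants are nonnegative real numbers. -/
structure IsDeterminantal {Ω : Type*} [MeasurableSpace Ω] (P : Measure Ω)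
    (X : Ω → Multiset ℂ) (K : ℂ → ℂ → ℂ) : Prop where
  measurable_kernel : Measurable (Function.uncurry K)
  posSemidef : ∀ (m : ℕ) (x : Fin m → ℂ),
    (Matrix.of fun i j : Fin m => K (x i) (x j)).PosSemidef
  aemeasurable_count : ∀ B : Set ℂ, MeasurableSet B → AEMeasurable (pointCount X B) P
  simple : ∀ᵐ ω ∂P, (X ω).Nodup
  intensity : ∀ (m : ℕ) (B : Fin m → Set ℂ), (∀ i, MeasurableSet (B i)) →
    Pairwise (fun i j => Disjoint (B i) (B j)) →
      ∫⁻ ω, ∏ i, (pointCount X (B i) ω : ENNReal) ∂P =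
        ∫⁻ x in Set.univ.pi B,
          ENNReal.ofReal (Matrix.of fun i j : Fin m => K (x i) (x j)).det.re

/-- `w` is the weight function given by
`w(z) |dz|² = ∫_{h(x) = z} g(x) |dx_1|² ⋯ |dx_k|²`, that is, `w` is the density, with respect to
Lebesgue measure on `ℂ`, of the image under `h` of the measure with density `g` on `ℂ^k`. -/
structure IsFiberWeight {k : ℕ} (h : (Fin k → ℂ) → ℂ) (g : (Fin k → ℂ) → ℝ)
    (w : ℂ → ℝ) : Prop where
  measurable : Measurable w
  nonneg : ∀ z, 0 ≤ w z
  map_eq : (volume.withDensity fun x => ENNReal.ofReal (g x)).map h =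
    volume.withDensity fun z => ENNReal.ofReal (w z)

/-- `w(z) |dz|² = ∫_{x_1 ⋯ x_k = z} exp (-∑ |x_j|²) ∏ |x_j|^{2 (n_j - n_1)} ∏ |dx_j|²`
(here `n_1, …, n_k` are `n 0, …, n (k-1)`; the subtraction is used only when `n 0` is the
smallest of the `n j`). -/
def IsRectWeight {k : ℕ} (n : Fin (k + 1) → ℕ) (w : ℂ → ℝ) : Prop :=
  IsFiberWeight (fun x : Fin k → ℂ => ∏ j, x j)
    (fun x => Real.exp (-∑ j, ‖x j‖ ^ 2) * ∏ j, ‖x j‖ ^ (2 * (n j.castSucc - n 0))) w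

/-! Eigenvalues are split off one at a time. A cyclic chain of vectors with `A_i (1, u_{i+1}) = x_i
(1, u_i)`, the last vertex being identified with the first, produces the eigenvalue `∏ x_i`.
Conjugating by the shears with first columns `(1, u_j)` makes every `A_i` block upper triangular,
with corner `x_i` and a remaining block `D_i`; the `D_i` form a chain with all dimensions lowered by
one. When all entries other than the first columns are fixed, `fiberMap` sends `u` to the first
columns, and for a generic chain its fibre contains exactly one point per eigenvalue
(`IsGenericChain.orderingSum_eq`). The area formula with multiplicity therefore turns a Gaussian
integral of a sum over eigenvalues into an integral over `u`. The squared Jacobian is `∏ |x_i|^(2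
(n_i - n_0)) |χ(∏ x_i)|²`, where `χ` is the characteristic polynomial of the product of the `D_i`
(`norm_det_fiberDeriv_sq`).

Each shear is a unitary matrix times a block upper triangular one, and the Gaussian density is
unitarily invariant. For fixed `u` a linear substitution thus leads to the Gaussian density of a
block triangular chain, and `u` contributes only a constant factor (`exists_chartIntegral_eq`). In
what remains, integration over the corners `x_i` with fixed product gives the weight `ω`, the factor
`|χ|²` supplies the new Vandermonde factors, and the chain of the `D_i` is handled by induction
(`hasEigenvalueFormula_succ`). That the constants are positive and finite is read off from total
masses (`HasEigenvalueFormula.ne`).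

The measure defining `ω` is invariant under rotation of each coordinate, so the monomials are
orthogonal for `ω`. The joint density is then a multiple of `det K(z_i, z_j)` for the projection
kernel `K` of the normalised monomials, and integrating out variables one by one gives the
intensities (`IsOrthonormalFamily.lintegral_prod_count_mul`).

Measurability is secured by sorting the eigenvalues lexicographically (`eigVec`) and by working with
sums over all orderings (`orderingSum`). -/

/-! ### Linear changes of variables, null sets and the area formula. -/

instance isAddHaarMeasure_volume_prod {G H : Type*} [AddGroup G] [TopologicalSpace G]
    [MeasureSpace G] [AddGroup H] [TopologicalSpace H] [MeasureSpace H]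
    [Measure.IsAddHaarMeasure (volume : Measure G)] [Measure.IsAddHaarMeasure (volume : Measure H)]
    [SFinite (volume : Measure G)] [SFinite (volume : Measure H)]
    [MeasurableAdd G] [MeasurableAdd H] :
    Measure.IsAddHaarMeasure (volume : Measure (G × H)) :=
  Measure.prod.instIsAddHaarMeasure _ _

/-- A linear equivalence changes additive Haar measures by a constant factor. -/
theorem exists_lintegral_linearEquiv_eq {E F : Type*} [NormedAddCommGroup E] [MeasurableSpace E]
    [BorelSpace E] [NormedSpace ℝ E] [NormedAddCommGroup F] [MeasurableSpace F] [BorelSpace F]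
    [NormedSpace ℝ F] [FiniteDimensional ℝ E] (L : E ≃ₗ[ℝ] F) (μ : Measure E) (ν : Measure F)
    [μ.IsAddHaarMeasure] [ν.IsAddHaarMeasure] :
    ∃ c : ENNReal, c ≠ 0 ∧ c ≠ ⊤ ∧ ∀ f : F → ENNReal, ∫⁻ x, f (L x) ∂μ = c * ∫⁻ y, f y ∂ν := by
  have : FiniteDimensional ℝ F := L.finiteDimensional
  let L' : E ≃L[ℝ] F := L.toContinuousLinearEquiv
  have : (μ.map L').IsAddHaarMeasure := ContinuousLinearEquiv.isAddHaarMeasure_map L' μ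
  refine ⟨Measure.addHaarScalarFactor (μ.map L') ν, ?_, ENNReal.coe_ne_top, fun f => ?_⟩
  · have := Measure.addHaarScalarFactor_pos_of_isAddHaarMeasure (μ.map L') ν
    exact_mod_cast this.ne'
  · have h2 : ∫⁻ x, f (L x) ∂μ = ∫⁻ y, f y ∂(μ.map L') :=
      (L'.toHomeomorph.toMeasurableEquiv.measurableEmbedding.lintegral_map f).symm
    rw [h2]
    conv_lhs => rw [Measure.isAddLeftInvariant_eq_smul (μ.map L') ν]
    simp only [lintegral_smul_measure]
    rfl

/-- A linear equivalence of a finite-dimensional space preserves null sets. -/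
theorem ae_of_ae_linearEquiv {E F : Type*} [NormedAddCommGroup E] [MeasurableSpace E]
    [BorelSpace E] [NormedSpace ℝ E] [NormedAddCommGroup F] [MeasurableSpace F] [BorelSpace F]
    [NormedSpace ℝ F] [FiniteDimensional ℝ E] (L : E ≃ₗ[ℝ] F) (μ : Measure E) (ν : Measure F)
    [μ.IsAddHaarMeasure] [ν.IsAddHaarMeasure] {p : F → Prop} (h : ∀ᵐ y ∂ν, p y) :
    ∀ᵐ x ∂μ, p (L x) := by
  have : FiniteDimensional ℝ F := L.finiteDimensional
  let L' : E ≃L[ℝ] F := L.toContinuousLinearEquiv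
  have : (μ.map L').IsAddHaarMeasure := ContinuousLinearEquiv.isAddHaarMeasure_map L' μ
  have h1 : ∀ᵐ y ∂(μ.map L'), p y := by
    rw [Measure.isAddLeftInvariant_eq_smul (μ.map L') ν]
    exact Measure.ae_smul_measure h _
  exact ae_of_ae_map L'.continuous.measurable.aemeasurable h1

/-- The zero set of a holomorphic function that does not vanish identically is a null set. -/
theorem ae_ne_zero_of_differentiable {E : Type*} [NormedAddCommGroup E] [NormedSpace ℂ E]
    [FiniteDimensional ℂ E] [MeasurableSpace E] [BorelSpace E] (μ : Measure E)
    [μ.IsAddHaarMeasure] {q : E → ℂ} (hq : Differentiable ℂ q) {x₀ : E} (h₀ : q x₀ ≠ 0) :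
    ∀ᵐ x ∂μ, q x ≠ 0 := by
  have : FiniteDimensional ℝ E := FiniteDimensional.complexToReal E
  have : ProperSpace E := FiniteDimensional.proper ℂ E
  have hmeas : Measurable q := hq.continuous.measurable
  -- On a complex line through `x₀` the restriction of `q` is a one-variable analytic function that
  -- is nonzero at `0`, so its zeros are isolated.
  have hline : ∀ y : E, ∀ᵐ t : ℂ, q (x₀ + t • y) ≠ 0 := by
    intro y
    have hd : Differentiable ℂ (fun t : ℂ => q (x₀ + t • y)) := by fun_prop
    have ha : AnalyticOnNhd ℂ (fun t : ℂ => q (x₀ + t • y)) Set.univ :=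
      fun t _ => hd.analyticAt t
    have hc := ha.preimage_zero_mem_codiscrete (x := 0) (by simpa using h₀)
    exact ae_restrict_le_codiscreteWithin (U := Set.univ) MeasurableSet.univ hc |> fun h => by
      rw [Measure.restrict_univ] at h
      exact h
  -- After exchanging the quantifiers by Fubini, one fixed `t ≠ 0` serves almost every `y`, and the
  -- dilation by `t` can be undone.
  have hsw : ∀ᵐ t : ℂ, ∀ᵐ y ∂μ, q (x₀ + t • y) ≠ 0 := by
    have hm : MeasurableSet {z : ℂ × E | q (x₀ + z.1 • z.2) ≠ 0} := by
      refine (measurableSet_singleton (0 : ℂ)).compl.preimage (hmeas.comp ?_)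
      exact (by fun_prop : Continuous fun z : ℂ × E => x₀ + z.1 • z.2).measurable
    exact Measure.ae_ae_comm (p := fun y t => q (x₀ + t • y) ≠ 0) (measurable_swap hm) |>.1
      (Filter.Eventually.of_forall hline)
  have hne : ∀ᵐ t : ℂ, t ≠ 0 := by simp [ae_iff, measure_singleton]
  obtain ⟨t, ht, ht0⟩ := (hsw.and hne).exists
  let L : E ≃ₗ[ℝ] E := (LinearEquiv.smulOfNeZero ℂ E t⁻¹ (inv_ne_zero ht0)).restrictScalars ℝ
  have h2 := ae_of_ae_linearEquiv L μ μ ht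
  have h3 : ∀ᵐ x ∂μ, q (x₀ + x) ≠ 0 := by
    filter_upwards [h2] with x hx
    simpa [L, smul_smul, ht0] using hx
  have := (measurePreserving_add_left μ (-x₀)).quasiMeasurePreserving.ae h3
  simpa using this

/-- The area formula for a map that need not be injective. -/
theorem lintegral_abs_det_fderiv_mul_eq_lintegral_tsum_fiber {E : Type*} [NormedAddCommGroup E]
    [NormedSpace ℝ E] [FiniteDimensional ℝ E] [MeasurableSpace E] [BorelSpace E] (μ : Measure E)
    [μ.IsAddHaarMeasure] {f : E → E} {f' : E → E →L[ℝ] E} (hf : ∀ x, HasFDerivAt f (f' x) x)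
    (hf' : Continuous f') {G : E → ENNReal} (hG : Measurable G) :
    ∫⁻ x, ENNReal.ofReal |(f' x).det| * G x ∂μ =
      ∫⁻ y, ∑' x : {x | f x = y ∧ (f' x).det ≠ 0}, G x ∂μ := by
  classical
  set S : Set E := {x | (f' x).det ≠ 0} with hS
  have hdet : Continuous fun x => (f' x).det := ContinuousLinearMap.continuous_det.comp hf'
  have hSm : MeasurableSet S := (hdet.measurable (measurableSet_singleton 0)).compl
  -- The tolerance `r A` is chosen so that a map approximated by an invertible `A` up to `r A` is
  -- injective; halving makes the inequality strict. For singular `A` any positive value will do.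
  have hr : ∀ A : E →L[ℝ] E, ∃ r : NNReal, r ≠ 0 ∧
      ∀ B : E ≃L[ℝ] E, (B : E →L[ℝ] E) = A →
        Subsingleton E ∨ r < ‖(B.symm : E →L[ℝ] E)‖₊⁻¹ := by
    intro A
    by_cases hsub : Subsingleton E
    · exact ⟨1, one_ne_zero, fun _ _ => Or.inl hsub⟩
    by_cases hA : ∃ B : E ≃L[ℝ] E, (B : E →L[ℝ] E) = A
    · obtain ⟨B, rfl⟩ := hA
      have : Nontrivial E := not_subsingleton_iff_nontrivial.1 hsub
      have hB : ‖(B.symm : E →L[ℝ] E)‖₊⁻¹ ≠ 0 := by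
        simpa using (ContinuousLinearEquiv.norm_symm_pos B).ne'
      refine ⟨‖(B.symm : E →L[ℝ] E)‖₊⁻¹ / 2, by positivity, fun B' hB' => Or.inr ?_⟩
      have : B' = B := ContinuousLinearEquiv.coe_injective hB'
      rw [this]
      exact half_lt_self (pos_iff_ne_zero.2 hB)
    · exact ⟨1, one_ne_zero, fun B hB => absurd ⟨B, hB⟩ hA⟩
  choose r hr0 hrB using hr
  obtain ⟨t, A, htd, htm, htS, htA, hAf⟩ := exists_partition_approximatesLinearOn_of_hasFDerivWithinAt
    f S f' (fun x _ => (hf x).hasFDerivWithinAt) r hr0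
  have hinj : ∀ n, Set.InjOn f (S ∩ t n) := by
    intro n
    rcases S.eq_empty_or_nonempty with hE | hne
    · simp [hE]
    obtain ⟨y, hy, hAy⟩ := hAf hne n
    have h1 := htA n
    have hdy : (A n).det ≠ 0 := hAy ▸ hy
    have hB : ((A n).toContinuousLinearEquivOfDetNeZero hdy : E →L[ℝ] E) = A n :=
      ContinuousLinearMap.coe_toContinuousLinearEquivOfDetNeZero _ _
    rw [← hB] at h1
    refine h1.injOn ?_
    have := hrB (A n) _ hB
    rwa [hB]
  have hm : ∀ n, MeasurableSet (S ∩ t n) := fun n => hSm.inter (htm n)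
  have hunion : S = ⋃ n, S ∩ t n := by
    rw [← Set.inter_iUnion, Set.inter_eq_left.2 htS]
  have hdisj : Pairwise (Function.onFun Disjoint fun n => S ∩ t n) := fun i j hij =>
    (htd hij).mono Set.inter_subset_right Set.inter_subset_right
  -- By injectivity on each piece, this sum has at most one term.
  let g : ℕ → E → ENNReal := fun n y => ∑' x : {x | f x = y ∧ x ∈ S ∩ t n}, G x
  have hg1 : ∀ n, ∀ x ∈ S ∩ t n, g n (f x) = G x := by
    intro n x hx
    have : {x' | f x' = f x ∧ x' ∈ S ∩ t n} = {x} := by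
      ext x'
      constructor
      · rintro ⟨h1, h2⟩
        exact hinj n h2 hx h1
      · rintro rfl
        exact ⟨rfl, hx⟩
    change ∑' x : {x' | f x' = f x ∧ x' ∈ S ∩ t n}, G x = G x
    rw [tsum_congr_set_coe G this, tsum_singleton x G]
  have hg0 : ∀ n, ∀ y, y ∉ f '' (S ∩ t n) → g n y = 0 := by
    intro n y hy
    have : {x' | f x' = y ∧ x' ∈ S ∩ t n} = ∅ := by
      ext x'
      simp only [Set.mem_ofPred_eq, Set.mem_empty_iff_false, iff_false]
      rintro ⟨h1, h2⟩
      exact hy ⟨x', h2, h1⟩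
    change ∑' x : {x' | f x' = y ∧ x' ∈ S ∩ t n}, G x = 0
    rw [tsum_congr_set_coe G this, tsum_empty]
  have hgm : ∀ n, Measurable (g n) := by
    intro n
    have he := measurableEmbedding_of_fderivWithin (hm n)
      (fun x _ => (hf x).hasFDerivWithinAt) (hinj n)
    -- On the image of the piece, `g n` is `G` transported along the measurable embedding given by
    -- `f`, and it is zero elsewhere; hence it is measurable.
    have : g n = Function.extend (Set.domRestrict (S ∩ t n) f) (fun x => G x) (fun _ => 0) := by
      ext y
      by_cases hy : y ∈ f '' (S ∩ t n)
      · obtain ⟨x, hx, rfl⟩ := hy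
        rw [hg1 n x hx]
        exact (he.injective.extend_apply (fun x : (S ∩ t n : Set E) => G x) _ ⟨x, hx⟩).symm
      · rw [hg0 n y hy, Function.extend_apply']
        rintro ⟨x, hx⟩
        exact hy ⟨x, x.2, hx⟩
    rw [this]
    exact he.measurable_extend (hG.comp measurable_subtype_coe) measurable_const
  -- Critical points drop out because the Jacobian factor vanishes there.
  have hL : ∫⁻ x, ENNReal.ofReal |(f' x).det| * G x ∂μ =
      ∫⁻ x in S, ENNReal.ofReal |(f' x).det| * G x ∂μ := by
    rw [← lintegral_indicator hSm]
    refine lintegral_congr fun x => ?_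
    by_cases hx : x ∈ S
    · rw [Set.indicator_of_mem hx]
    · rw [Set.indicator_of_notMem hx]
      have : (f' x).det = 0 := by simpa [hS] using hx
      simp [this]
  rw [hL]
  conv_lhs => rw [hunion]
  rw [lintegral_iUnion hm hdisj]
  have hpart : ∀ n, ∫⁻ x in S ∩ t n, ENNReal.ofReal |(f' x).det| * G x ∂μ = ∫⁻ y, g n y ∂μ := by
    intro n
    have h1 := lintegral_image_eq_lintegral_abs_det_fderiv_mul μ (hm n)
      (fun x _ => (hf x).hasFDerivWithinAt) (hinj n) (g n)
    have h2 : ∫⁻ y in f '' (S ∩ t n), g n y ∂μ = ∫⁻ y, g n y ∂μ := by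
      apply setLIntegral_eq_of_support_subset
      intro y hy
      by_contra hcon
      exact hy (hg0 n y hcon)
    rw [← h2, h1]
    refine setLIntegral_congr_fun (hm n) fun x hx => ?_
    simp only [hg1 n x hx]
  simp_rw [hpart]
  rw [← lintegral_tsum fun n => (hgm n).aemeasurable]
  refine lintegral_congr fun y => ?_
  have hset : {x | f x = y ∧ (f' x).det ≠ 0} = ⋃ n, {x | f x = y ∧ x ∈ S ∩ t n} := by
    ext x
    have : x ∈ S ↔ ∃ n, x ∈ S ∩ t n := by
      conv_lhs => rw [hunion]
      simp
    simp only [Set.mem_ofPred_eq, Set.mem_iUnion]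
    rw [exists_and_left, ← this]
    rfl
  rw [tsum_congr_set_coe G hset, ENNReal.tsum_biUnion]
  intro i _ j _ hij
  refine Set.disjoint_left.2 fun x hi hj => ?_
  exact Set.disjoint_left.1 (hdisj hij) hi.2 hj.2

/-! ### Integration over finite powers of the complex plane. -/

theorem lintegral_fin_cons {N : ℕ} {F : (Fin (N + 1) → ℂ) → ENNReal} (hF : Measurable F) :
    ∫⁻ z, F z = ∫⁻ x : ℂ, ∫⁻ z : Fin N → ℂ, F (Fin.cons x z) := by
  have h := volume_preserving_piFinSuccAbove (fun _ : Fin (N + 1) => ℂ) 0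
  have h2 := h.symm.lintegral_comp_emb (MeasurableEquiv.measurableEmbedding _) F
  rw [← h2, Measure.volume_eq_prod]
  refine (lintegral_prod _ (hF.comp
    (MeasurableEquiv.piFinSuccAbove _ 0).symm.measurable).aemeasurable).trans ?_
  refine lintegral_congr fun x => lintegral_congr fun z => ?_
  exact congrArg F (Fin.insertNth_zero' x z)

theorem lintegral_fin_snoc {N : ℕ} {F : (Fin (N + 1) → ℂ) → ENNReal} (hF : Measurable F) :
    ∫⁻ z, F z = ∫⁻ z : Fin N → ℂ, ∫⁻ x : ℂ, F (Fin.snoc z x) := by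
  have h := volume_preserving_piFinSuccAbove (fun _ : Fin (N + 1) => ℂ) (Fin.last N)
  have h2 := h.symm.lintegral_comp_emb (MeasurableEquiv.measurableEmbedding _) F
  rw [← h2, Measure.volume_eq_prod]
  refine (lintegral_prod_symm _ (hF.comp
    (MeasurableEquiv.piFinSuccAbove _ (Fin.last N)).symm.measurable).aemeasurable).trans ?_
  refine lintegral_congr fun x => lintegral_congr fun z => ?_
  exact congrArg F (Fin.insertNth_last' z x)

theorem lintegral_comp_perm {N : ℕ} (σ : Equiv.Perm (Fin N)) (F : (Fin N → ℂ) → ENNReal) :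
    ∫⁻ z : Fin N → ℂ, F (fun i => z (σ i)) = ∫⁻ z, F z := by
  have h := volume_measurePreserving_piCongrLeft (fun _ : Fin N => ℂ) σ
  have h2 := h.symm.lintegral_comp_emb (MeasurableEquiv.measurableEmbedding _) F
  rw [← h2]
  rfl

theorem lintegral_fin_prod {N : ℕ} {f : Fin N → ℂ → ENNReal} (hf : ∀ i, Measurable (f i)) :
    ∫⁻ z : Fin N → ℂ, ∏ i, f i (z i) = ∏ i, ∫⁻ x, f i x := by
  induction N with
  | zero => simp [volume_pi]
  | succ N ih =>
    rw [lintegral_fin_cons (by fun_prop)]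
    simp only [Fin.prod_univ_succ, Fin.cons_zero, Fin.cons_succ]
    have : ∀ x : ℂ, ∫⁻ z : Fin N → ℂ, f 0 x * ∏ i : Fin N, f i.succ (z i) =
        f 0 x * ∏ i : Fin N, ∫⁻ x, f i.succ x := fun x => by
      rw [lintegral_const_mul _ (by fun_prop), ih fun i => hf _]
    simp_rw [this]
    rw [lintegral_mul_const _ (hf 0)]

theorem lintegral_pi_prod {ι : Type*} [Fintype ι] {f : ι → ℂ → ENNReal}
    (hf : ∀ i, Measurable (f i)) :
    ∫⁻ z : ι → ℂ, ∏ i, f i (z i) = ∏ i, ∫⁻ x, f i x := by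
  let e := Fintype.equivFin ι
  have h := volume_measurePreserving_piCongrLeft (fun _ : ι => ℂ) e.symm
  have h2 := h.lintegral_comp_emb (MeasurableEquiv.measurableEmbedding _)
    (fun z => ∏ i, f i (z i))
  have h3 := lintegral_fin_prod (f := fun i => f (e.symm i)) fun i => hf _
  rw [← h2, Fintype.prod_equiv e (fun i => ∫⁻ x, f i x) (fun i => ∫⁻ x, f (e.symm i) x)
    (fun i => by simp), ← h3]
  refine lintegral_congr fun z => ?_
  rw [Fintype.prod_equiv e]
  intro i
  obtain ⟨j, rfl⟩ := e.symm.surjective i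
  rw [MeasurableEquiv.coe_piCongrLeft, Equiv.piCongrLeft_apply_apply, e.apply_symm_apply]

theorem pi_withDensity_eq {ι : Type*} [Fintype ι] {g : ℂ → ENNReal} (hg : Measurable g)
    [SigmaFinite (volume.withDensity g : Measure ℂ)] :
    Measure.pi (fun _ : ι => volume.withDensity g) =
      (volume : Measure (ι → ℂ)).withDensity fun z => ∏ i, g (z i) := by
  refine Measure.pi_eq fun s hs => ?_
  rw [withDensity_apply _ (MeasurableSet.univ_pi hs), ← lintegral_indicator (.univ_pi hs)]
  have : ∀ z : ι → ℂ, (Set.univ.pi s).indicator (fun z => ∏ i, g (z i)) z =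
      ∏ i, (s i).indicator g (z i) := by
    intro z
    by_cases hz : z ∈ Set.univ.pi s
    · rw [Set.indicator_of_mem hz]
      exact Finset.prod_congr rfl fun i _ => (Set.indicator_of_mem (hz i trivial) _).symm
    · rw [Set.indicator_of_notMem hz]
      simp only [Set.mem_pi, Set.mem_univ, true_implies, not_forall] at hz
      obtain ⟨i, hi⟩ := hz
      exact (Finset.prod_eq_zero (Finset.mem_univ i) (Set.indicator_of_notMem hi _)).symm
  simp_rw [this]
  rw [lintegral_pi_prod fun i => hg.indicator (hs i)]
  refine Finset.prod_congr rfl fun i _ => ?_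
  rw [lintegral_indicator (hs i), withDensity_apply _ (hs i)]

/-! ### A measurable enumeration of the eigenvalues. -/

/-- The lexicographic key `(re, im)` of a complex number. -/
def lexKey (z : ℂ) : ℝ ×ₗ ℝ := toLex (z.re, z.im)

theorem lexKey_injective : Function.Injective lexKey := by
  intro a b h
  have := Prod.ext_iff.1 (toLex.injective h)
  exact Complex.ext this.1 this.2

theorem eq_of_monotone_lexKey {N : ℕ} {z z' : Fin N → ℂ} (hz : Monotone (lexKey ∘ z))
    (hz' : Monotone (lexKey ∘ z'))
    (h : (Finset.univ : Finset (Fin N)).val.map z = (Finset.univ : Finset (Fin N)).val.map z') :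
    z = z' := by
  have h1 : (Finset.univ : Finset (Fin N)).val.map (lexKey ∘ z) =
      (Finset.univ : Finset (Fin N)).val.map (lexKey ∘ z') := by
    rw [← Multiset.map_map, h, Multiset.map_map]
  rw [Fin.univ_val_map, Fin.univ_val_map, Multiset.coe_eq_coe] at h1
  have h2 : lexKey ∘ z = lexKey ∘ z' := List.ofFn_injective <|
    h1.eq_of_pairwise' hz.sortedLE_ofFn.pairwise hz'.sortedLE_ofFn.pairwise
  exact lexKey_injective.comp_left h2

theorem map_univ_comp_perm {N : ℕ} (z : Fin N → ℂ) (σ : Equiv.Perm (Fin N)) :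
    (Finset.univ : Finset (Fin N)).val.map (z ∘ σ) =
      (Finset.univ : Finset (Fin N)).val.map z := by
  rw [Fin.univ_val_map, Fin.univ_val_map, Multiset.coe_eq_coe]
  exact σ.ofFn_comp_perm z

theorem exists_perm_of_map_univ_eq {N : ℕ} {z z' : Fin N → ℂ}
    (h : (Finset.univ : Finset (Fin N)).val.map z = (Finset.univ : Finset (Fin N)).val.map z') :
    ∃ σ : Equiv.Perm (Fin N), z' = z ∘ σ := by
  have h1 := eq_of_monotone_lexKey (z := z ∘ Tuple.sort (lexKey ∘ z))
    (z' := z' ∘ Tuple.sort (lexKey ∘ z')) (Tuple.monotone_sort (lexKey ∘ z))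
    (Tuple.monotone_sort (lexKey ∘ z')) (by rw [map_univ_comp_perm, map_univ_comp_perm, h])
  refine ⟨(Tuple.sort (lexKey ∘ z')).symm.trans (Tuple.sort (lexKey ∘ z)), ?_⟩
  ext i
  have := congrFun h1 ((Tuple.sort (lexKey ∘ z')).symm i)
  simpa using this.symm

/-- Tuples sorted lexicographically. -/
def sortedTuples (N : ℕ) : Set (Fin N → ℂ) := {z | Monotone (lexKey ∘ z)}

theorem measurableSet_sortedTuples (N : ℕ) : MeasurableSet (sortedTuples N) := by
  have : sortedTuples N = ⋂ (i : Fin N) (j : Fin N) (_ : i ≤ j),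
      ({z : Fin N → ℂ | (z i).re < (z j).re} ∪
        ({z | (z i).re = (z j).re} ∩ {z | (z i).im ≤ (z j).im})) := by
    ext z
    simp only [sortedTuples, Set.mem_iInter]
    constructor
    · intro h i j hij
      exact Prod.Lex.toLex_le_toLex.1 (h hij)
    · intro h i j hij
      exact Prod.Lex.toLex_le_toLex.2 (h i j hij)
  rw [this]
  refine MeasurableSet.iInter fun i => MeasurableSet.iInter fun j => MeasurableSet.iInter fun _ => ?_
  have hre : ∀ i : Fin N, Measurable fun z : Fin N → ℂ => (z i).re := fun i =>
    Complex.measurable_re.comp (measurable_pi_apply i)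
  have him : ∀ i : Fin N, Measurable fun z : Fin N → ℂ => (z i).im := fun i =>
    Complex.measurable_im.comp (measurable_pi_apply i)
  exact (measurableSet_lt (hre i) (hre j)).union
    ((measurableSet_eq_fun (hre i) (hre j)).inter (measurableSet_le (him i) (him j)))

/-- The values at the natural numbers of the monic polynomial with the given roots. -/
noncomputable def rootValues {N : ℕ} (z : Fin N → ℂ) : ℕ → ℂ := fun t => ∏ i, ((t : ℂ) - z i)

/-- A polynomial is determined by its values on an infinite set. Sampling at the natural numbers
keeps the invariant in the countable product `ℕ → ℂ`, where the Lusin–Souslin theorem is available.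
-/
theorem map_univ_eq_of_rootValues_eq {N : ℕ} {z z' : Fin N → ℂ}
    (h : rootValues z = rootValues z') :
    (Finset.univ : Finset (Fin N)).val.map z = (Finset.univ : Finset (Fin N)).val.map z' := by
  have key : ∀ y : Fin N → ℂ, (∏ i, (Polynomial.X - Polynomial.C (y i))).roots =
      (Finset.univ : Finset (Fin N)).val.map y := by
    intro y
    have := Polynomial.roots_multiset_prod_X_sub_C ((Finset.univ : Finset (Fin N)).val.map y)
    rw [Multiset.map_map] at this
    exact this
  have hp : (∏ i, (Polynomial.X - Polynomial.C (z i))) =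
      ∏ i, (Polynomial.X - Polynomial.C (z' i)) := by
    refine Polynomial.eq_of_infinite_eval_eq _ _ ?_
    refine (Set.infinite_range_of_injective (Nat.cast_injective (R := ℂ))).mono ?_
    rintro _ ⟨t, rfl⟩
    have := congrFun h t
    simpa [rootValues, Polynomial.eval_prod] using this
  rw [← key, ← key, hp]

/-- An injective measurable map out of a standard Borel space is a measurable embedding. Its inverse
therefore recovers the sorted roots measurably from the polynomial. -/
theorem measurableEmbedding_rootValues (N : ℕ) :
    MeasurableEmbedding fun z : sortedTuples N => rootValues z.1 := by
  have : StandardBorelSpace (sortedTuples N) := (measurableSet_sortedTuples N).standardBorel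
  refine Measurable.measurableEmbedding ?_ ?_
  · refine measurable_pi_lambda _ fun t => ?_
    simp only [rootValues]
    exact Finset.measurable_prod _ fun i _ => measurable_const.sub
      ((measurable_pi_apply i).comp measurable_subtype_coe)
  · intro z z' h
    exact Subtype.ext (eq_of_monotone_lexKey z.2 z'.2 (map_univ_eq_of_rootValues_eq h))

/-- The eigenvalues of a matrix, sorted lexicographically. -/
noncomputable def eigVec {N : ℕ} (M : Matrix (Fin N) (Fin N) ℂ) : Fin N → ℂ :=
  Function.extend (fun z : sortedTuples N => rootValues z.1) Subtype.val (fun _ => 0)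
    (fun t => (Matrix.scalar (Fin N) (t : ℂ) - M).det)

/-- Characteristic polynomials split over `ℂ`, so their values always lie in the range of the
embedding and the default `0` in `eigVec` is never taken. -/
theorem map_eigVec {N : ℕ} (M : Matrix (Fin N) (Fin N) ℂ) :
    (Finset.univ : Finset (Fin N)).val.map (eigVec M) = eigenvalueMultiset M := by
  have hs : M.charpoly.Splits := IsAlgClosed.splits _
  have hcard : (eigenvalueMultiset M).card = N := by
    rw [eigenvalueMultiset, ← hs.natDegree_eq_card_roots, Matrix.charpoly_natDegree_eq_dim,
      Fintype.card_fin]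
  obtain ⟨l, hl⟩ : ∃ l : List ℂ, (l : Multiset ℂ) = eigenvalueMultiset M :=
    ⟨_, Multiset.coe_toList _⟩
  have hlen : l.length = N := by rw [← hcard, ← hl, Multiset.coe_card]
  subst hlen
  let z := l.get ∘ Tuple.sort (lexKey ∘ l.get)
  have hz : z ∈ sortedTuples l.length := Tuple.monotone_sort (lexKey ∘ l.get)
  have hzm : (Finset.univ : Finset (Fin l.length)).val.map z = eigenvalueMultiset M := by
    rw [map_univ_comp_perm, Fin.univ_val_map, List.ofFn_get, hl]
  have hv : (fun t : ℕ => (Matrix.scalar (Fin l.length) (t : ℂ) - M).det) = rootValues z := by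
    ext t
    rw [← Matrix.eval_charpoly, hs.eval_eq_prod_roots_of_monic M.charpoly_monic]
    change (Multiset.map _ (eigenvalueMultiset M)).prod = _
    rw [← hzm, Multiset.map_map]
    rfl
  have : eigVec M = z := by
    rw [eigVec, hv]
    exact (measurableEmbedding_rootValues _).injective.extend_apply _ _ ⟨z, hz⟩
  rw [this, hzm]

theorem measurable_eigVec_comp {N : ℕ} {X : Type*} [MeasurableSpace X]
    {M : X → Matrix (Fin N) (Fin N) ℂ} (hM : ∀ i j, Measurable fun x => M x i j) :
    Measurable fun x => eigVec (M x) := by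
  have h : Measurable (Function.extend (fun z : sortedTuples N => rootValues z.1) Subtype.val
      (fun _ => 0)) :=
    (measurableEmbedding_rootValues N).measurable_extend measurable_subtype_coe measurable_const
  refine h.comp (measurable_pi_lambda _ fun t => ?_)
  simp only [Matrix.det_apply]
  refine Finset.measurable_sum _ fun σ _ => Measurable.const_smul ?_ _
  exact Finset.measurable_prod _ fun i _ => measurable_const.sub (hM _ _)

theorem charpoly_eval_eq_prod_eigVec {N : ℕ} (M : Matrix (Fin N) (Fin N) ℂ) (t : ℂ) :
    M.charpoly.eval t = ∏ i, (t - eigVec M i) := by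
  have hs : M.charpoly.Splits := IsAlgClosed.splits _
  rw [hs.eval_eq_prod_roots_of_monic M.charpoly_monic]
  change (Multiset.map _ (eigenvalueMultiset M)).prod = _
  rw [← map_eigVec, Multiset.map_map]
  rfl

/-! ### Determinants of projection kernels and their integrals. -/

/-- The projection kernel `∑ l, φ l x * conj (φ l y)`. -/
noncomputable def projKernel {N : ℕ} (φ : Fin N → ℂ → ℂ) (x y : ℂ) : ℂ :=
  ∑ l, φ l x * star (φ l y)

/-- The kernel matrix at a tuple of points. -/
noncomputable def kernelMatrix {N m : ℕ} (φ : Fin N → ℂ → ℂ) (x : Fin m → ℂ) :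
    Matrix (Fin m) (Fin m) ℂ :=
  Matrix.of fun i j => projKernel φ (x i) (x j)

/-- The determinantal intensity attached to the projection kernel. -/
noncomputable def detIntensity {N m : ℕ} (φ : Fin N → ℂ → ℂ) (x : Fin m → ℂ) : ENNReal :=
  ENNReal.ofReal (kernelMatrix φ x).det.re

theorem kernelMatrix_eq_mul {N m : ℕ} (φ : Fin N → ℂ → ℂ) (x : Fin m → ℂ) :
    kernelMatrix φ x = (Matrix.of fun i l => φ l (x i)) * (Matrix.of fun i l => φ l (x i)).conjTranspose := by
  ext i j
  simp [kernelMatrix, projKernel, Matrix.mul_apply]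

theorem kernelMatrix_posSemidef {N m : ℕ} (φ : Fin N → ℂ → ℂ) (x : Fin m → ℂ) :
    (kernelMatrix φ x).PosSemidef := by
  rw [kernelMatrix_eq_mul]
  exact Matrix.posSemidef_self_mul_conjTranspose _

theorem measurable_projKernel {N : ℕ} {φ : Fin N → ℂ → ℂ} (hφ : ∀ l, Measurable (φ l)) :
    Measurable (Function.uncurry (projKernel φ)) := by
  unfold Function.uncurry projKernel
  refine Finset.measurable_sum _ fun l _ => ((hφ l).comp measurable_fst).mul ?_
  exact (continuous_star.measurable).comp ((hφ l).comp measurable_snd)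

theorem measurable_det_kernelMatrix {N m : ℕ} {φ : Fin N → ℂ → ℂ} (hφ : ∀ l, Measurable (φ l)) :
    Measurable fun x : Fin m → ℂ => (kernelMatrix φ x).det := by
  simp only [Matrix.det_apply]
  refine Finset.measurable_sum _ fun σ _ => Measurable.const_smul ?_ _
  refine Finset.measurable_prod _ fun i _ => ?_
  have : Measurable fun x : Fin m → ℂ => (x (σ i), x i) := by fun_prop
  exact (measurable_projKernel hφ).comp this

theorem measurable_detIntensity {N m : ℕ} {φ : Fin N → ℂ → ℂ} (hφ : ∀ l, Measurable (φ l)) :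
    Measurable fun x : Fin m → ℂ => detIntensity φ x :=
  (Complex.measurable_re.comp (measurable_det_kernelMatrix hφ)).ennreal_ofReal

theorem detIntensity_comp_perm {N m : ℕ} (φ : Fin N → ℂ → ℂ) (x : Fin m → ℂ)
    (σ : Equiv.Perm (Fin m)) : detIntensity φ (fun i => x (σ i)) = detIntensity φ x := by
  have : kernelMatrix φ (fun i => x (σ i)) = (kernelMatrix φ x).submatrix σ σ := rfl
  rw [detIntensity, this, Matrix.det_submatrix_equiv_self, detIntensity]

theorem kernelMatrix_snoc_submatrix {N m : ℕ} (φ : Fin N → ℂ → ℂ) (x : Fin m → ℂ) (y : ℂ) :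
    (kernelMatrix φ (Fin.snoc x y : Fin (m + 1) → ℂ)).submatrix finSumFinEquiv finSumFinEquiv =
      Matrix.fromBlocks (kernelMatrix φ x) (Matrix.of fun i (_ : Fin 1) => projKernel φ (x i) y)
        (Matrix.of fun (_ : Fin 1) j => projKernel φ y (x j))
        (Matrix.of fun (_ : Fin 1) (_ : Fin 1) => projKernel φ y y) := by
  have h1 : ∀ i : Fin m, (Fin.snoc x y : Fin (m + 1) → ℂ) (Fin.castAdd 1 i) = x i := fun i =>
    Fin.snoc_castSucc (α := fun _ => ℂ) _ _ _
  have h2 : ∀ j : Fin 1, (Fin.snoc x y : Fin (m + 1) → ℂ) (Fin.natAdd m j) = y := fun j => by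
    have : Fin.natAdd m j = Fin.last m := by ext; simp
    rw [this]
    exact Fin.snoc_last (α := fun _ => ℂ) _ _
  ext i j
  rcases i with i | i <;> rcases j with j | j <;>
    simp [kernelMatrix, h1, h2]

/-- A null vector of the smaller matrix, padded by `0`, annihilates the quadratic form of the larger
one. For a positive semidefinite matrix this forces it to be a null vector. -/
theorem det_kernelMatrix_snoc_of_det_eq_zero {N m : ℕ} (φ : Fin N → ℂ → ℂ) {x : Fin m → ℂ}
    (hx : (kernelMatrix φ x).det = 0) (y : ℂ) :
    (kernelMatrix φ (Fin.snoc x y : Fin (m + 1) → ℂ)).det = 0 := by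
  obtain ⟨v, hv0, hv⟩ := Matrix.exists_mulVec_eq_zero_iff.2 hx
  rw [← Matrix.det_submatrix_equiv_self finSumFinEquiv]
  have hpsd := ((kernelMatrix_posSemidef φ (Fin.snoc x y : Fin (m + 1) → ℂ)).submatrix
    finSumFinEquiv)
  refine Matrix.exists_mulVec_eq_zero_iff.1 ⟨Sum.elim v 0, ?_, ?_⟩
  · intro h
    apply hv0
    ext i
    exact congrFun h (Sum.inl i)
  · rw [← hpsd.dotProduct_mulVec_zero_iff, kernelMatrix_snoc_submatrix, Matrix.fromBlocks_mulVec]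
    simp [hv, Matrix.mulVec_zero, dotProduct]

/-- Orthonormality in `L²(ℂ)`. -/
structure IsOrthonormalFamily {N : ℕ} (φ : Fin N → ℂ → ℂ) : Prop where
  measurable : ∀ l, Measurable (φ l)
  integrable : ∀ l l', Integrable fun y => φ l y * star (φ l' y)
  integral_eq : ∀ l l', ∫ y, φ l y * star (φ l' y) = if l = l' then 1 else 0

namespace IsOrthonormalFamily

variable {N : ℕ} {φ : Fin N → ℂ → ℂ}

theorem integrable_diag (h : IsOrthonormalFamily φ) : Integrable fun y => projKernel φ y y :=
  integrable_finsetSum _ fun l _ => h.integrable l l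

theorem integral_diag (h : IsOrthonormalFamily φ) : ∫ y, projKernel φ y y = N := by
  simp only [projKernel]
  rw [integral_finsetSum _ fun l _ => h.integrable l l,
    Finset.sum_congr rfl fun l _ => h.integral_eq l l]
  simp

/-- This separates the `y`-dependence, so that orthonormality yields the reproducing property. -/
theorem mul_eq (φ : Fin N → ℂ → ℂ) (a b y : ℂ) : projKernel φ y a * projKernel φ b y =
    ∑ l, ∑ l', (star (φ l a) * φ l' b) * (φ l y * star (φ l' y)) := by
  simp only [projKernel, Finset.sum_mul_sum]
  exact Finset.sum_congr rfl fun l _ => Finset.sum_congr rfl fun l' _ => by ring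

theorem integrable_mul (h : IsOrthonormalFamily φ) (a b : ℂ) :
    Integrable fun y => projKernel φ y a * projKernel φ b y := by
  simp only [mul_eq]
  exact integrable_finsetSum _ fun l _ => integrable_finsetSum _ fun l' _ =>
    (h.integrable l l').const_mul _

theorem integral_mul (h : IsOrthonormalFamily φ) (a b : ℂ) :
    ∫ y, projKernel φ y a * projKernel φ b y = projKernel φ b a := by
  simp only [mul_eq]
  rw [integral_finsetSum _ fun l _ => integrable_finsetSum _ fun l' _ =>
    (h.integrable l l').const_mul _]
  have : ∀ l, ∫ y, ∑ l', (star (φ l a) * φ l' b) * (φ l y * star (φ l' y)) =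
      φ l b * star (φ l a) := by
    intro l
    rw [integral_finsetSum _ fun l' _ => (h.integrable l l').const_mul _]
    simp only [integral_const_mul, h.integral_eq]
    simp [mul_comm]
  simp_rw [this]
  rfl

/-- For invertible `A` the Schur complement gives `det A * (K(y,y) - k A⁻¹ k*)`. The diagonal
integrates to `N`, and by the reproducing property the subtracted term integrates to `tr (A A⁻¹) =
m`. -/
theorem integrable_det_snoc_and_integral (h : IsOrthonormalFamily φ) {m : ℕ} (x : Fin m → ℂ) :
    Integrable (fun y => (kernelMatrix φ (Fin.snoc x y : Fin (m + 1) → ℂ)).det) ∧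
      ∫ y, (kernelMatrix φ (Fin.snoc x y : Fin (m + 1) → ℂ)).det =
        ((N : ℂ) - m) * (kernelMatrix φ x).det := by
  by_cases hx : (kernelMatrix φ x).det = 0
  · simp [det_kernelMatrix_snoc_of_det_eq_zero φ hx, hx]
  set A := kernelMatrix φ x with hA
  have hu : IsUnit A.det := isUnit_iff_ne_zero.2 hx
  let _ : Invertible A := A.invertibleOfIsUnitDet hu
  have hdet : ∀ y, (kernelMatrix φ (Fin.snoc x y : Fin (m + 1) → ℂ)).det =
      A.det * (projKernel φ y y -
        ∑ j, ∑ i, (A⁻¹ i j) * (projKernel φ y (x i) * projKernel φ (x j) y)) := by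
    intro y
    rw [← Matrix.det_submatrix_equiv_self finSumFinEquiv, kernelMatrix_snoc_submatrix,
      Matrix.det_fromBlocks₁₁, Matrix.det_fin_one, Matrix.invOf_eq_nonsing_inv]
    simp only [Matrix.sub_apply, Matrix.mul_apply, Matrix.of_apply, Finset.sum_mul]
    congr 2
    exact Finset.sum_congr rfl fun j _ => Finset.sum_congr rfl fun i _ => by ring
  have hint : Integrable fun y => ∑ j, ∑ i, (A⁻¹ i j) *
      (projKernel φ y (x i) * projKernel φ (x j) y) :=
    integrable_finsetSum _ fun j _ => integrable_finsetSum _ fun i _ =>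
      (h.integrable_mul _ _).const_mul _
  simp only [hdet]
  refine ⟨(h.integrable_diag.sub hint).const_mul _, ?_⟩
  rw [integral_const_mul, integral_sub h.integrable_diag hint, h.integral_diag,
    integral_finsetSum _ fun j _ => integrable_finsetSum _ fun i _ =>
      (h.integrable_mul _ _).const_mul _]
  have h2 : ∑ j, ∫ y, ∑ i, (A⁻¹ i j) * (projKernel φ y (x i) * projKernel φ (x j) y) = m := by
    have h3 : ∀ j, ∫ y, ∑ i, (A⁻¹ i j) * (projKernel φ y (x i) * projKernel φ (x j) y) =
        (A * A⁻¹) j j := by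
      intro j
      rw [integral_finsetSum _ fun i _ => (h.integrable_mul _ _).const_mul _, Matrix.mul_apply]
      refine Finset.sum_congr rfl fun i _ => ?_
      rw [integral_const_mul, h.integral_mul, mul_comm]
      rfl
    simp_rw [h3, Matrix.mul_nonsing_inv A hu]
    simp
  rw [h2]
  ring

theorem lintegral_detIntensity_snoc (h : IsOrthonormalFamily φ) {m : ℕ} (hm : m ≤ N)
    (x : Fin m → ℂ) :
    ∫⁻ y, detIntensity φ (Fin.snoc x y : Fin (m + 1) → ℂ) =
      ((N - m : ℕ) : ENNReal) * detIntensity φ x := by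
  obtain ⟨h1, h2⟩ := h.integrable_det_snoc_and_integral x
  have h3 : 0 ≤ fun y : ℂ => (kernelMatrix φ (Fin.snoc x y : Fin (m + 1) → ℂ)).det.re := fun y =>
    (Complex.le_def.1 (kernelMatrix_posSemidef φ (Fin.snoc x y : Fin (m + 1) → ℂ)).det_nonneg).1
  have h4 := ofReal_integral_eq_lintegral_ofReal h1.re (ae_of_all _ h3)
  have h5 : ∫ y, RCLike.re (kernelMatrix φ (Fin.snoc x y : Fin (m + 1) → ℂ)).det =
      ((N - m : ℕ) : ℝ) * (kernelMatrix φ x).det.re := by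
    rw [integral_re h1, h2, ← Nat.cast_sub hm]
    simp
  rw [h5, ENNReal.ofReal_mul (Nat.cast_nonneg _), ENNReal.ofReal_natCast] at h4
  exact h4.symm

/-- Integrating out the last `r` variables one at a time gives the factors `N - m`, `N - m - 1`, and
so on. -/
theorem lintegral_mul_detIntensity (h : IsOrthonormalFamily φ) {m : ℕ} (r : ℕ) (hm : m + r ≤ N)
    {g : (Fin m → ℂ) → ENNReal} (hg : Measurable g) :
    ∫⁻ z : Fin (m + r) → ℂ, g (fun i => z (Fin.castAdd r i)) * detIntensity φ z =
      ((N - m).descFactorial r : ENNReal) * ∫⁻ x, g x * detIntensity φ x := by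
  induction r with
  | zero =>
    simp only [Nat.descFactorial_zero, Nat.cast_one, one_mul]
    rfl
  | succ r ih =>
    have hm1 : Measurable fun z : Fin (m + r) → ℂ => g (fun i => z (Fin.castAdd r i)) :=
      hg.comp (measurable_pi_lambda _ fun i => measurable_pi_apply _)
    have hm2 : Measurable fun z : Fin (m + r + 1) → ℂ =>
        g (fun i => z (Fin.castAdd (r + 1) i)) * detIntensity φ z :=
      (hg.comp (measurable_pi_lambda _ fun i => measurable_pi_apply _)).mul
        (measurable_detIntensity h.measurable)
    refine (lintegral_fin_snoc hm2).trans ?_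
    have hin : ∀ z : Fin (m + r) → ℂ, ∫⁻ y : ℂ,
        g (fun i => (Fin.snoc z y : Fin (m + r + 1) → ℂ) (Fin.castAdd (r + 1) i)) *
          detIntensity φ (Fin.snoc z y : Fin (m + r + 1) → ℂ) =
        ((N - (m + r) : ℕ) : ENNReal) *
          (g (fun i => z (Fin.castAdd r i)) * detIntensity φ z) := by
      intro z
      have : ∀ y : ℂ, (fun i : Fin m =>
          (Fin.snoc z y : Fin (m + r + 1) → ℂ) (Fin.castAdd (r + 1) i)) =
          fun i => z (Fin.castAdd r i) := fun y => by
        ext i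
        exact Fin.snoc_castSucc (α := fun _ => ℂ) y z (Fin.castAdd r i)
      simp_rw [this]
      have hm3 : Measurable fun y : ℂ => detIntensity φ (Fin.snoc z y : Fin (m + r + 1) → ℂ) :=
        (measurable_detIntensity h.measurable).comp <| measurable_pi_lambda _ fun i => by
          refine Fin.lastCases ?_ (fun i => ?_) i
          · simpa using measurable_id'
          · simp
      rw [lintegral_const_mul _ hm3, h.lintegral_detIntensity_snoc (by omega)]
      ring
    simp_rw [hin]
    have hm4 : Measurable fun z : Fin (m + r) → ℂ =>
        g (fun i => z (Fin.castAdd r i)) * detIntensity φ z :=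
      hm1.mul (measurable_detIntensity h.measurable)
    rw [lintegral_const_mul _ hm4, ih (by omega),
      ← mul_assoc, Nat.descFactorial_succ, Nat.cast_mul, Nat.sub_sub]

theorem exists_perm_extending {m r : ℕ} {s : Fin m → Fin (m + r)} (hs : Function.Injective s) :
    ∃ σ : Equiv.Perm (Fin (m + r)), ∀ i, σ (Fin.castAdd r i) = s i := by
  classical
  have hc : Function.Injective (Fin.castAdd r : Fin m → Fin (m + r)) := Fin.castAdd_injective m r
  let e : {x // x ∈ Set.range (Fin.castAdd r : Fin m → Fin (m + r))} ≃ {x // x ∈ Set.range s} :=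
    (Equiv.ofInjective _ hc).symm.trans (Equiv.ofInjective _ hs)
  refine ⟨e.extendSubtype, fun i => ?_⟩
  rw [e.extendSubtype_apply_of_mem _ ⟨i, rfl⟩]
  have : (Equiv.ofInjective _ hc).symm ⟨Fin.castAdd r i, ⟨i, rfl⟩⟩ = i :=
    (Equiv.ofInjective _ hc).symm_apply_apply i
  simp [e, this]

/-- Expanding the product of counts gives a sum over index maps `s`. Disjointness of the sets kills
the non-injective ones. Each injective `s` extends to a permutation, so symmetry reduces it to the
first `m` coordinates, and integrating out the rest gives `(N - m)!`. There are `N! / (N - m)!`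
injections. -/
theorem lintegral_prod_count_mul (h : IsOrthonormalFamily φ) {m : ℕ} {B : Fin m → Set ℂ}
    (hB : ∀ i, MeasurableSet (B i)) (hd : Pairwise fun i j => Disjoint (B i) (B j)) :
    ∫⁻ z : Fin N → ℂ, (∏ i, ∑ l, (B i).indicator 1 (z l)) * detIntensity φ z =
      (N.factorial : ENNReal) * ∫⁻ x in Set.univ.pi B, detIntensity φ x := by
  classical
  have hone : ∀ i, Measurable ((B i).indicator (1 : ℂ → ENNReal)) := fun i =>
    measurable_one.indicator (hB i)
  have hsum : ∀ z : Fin N → ℂ, (∏ i, ∑ l, (B i).indicator (1 : ℂ → ENNReal) (z l)) =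
      ∑ s : Fin m → Fin N with Function.Injective s, ∏ i, (B i).indicator 1 (z (s i)) := by
    intro z
    rw [Finset.prod_univ_sum, Fintype.piFinset_univ, Finset.sum_filter]
    refine Finset.sum_congr rfl fun s _ => ?_
    split_ifs with hs
    · rfl
    · rw [Function.Injective] at hs
      push Not at hs
      obtain ⟨i, j, hij, hne⟩ := hs
      by_cases hi : z (s i) ∈ B i
      · refine Finset.prod_eq_zero (Finset.mem_univ j) (Set.indicator_of_notMem ?_ _)
        rw [← hij]
        exact Set.disjoint_left.1 (hd hne) hi
      · exact Finset.prod_eq_zero (Finset.mem_univ i) (Set.indicator_of_notMem hi _)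
  simp_rw [hsum, Finset.sum_mul]
  have hmeas : ∀ s : Fin m → Fin N, Measurable fun z : Fin N → ℂ =>
      (∏ i, (B i).indicator (1 : ℂ → ENNReal) (z (s i))) * detIntensity φ z := fun s =>
    Measurable.mul (Finset.measurable_prod _ fun i _ => (hone i).comp (measurable_pi_apply _))
      (measurable_detIntensity h.measurable)
  rw [lintegral_finsetSum _ fun s _ => hmeas s]
  rcases le_or_gt m N with hmN | hmN
  · obtain ⟨r, rfl⟩ := Nat.exists_eq_add_of_le hmN
    let g : (Fin m → ℂ) → ENNReal := fun x => ∏ i, (B i).indicator 1 (x i)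
    have hg : Measurable g := Finset.measurable_prod _ fun i _ => (hone i).comp (measurable_pi_apply _)
    have hgB : ∫⁻ x, g x * detIntensity φ x = ∫⁻ x in Set.univ.pi B, detIntensity φ x := by
      rw [← lintegral_indicator (.univ_pi hB)]
      refine lintegral_congr fun x => ?_
      by_cases hx : x ∈ Set.univ.pi B
      · rw [Set.indicator_of_mem hx]
        have : g x = 1 := Finset.prod_eq_one fun i _ => by
          rw [Set.indicator_of_mem (hx i trivial)]; rfl
        rw [this, one_mul]
      · rw [Set.indicator_of_notMem hx]
        simp only [Set.mem_pi, Set.mem_univ, true_implies, not_forall] at hx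
        obtain ⟨i, hi⟩ := hx
        have : g x = 0 := Finset.prod_eq_zero (Finset.mem_univ i) (Set.indicator_of_notMem hi _)
        rw [this, zero_mul]
    have hterm : ∀ s ∈ (Finset.univ.filter fun s : Fin m → Fin (m + r) => Function.Injective s),
        ∫⁻ z : Fin (m + r) → ℂ, (∏ i, (B i).indicator 1 (z (s i))) * detIntensity φ z =
          (r.factorial : ENNReal) * ∫⁻ x in Set.univ.pi B, detIntensity φ x := by
      intro s hs
      obtain ⟨σ, hσ⟩ := exists_perm_extending (Finset.mem_filter.1 hs).2
      have h1 := lintegral_comp_perm σ fun z : Fin (m + r) → ℂ =>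
        g (fun i => z (Fin.castAdd r i)) * detIntensity φ z
      have h2 := h.lintegral_mul_detIntensity r le_rfl hg
      rw [hgB, Nat.add_sub_cancel_left, Nat.descFactorial_self] at h2
      rw [← h2, ← h1]
      refine lintegral_congr fun z => ?_
      simp only [detIntensity_comp_perm, g, hσ]
    rw [Finset.sum_congr rfl hterm, Finset.sum_const, nsmul_eq_mul, ← mul_assoc]
    congr 1
    have hcard : (Finset.univ.filter fun s : Fin m → Fin (m + r) => Function.Injective s).card =
        (m + r).descFactorial m := by
      rw [← Fintype.card_subtype,
        Fintype.card_congr (Equiv.subtypeInjectiveEquivEmbedding (Fin m) (Fin (m + r))),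
        Fintype.card_embedding_eq, Fintype.card_fin, Fintype.card_fin]
    rw [hcard, ← Nat.cast_mul, mul_comm]
    congr 1
    have := Nat.factorial_mul_descFactorial (n := m + r) (k := m) (by omega)
    rwa [Nat.add_sub_cancel_left] at this
  · have hemp : (Finset.univ.filter fun s : Fin m → Fin N => Function.Injective s) = ∅ := by
      refine Finset.filter_eq_empty_iff.2 fun s _ hs => ?_
      have := Fintype.card_le_of_injective s hs
      simp at this
      omega
    -- The kernel matrix factors through `ℂ^N`, so for `m > N` its rank is too small.
    have hz : ∀ x : Fin m → ℂ, detIntensity φ x = 0 := by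
      intro x
      have hdet : (kernelMatrix φ x).det = 0 := by
        by_contra hne
        have h1 := Matrix.rank_of_isUnit (kernelMatrix φ x)
          ((Matrix.isUnit_iff_isUnit_det _).2 (isUnit_iff_ne_zero.2 hne))
        have h2 := (Matrix.rank_mul_le_left (Matrix.of fun i l => φ l (x i))
          (Matrix.of fun i l => φ l (x i)).conjTranspose).trans (Matrix.rank_le_width _)
        rw [← kernelMatrix_eq_mul, h1, Fintype.card_fin] at h2
        omega
      simp [detIntensity, hdet]
    simp [hemp, hz]

end IsOrthonormalFamily

/-! ### Moments of the weight and the orthonormal monomials. -/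

theorem integral_norm_pow_mul_exp_pos (n : ℕ) :
    0 < ∫ z : ℂ, ‖z‖ ^ n * Real.exp (-‖z‖ ^ 2) := by
  have h := Complex.integral_rpow_mul_exp_neg_rpow (p := 2) (q := n) (by norm_num)
    (by have : (0 : ℝ) ≤ n := Nat.cast_nonneg n
        linarith)
  simp only [Real.rpow_natCast, Real.rpow_ofNat] at h
  rw [h]
  have : (0 : ℝ) ≤ n := Nat.cast_nonneg n
  have := Real.Gamma_pos_of_pos (s := ((n : ℝ) + 2) / 2) (by positivity)
  positivity

/-- The Bochner integral of a non-integrable function is `0` by convention, which the strict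
positivity just proved excludes. -/
theorem integrable_norm_pow_mul_exp (n : ℕ) :
    Integrable fun z : ℂ => ‖z‖ ^ n * Real.exp (-‖z‖ ^ 2) := by
  by_contra h
  exact (integral_norm_pow_mul_exp_pos n).ne' (integral_undef h)

theorem integrable_monomial_mul_exp (a b d : ℕ) :
    Integrable fun z : ℂ =>
      z ^ a * star z ^ b * ((‖z‖ ^ (2 * d) * Real.exp (-‖z‖ ^ 2) : ℝ) : ℂ) := by
  refine (integrable_norm_pow_mul_exp (a + b + 2 * d)).mono' (by fun_prop) ?_
  refine Filter.Eventually.of_forall fun z => le_of_eq ?_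
  rw [norm_mul, norm_mul, norm_pow, norm_pow, norm_star, Complex.norm_real, Real.norm_of_nonneg
    (by positivity), pow_add, pow_add]
  ring

/-- The rotation by `θ = π / (a - b)` multiplies `z ^ a * star z ^ b` by `-1` and preserves the
radial factor and Lebesgue measure, so the integral equals its own negative. -/
theorem integral_monomial_mul_exp_of_ne {a b : ℕ} (hab : a ≠ b) (d : ℕ) :
    ∫ z : ℂ, z ^ a * star z ^ b * ((‖z‖ ^ (2 * d) * Real.exp (-‖z‖ ^ 2) : ℝ) : ℂ) = 0 := by
  set F : ℂ → ℂ := fun z => z ^ a * star z ^ b * ((‖z‖ ^ (2 * d) * Real.exp (-‖z‖ ^ 2) : ℝ) : ℂ)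
  let θ : ℝ := Real.pi / ((a : ℝ) - b)
  have hne : (a : ℝ) - b ≠ 0 := sub_ne_zero.2 (by exact_mod_cast hab)
  let c : Circle := Circle.exp θ
  have hc : (c : ℂ) ^ a * star (c : ℂ) ^ b = -1 := by
    have h1 : (c : ℂ) = Complex.exp (θ * Complex.I) := Circle.coe_exp θ
    have h2 : star (c : ℂ) = Complex.exp (-(θ * Complex.I)) := by
      rw [h1, Complex.star_def, ← Complex.exp_conj]
      simp
    rw [h2, h1, ← Complex.exp_nat_mul, ← Complex.exp_nat_mul, ← Complex.exp_add]
    have : (a : ℂ) * (θ * Complex.I) + b * -(θ * Complex.I) = Real.pi * Complex.I := by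
      have h3 : ((a : ℂ) - b) * θ = Real.pi := by
        have : ((a : ℝ) - b) * θ = Real.pi := mul_div_cancel₀ _ hne
        exact_mod_cast this
      rw [← h3]; ring
    rw [this, Complex.exp_pi_mul_I]
  have hrot := (rotation c).measurePreserving.integral_comp
    (rotation c).toHomeomorph.measurableEmbedding F
  have hF : ∀ z, F (rotation c z) = -F z := by
    intro z
    simp only [F, rotation_apply, mul_pow, star_mul', norm_mul, Circle.norm_coe, one_mul]
    linear_combination (z ^ a * star z ^ b *
      ((‖z‖ ^ (2 * d) * Real.exp (-‖z‖ ^ 2) : ℝ) : ℂ)) * hc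
  simp_rw [hF, integral_neg] at hrot
  exact self_eq_neg.1 hrot.symm

/-- The density on `ℂ^k` whose image under the product map defines the weight. -/
noncomputable def baseDensity {k : ℕ} (d : Fin k → ℕ) (x : Fin k → ℂ) : ℝ :=
  Real.exp (-∑ j, ‖x j‖ ^ 2) * ∏ j, ‖x j‖ ^ (2 * d j)

theorem baseDensity_eq_prod {k : ℕ} (d : Fin k → ℕ) (x : Fin k → ℂ) :
    baseDensity d x = ∏ j, (‖x j‖ ^ (2 * d j) * Real.exp (-‖x j‖ ^ 2)) := by
  rw [baseDensity, Finset.prod_mul_distrib, ← Real.exp_sum, Finset.sum_neg_distrib, mul_comm]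

theorem baseDensity_nonneg {k : ℕ} (d : Fin k → ℕ) (x : Fin k → ℂ) : 0 ≤ baseDensity d x := by
  rw [baseDensity]; positivity

theorem continuous_baseDensity {k : ℕ} (d : Fin k → ℕ) : Continuous (baseDensity d) := by
  unfold baseDensity; fun_prop

/-- The measure on `ℂ^k` whose image under the product map defines the weight. -/
noncomputable def baseMeasure {k : ℕ} (d : Fin k → ℕ) : Measure (Fin k → ℂ) :=
  volume.withDensity fun x => ENNReal.ofReal (baseDensity d x)

theorem integrable_baseDensity {k : ℕ} (d : Fin k → ℕ) : Integrable (baseDensity d) := by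
  have : baseDensity d = fun x => ∏ j, (‖x j‖ ^ (2 * d j) * Real.exp (-‖x j‖ ^ 2)) :=
    funext (baseDensity_eq_prod d)
  rw [this]
  exact Integrable.fintype_prod_dep
    (f := fun (j : Fin k) (z : ℂ) => ‖z‖ ^ (2 * d j) * Real.exp (-‖z‖ ^ 2))
    fun j => integrable_norm_pow_mul_exp _

instance isFiniteMeasure_baseMeasure {k : ℕ} (d : Fin k → ℕ) : IsFiniteMeasure (baseMeasure d) :=
  isFiniteMeasure_withDensity_ofReal (integrable_baseDensity d).2

/-- The mixed moments of the weight. -/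
noncomputable def weightMoment {k : ℕ} (d : Fin k → ℕ) (l : ℕ) : ℝ :=
  ∏ j, ∫ z : ℂ, ‖z‖ ^ (2 * l + 2 * d j) * Real.exp (-‖z‖ ^ 2)

theorem weightMoment_pos {k : ℕ} (d : Fin k → ℕ) (l : ℕ) : 0 < weightMoment d l :=
  Finset.prod_pos fun _ _ => integral_norm_pow_mul_exp_pos _

theorem measurable_finProd (k : ℕ) : Measurable fun x : Fin k → ℂ => ∏ j, x j :=
  Finset.measurable_prod _ fun i _ => measurable_pi_apply i

theorem integrable_monomial_baseMeasure {k : ℕ} (d : Fin k → ℕ) (a b : ℕ) :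
    Integrable (fun x => (∏ j, x j) ^ a * star (∏ j, x j) ^ b) (baseMeasure d) ∧
      ∫ x, (∏ j, x j) ^ a * star (∏ j, x j) ^ b ∂(baseMeasure d) =
        ∏ j, ∫ z : ℂ, z ^ a * star z ^ b * ((‖z‖ ^ (2 * d j) * Real.exp (-‖z‖ ^ 2) : ℝ) : ℂ) := by
  have hm : Measurable fun x => (baseDensity d x).toNNReal :=
    (continuous_baseDensity d).measurable.real_toNNReal
  have heq : ∀ x : Fin k → ℂ, (baseDensity d x).toNNReal •
      ((∏ j, x j) ^ a * star (∏ j, x j) ^ b) =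
      ∏ j, (x j ^ a * star (x j) ^ b * ((‖x j‖ ^ (2 * d j) * Real.exp (-‖x j‖ ^ 2) : ℝ) : ℂ)) := by
    intro x
    rw [NNReal.smul_def, Real.coe_toNNReal _ (baseDensity_nonneg d x), baseDensity_eq_prod,
      Complex.real_smul, Complex.ofReal_prod, Finset.prod_mul_distrib, Finset.prod_mul_distrib,
      Finset.prod_pow, Finset.prod_pow, star_prod, mul_comm]
  have hb : baseMeasure d = volume.withDensity fun x => ((baseDensity d x).toNNReal : ENNReal) :=
    rfl
  constructor
  · rw [hb, integrable_withDensity_iff_integrable_smul hm]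
    simp_rw [heq]
    exact Integrable.fintype_prod_dep
      (f := fun (j : Fin k) (z : ℂ) =>
        z ^ a * star z ^ b * ((‖z‖ ^ (2 * d j) * Real.exp (-‖z‖ ^ 2) : ℝ) : ℂ))
      fun j => integrable_monomial_mul_exp a b (d j)
  · rw [hb, integral_withDensity_eq_integral_smul hm]
    simp_rw [heq]
    exact integral_fintype_prod_eq_prod (fun (j : Fin k) (z : ℂ) =>
        z ^ a * star z ^ b * ((‖z‖ ^ (2 * d j) * Real.exp (-‖z‖ ^ 2) : ℝ) : ℂ))

theorem integral_monomial_baseMeasure {k : ℕ} (hk : 1 ≤ k) (d : Fin k → ℕ) (a b : ℕ) :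
    ∫ x, (∏ j, x j) ^ a * star (∏ j, x j) ^ b ∂(baseMeasure d) =
      if a = b then (weightMoment d a : ℂ) else 0 := by
  rw [(integrable_monomial_baseMeasure d a b).2]
  split_ifs with h
  · subst h
    rw [weightMoment, Complex.ofReal_prod]
    refine Finset.prod_congr rfl fun j _ => ?_
    rw [← integral_complex_ofReal]
    refine integral_congr_ae (Filter.Eventually.of_forall fun z => ?_)
    have : z ^ a * star z ^ a = ((‖z‖ ^ (2 * a) : ℝ) : ℂ) := by
      rw [← mul_pow, Complex.star_def, Complex.mul_conj', pow_mul]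
      push_cast
      rfl
    simp only [this, pow_add]
    push_cast
    ring
  -- Here `1 ≤ k` matters: an empty product would not vanish.
  · exact Finset.prod_eq_zero (Finset.mem_univ ⟨0, hk⟩) (integral_monomial_mul_exp_of_ne h _)

/-- The weight condition in terms of the exponents `d j = n j - n 0`. -/
abbrev IsProdWeight {k : ℕ} (d : Fin k → ℕ) (w : ℂ → ℝ) : Prop :=
  IsFiberWeight (fun x : Fin k → ℂ => ∏ j, x j) (baseDensity d) w

namespace IsProdWeight

variable {k : ℕ} {d : Fin k → ℕ} {w : ℂ → ℝ}

theorem map_baseMeasure (h : IsProdWeight d w) :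
    (baseMeasure d).map (fun x => ∏ j, x j) = volume.withDensity fun z => ENNReal.ofReal (w z) :=
  h.map_eq

theorem lintegral_eq (h : IsProdWeight d w) {F : ℂ → ENNReal} (hF : Measurable F) :
    ∫⁻ x : Fin k → ℂ, ENNReal.ofReal (baseDensity d x) * F (∏ j, x j) =
      ∫⁻ z, ENNReal.ofReal (w z) * F z := by
  have h1 : ∫⁻ z, F z ∂(volume.withDensity fun z => ENNReal.ofReal (w z)) =
      ∫⁻ z, ENNReal.ofReal (w z) * F z :=
    lintegral_withDensity_eq_lintegral_mul _ h.measurable.ennreal_ofReal hF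
  rw [← h1, ← h.map_baseMeasure, lintegral_map hF (measurable_finProd k)]
  exact (lintegral_withDensity_eq_lintegral_mul _
    (continuous_baseDensity d).measurable.ennreal_ofReal (hF.comp (measurable_finProd k))).symm

theorem integrable_and_integral_monomial (h : IsProdWeight d w) (hk : 1 ≤ k) (a b : ℕ) :
    Integrable (fun z : ℂ => (w z : ℂ) * (z ^ a * star z ^ b)) ∧
      ∫ z : ℂ, (w z : ℂ) * (z ^ a * star z ^ b) =
        if a = b then (weightMoment d a : ℂ) else 0 := by
  have hm : Measurable fun z => (w z).toNNReal := h.measurable.real_toNNReal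
  have heq : ∀ z : ℂ, (w z : ℂ) * (z ^ a * star z ^ b) =
      (w z).toNNReal • (z ^ a * star z ^ b) := fun z => by
    rw [NNReal.smul_def, Real.coe_toNNReal _ (h.nonneg z), Complex.real_smul]
  have hb : (baseMeasure d).map (fun x => ∏ j, x j) =
      volume.withDensity fun z => ((w z).toNNReal : ENNReal) := h.map_baseMeasure
  have hcont : Measurable fun z : ℂ => z ^ a * star z ^ b := by fun_prop
  simp_rw [heq]
  rw [← integrable_withDensity_iff_integrable_smul hm, ← integral_withDensity_eq_integral_smul hm,
    ← hb, integral_map (measurable_finProd k).aemeasurable hcont.aestronglyMeasurable,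
    integrable_map_measure hcont.aestronglyMeasurable (measurable_finProd k).aemeasurable]
  exact ⟨(integrable_monomial_baseMeasure d a b).1, integral_monomial_baseMeasure hk d a b⟩

end IsProdWeight

/-- The orthonormal functions `√(w / h_l) z ^ l` of the weight `w`. -/
noncomputable def weightFun {k : ℕ} (d : Fin k → ℕ) (w : ℂ → ℝ) (N : ℕ) (l : Fin N) (z : ℂ) : ℂ :=
  ((Real.sqrt (w z) * (Real.sqrt (weightMoment d l))⁻¹ : ℝ) : ℂ) * z ^ (l : ℕ)

/-- Putting `√w` into the functions makes them orthonormal for Lebesgue measure, which is the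
reference measure of the intensities. -/
theorem IsProdWeight.isOrthonormalFamily {k : ℕ} {d : Fin k → ℕ} {w : ℂ → ℝ}
    (h : IsProdWeight d w) (hk : 1 ≤ k) (N : ℕ) : IsOrthonormalFamily (weightFun d w N) := by
  have heq : ∀ (l l' : Fin N) (z : ℂ), weightFun d w N l z * star (weightFun d w N l' z) =
      (((Real.sqrt (weightMoment d l))⁻¹ * (Real.sqrt (weightMoment d l'))⁻¹ : ℝ) : ℂ) *
        ((w z : ℂ) * (z ^ (l : ℕ) * star z ^ (l' : ℕ))) := by
    intro l l' z
    have hw : ((Real.sqrt (w z) : ℝ) : ℂ) * ((Real.sqrt (w z) : ℝ) : ℂ) = (w z : ℂ) := by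
      rw [← Complex.ofReal_mul, Real.mul_self_sqrt (h.nonneg z)]
    simp only [weightFun, star_mul', star_pow, Complex.star_def, Complex.conj_ofReal]
    push_cast
    rw [← hw]
    ring
  refine ⟨fun l => ?_, fun l l' => ?_, fun l l' => ?_⟩
  · have := h.measurable
    unfold weightFun
    fun_prop
  · simp_rw [heq]
    exact (h.integrable_and_integral_monomial hk _ _).1.const_mul _
  · simp_rw [heq]
    rw [integral_const_mul, (h.integrable_and_integral_monomial hk _ _).2]
    by_cases hl : l = l'
    · subst hl
      have := weightMoment_pos d l
      rw [if_pos rfl, if_pos rfl, ← mul_inv, Real.mul_self_sqrt this.le, ← Complex.ofReal_mul,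
        inv_mul_cancel₀ this.ne', Complex.ofReal_one]
    · rw [if_neg (fun h => hl (Fin.ext h)), if_neg hl, mul_zero]

/-- The unnormalized joint density of the points. -/
noncomputable def weightDensity (w : ℂ → ℝ) {N : ℕ} (z : Fin N → ℂ) : ℝ :=
  (∏ l, w (z l)) * ∏ i, ∏ j ∈ Finset.Ioi i, ‖z i - z j‖ ^ 2

/-- The matrix of function values is a Vandermonde matrix between two diagonal ones, and the kernel
matrix is this matrix times its adjoint. -/
theorem IsProdWeight.ofReal_weightDensity {k : ℕ} {d : Fin k → ℕ} {w : ℂ → ℝ}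
    (h : IsProdWeight d w) {N : ℕ} (z : Fin N → ℂ) :
    ENNReal.ofReal (weightDensity w z) =
      ENNReal.ofReal (∏ l : Fin N, weightMoment d l) * detIntensity (weightFun d w N) z := by
  have hp : 0 < ∏ l : Fin N, weightMoment d l := Finset.prod_pos fun l _ => weightMoment_pos d l
  rw [detIntensity, ← ENNReal.ofReal_mul hp.le]
  congr 1
  have hmat : (Matrix.of fun (i l : Fin N) => weightFun d w N l (z i)) =
      Matrix.diagonal (fun i => ((Real.sqrt (w (z i)) : ℝ) : ℂ)) * Matrix.vandermonde z *
        Matrix.diagonal (fun l : Fin N => (((Real.sqrt (weightMoment d l))⁻¹ : ℝ) : ℂ)) := by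
    ext i l
    rw [Matrix.mul_diagonal, Matrix.diagonal_mul, Matrix.vandermonde_apply]
    simp only [weightFun, Matrix.of_apply]
    push_cast
    ring
  have hdet : (kernelMatrix (weightFun d w N) z).det =
      ((‖(Matrix.of fun (i l : Fin N) => weightFun d w N l (z i)).det‖ ^ 2 : ℝ) : ℂ) := by
    rw [kernelMatrix_eq_mul, Matrix.det_mul, Matrix.det_conjTranspose, Complex.star_def,
      Complex.mul_conj']
    push_cast
    rfl
  rw [hdet, Complex.ofReal_re, hmat, Matrix.det_mul, Matrix.det_mul, Matrix.det_diagonal,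
    Matrix.det_diagonal, Matrix.det_vandermonde, norm_mul, norm_mul, mul_pow, mul_pow, norm_prod,
    norm_prod, norm_prod, ← Finset.prod_pow, ← Finset.prod_pow, ← Finset.prod_pow, weightDensity]
  have h1 : ∀ i, ‖((Real.sqrt (w (z i)) : ℝ) : ℂ)‖ ^ 2 = w (z i) := fun i => by
    rw [Complex.norm_real, Real.norm_of_nonneg (Real.sqrt_nonneg _), Real.sq_sqrt (h.nonneg _)]
  have h2 : ∀ l : Fin N, ‖(((Real.sqrt (weightMoment d l))⁻¹ : ℝ) : ℂ)‖ ^ 2 =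
      (weightMoment d l)⁻¹ := fun l => by
    rw [Complex.norm_real, Real.norm_of_nonneg (by positivity), inv_pow,
      Real.sq_sqrt (weightMoment_pos d l).le]
  have h3 : ∀ i, ‖∏ j ∈ Finset.Ioi i, (z j - z i)‖ ^ 2 =
      ∏ j ∈ Finset.Ioi i, ‖z i - z j‖ ^ 2 := fun i => by
    rw [norm_prod, ← Finset.prod_pow]
    exact Finset.prod_congr rfl fun j _ => by rw [norm_sub_rev]
  simp_rw [h1, h2, h3]
  rw [Finset.prod_inv_distrib]
  field_simp

theorem measurable_weightDensity {w : ℂ → ℝ} (hw : Measurable w) (N : ℕ) :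
    Measurable fun z : Fin N → ℂ => weightDensity w z := by
  unfold weightDensity
  fun_prop

theorem IsProdWeight.lintegral_weightDensity {k : ℕ} {d : Fin k → ℕ} {w : ℂ → ℝ}
    (h : IsProdWeight d w) (hk : 1 ≤ k) (N : ℕ) :
    ∫⁻ z : Fin N → ℂ, ENNReal.ofReal (weightDensity w z) =
      ENNReal.ofReal (∏ l : Fin N, weightMoment d l) * N.factorial := by
  have ho := h.isOrthonormalFamily hk N
  simp_rw [h.ofReal_weightDensity]
  rw [lintegral_const_mul _ (measurable_detIntensity ho.measurable)]
  -- With no counting sets, the counting formula is the statement about the total mass.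
  have := ho.lintegral_prod_count_mul (B := (Fin.elim0 : Fin 0 → Set ℂ)) (fun i => i.elim0)
    (fun i => i.elim0)
  simp only [Finset.univ_eq_empty, Finset.prod_empty, one_mul] at this
  rw [this]
  simp [detIntensity, volume_pi]

/-- For almost all values of the other coordinates the product is a nonzero multiple of the first
one, and such a dilation pulls null sets back to null sets. -/
theorem volume_preimage_finProd_eq_zero {k : ℕ} (hk : 1 ≤ k) {s : Set ℂ} (hs : MeasurableSet s)
    (h0 : volume s = 0) : volume ((fun x : Fin k → ℂ => ∏ j, x j) ⁻¹' s) = 0 := by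
  obtain ⟨k, rfl⟩ := Nat.exists_eq_add_of_le' hk
  have hm : MeasurableSet ((fun x : Fin (k + 1) → ℂ => ∏ j, x j) ⁻¹' s) :=
    measurable_finProd (k + 1) hs
  rw [← lintegral_indicator_one hm, lintegral_fin_cons (measurable_one.indicator hm)]
  have hm2 : Measurable (fun p : ℂ × (Fin k → ℂ) =>
      ((fun x : Fin (k + 1) → ℂ => ∏ j, x j) ⁻¹' s).indicator (1 : (Fin (k + 1) → ℂ) → ENNReal)
        (Fin.cons p.1 p.2)) := by
    refine (measurable_one.indicator hm).comp (measurable_pi_lambda _ fun i => ?_)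
    refine Fin.cases ?_ (fun i => ?_) i
    · simpa using measurable_fst
    · simp only [Fin.cons_succ]
      exact (measurable_pi_apply i).comp measurable_snd
  rw [lintegral_lintegral_swap hm2.aemeasurable]
  have hne : ∀ᵐ z : Fin k → ℂ, ∏ j, z j ≠ 0 := by
    have : ∀ j : Fin k, ∀ᵐ z : Fin k → ℂ, z j ≠ 0 := fun j =>
      ae_ne_zero_of_differentiable volume (q := fun z : Fin k → ℂ => z j) (x₀ := fun _ => 1)
        (by fun_prop) one_ne_zero
    filter_upwards [ae_all_iff.2 this] with z hz
    exact Finset.prod_ne_zero_iff.2 fun j _ => hz j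
  rw [lintegral_eq_zero_iff' hm2.lintegral_prod_left'.aemeasurable]
  filter_upwards [hne] with z hz
  have hset : ∀ x : ℂ, ((fun x : Fin (k + 1) → ℂ => ∏ j, x j) ⁻¹' s).indicator
      (1 : (Fin (k + 1) → ℂ) → ENNReal) (Fin.cons x z) =
      ((fun x : ℂ => x * ∏ j, z j) ⁻¹' s).indicator 1 x := by
    intro x
    have hmem : (Fin.cons x z : Fin (k + 1) → ℂ) ∈ ((fun x : Fin (k + 1) → ℂ => ∏ j, x j) ⁻¹' s) ↔
        x ∈ ((fun x : ℂ => x * ∏ j, z j) ⁻¹' s) := by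
      change (∏ j, (Fin.cons x z : Fin (k + 1) → ℂ) j) ∈ s ↔ x * ∏ j, z j ∈ s
      rw [Fin.prod_univ_succ]
      simp
    by_cases hx : x ∈ ((fun x : ℂ => x * ∏ j, z j) ⁻¹' s)
    · rw [Set.indicator_of_mem hx, Set.indicator_of_mem (hmem.2 hx)]
      rfl
    · rw [Set.indicator_of_notMem hx, Set.indicator_of_notMem (mt hmem.1 hx)]
  simp_rw [hset]
  have hms : MeasurableSet ((fun x : ℂ => x * ∏ j, z j) ⁻¹' s) :=
    (measurable_id'.mul_const (∏ j, z j)) hs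
  rw [lintegral_indicator_one hms]
  have hae : ∀ᵐ y : ℂ, y ∉ s := measure_eq_zero_iff_ae_notMem.1 h0
  let L : ℂ ≃ₗ[ℝ] ℂ := (LinearEquiv.smulOfNeZero ℂ ℂ (∏ j, z j) hz).restrictScalars ℝ
  have := ae_of_ae_linearEquiv L volume volume hae
  refine measure_eq_zero_iff_ae_notMem.2 ?_
  filter_upwards [this] with x hx hx'
  apply hx
  simpa [L, mul_comm] using hx'

/-- The weight is a Radon–Nikodym derivative, taken real-valued; the pushforward is finite, so the
derivative is finite almost everywhere. -/
theorem exists_isProdWeight {k : ℕ} (hk : 1 ≤ k) (d : Fin k → ℕ) : ∃ w, IsProdWeight d w := by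
  let μ := (baseMeasure d).map (fun x => ∏ j, x j)
  have hac : μ ≪ volume := by
    refine Measure.AbsolutelyContinuous.mk fun s hs h0 => ?_
    rw [Measure.map_apply (measurable_finProd k) hs]
    exact withDensity_absolutelyContinuous _ _ (volume_preimage_finProd_eq_zero hk hs h0)
  refine ⟨fun z => (μ.rnDeriv volume z).toReal, ?_, fun z => ENNReal.toReal_nonneg, ?_⟩
  · exact (Measure.measurable_rnDeriv _ _).ennreal_toReal
  · change μ = _
    conv_lhs => rw [← Measure.withDensity_rnDeriv_eq μ volume hac]
    refine withDensity_congr_ae ?_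
    filter_upwards [Measure.rnDeriv_lt_top μ volume] with z hz
    rw [ENNReal.ofReal_toReal hz.ne]

/-! ### Products along a chain and cyclic conjugation. -/

section chains

open Matrix

/-- The product `A j * A (j+1) * ⋯ * A (k-1)`. -/
def suffixProd {k : ℕ} {n : Fin (k + 1) → ℕ}
    (A : (i : Fin k) → Matrix (Fin (n i.castSucc)) (Fin (n i.succ)) ℂ) (j : Fin (k + 1)) :
    Matrix (Fin (n j)) (Fin (n (Fin.last k))) ℂ :=
  Fin.reverseInduction (motive := fun j => Matrix (Fin (n j)) (Fin (n (Fin.last k))) ℂ)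
    (1 : Matrix (Fin (n (Fin.last k))) (Fin (n (Fin.last k))) ℂ) (fun i M => A i * M) j

section suffixProd

variable {k : ℕ} {n : Fin (k + 1) → ℕ}
  (A : (i : Fin k) → Matrix (Fin (n i.castSucc)) (Fin (n i.succ)) ℂ)

theorem suffixProd_last : suffixProd A (Fin.last k) = 1 := by
  simp [suffixProd]

theorem suffixProd_castSucc (i : Fin k) :
    suffixProd A i.castSucc = A i * suffixProd A i.succ := by
  simp [suffixProd]

/-- `suffixProd` grows on the left and `rectProd` on the right; this reconciles the two recursions.
-/
theorem suffixProd_castSucc_eq_mul {k : ℕ} {n : Fin (k + 2) → ℕ}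
    (A : (i : Fin (k + 1)) → Matrix (Fin (n i.castSucc)) (Fin (n i.succ)) ℂ) (j : Fin (k + 1)) :
    suffixProd A j.castSucc =
      suffixProd (n := fun i => n i.castSucc) (fun i : Fin k => A i.castSucc) j *
        A (Fin.last k) := by
  induction j using Fin.reverseInduction with
  | last =>
    rw [suffixProd_castSucc, suffixProd_last, Matrix.one_mul]
    exact (congrArg _ (suffixProd_last A)).trans (Matrix.mul_one _)
  | cast i ih =>
    rw [suffixProd_castSucc, suffixProd_castSucc, Matrix.mul_assoc, ← ih]
    rfl

theorem suffixProd_zero : suffixProd A 0 = rectProd k n A := by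
  induction k with
  | zero => exact suffixProd_last A
  | succ k ih =>
    rw [rectProd, ← ih]
    exact suffixProd_castSucc_eq_mul A 0

theorem suffixProd_conj {P P' : (j : Fin (k + 1)) → Matrix (Fin (n j)) (Fin (n j)) ℂ}
    (hP : ∀ j, P' j * P j = 1) (j : Fin (k + 1)) :
    suffixProd (fun i => P i.castSucc * A i * P' i.succ) j =
      P j * suffixProd A j * P' (Fin.last k) := by
  induction j using Fin.reverseInduction with
  | last =>
    rw [suffixProd_last, suffixProd_last, Matrix.mul_one, mul_eq_one_comm.1 (hP _)]
  | cast i ih =>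
    rw [suffixProd_castSucc, suffixProd_castSucc, ih]
    calc P i.castSucc * A i * P' i.succ * (P i.succ * suffixProd A i.succ * P' (Fin.last k))
        = P i.castSucc * A i * (P' i.succ * P i.succ) * suffixProd A i.succ * P' (Fin.last k) := by
          simp only [Matrix.mul_assoc]
      _ = _ := by rw [hP, Matrix.mul_one]; simp only [Matrix.mul_assoc]

theorem squareProd_eq (h : n (Fin.last k) = n 0) :
    squareProd h A = (suffixProd A 0).submatrix id (Fin.cast h.symm) := by
  rw [suffixProd_zero, squareProd]

/-- The factors at the interior vertices telescope. The condition at the ends identifies the last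
conjugating matrix with the first, so the product undergoes a similarity. -/
theorem charpoly_squareProd_conj (h : n (Fin.last k) = n 0)
    {P P' : (j : Fin (k + 1)) → Matrix (Fin (n j)) (Fin (n j)) ℂ} (hP : ∀ j, P' j * P j = 1)
    (hlast : (P' (Fin.last k)).submatrix (Fin.cast h.symm) (Fin.cast h.symm) = P' 0) :
    (squareProd h (fun i => P i.castSucc * A i * P' i.succ)).charpoly =
      (squareProd h A).charpoly := by
  have h1 : squareProd h (fun i => P i.castSucc * A i * P' i.succ) =
      P 0 * squareProd h A * P' 0 := by
    rw [squareProd_eq, squareProd_eq, suffixProd_conj A hP, ← hlast]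
    have := Matrix.submatrix_mul_equiv (P 0 * suffixProd A 0) (P' (Fin.last k)) id
      (finCongr h.symm) (finCongr h.symm)
    exact this.symm
  rw [h1, Matrix.mul_assoc, Matrix.charpoly_mul_comm, Matrix.mul_assoc, hP, Matrix.mul_one]

end suffixProd

/-! ### Bordered matrices and shears. -/

section block

/-- The `(p+1) × (q+1)` matrix with blocks `a, w, c, D`. -/
def block {p q : ℕ} (a : ℂ) (w : Fin q → ℂ) (c : Fin p → ℂ) (D : Matrix (Fin p) (Fin q) ℂ) :
    Matrix (Fin (p + 1)) (Fin (q + 1)) ℂ :=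
  Matrix.of (Fin.cons (Fin.cons a w : Fin (q + 1) → ℂ) fun i => Fin.cons (c i) (D i))

variable {p q r : ℕ} (a : ℂ) (w : Fin q → ℂ) (c : Fin p → ℂ) (D : Matrix (Fin p) (Fin q) ℂ)

@[simp] theorem block_zero_zero : block a w c D 0 0 = a := rfl
@[simp] theorem block_zero_succ (j) : block a w c D 0 (Fin.succ j) = w j := rfl
@[simp] theorem block_succ_zero (i) : block a w c D (Fin.succ i) 0 = c i := rfl
@[simp] theorem block_succ_succ (i j) : block a w c D (Fin.succ i) (Fin.succ j) = D i j := rfl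

theorem block_ext {M M' : Matrix (Fin (p + 1)) (Fin (q + 1)) ℂ} (h00 : M 0 0 = M' 0 0)
    (h0 : ∀ j : Fin q, M 0 j.succ = M' 0 j.succ) (h1 : ∀ i : Fin p, M i.succ 0 = M' i.succ 0)
    (h2 : ∀ (i : Fin p) (j : Fin q), M i.succ j.succ = M' i.succ j.succ) : M = M' := by
  ext i j
  refine Fin.cases ?_ (fun i => ?_) i <;> refine Fin.cases ?_ (fun j => ?_) j
  · exact h00
  · exact h0 j
  · exact h1 i
  · exact h2 i j

theorem block_mul (a' : ℂ) (w' : Fin r → ℂ) (c' : Fin q → ℂ) (D' : Matrix (Fin q) (Fin r) ℂ) :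
    block a w c D * block a' w' c' D' =
      block (a * a' + w ⬝ᵥ c') (a • w' + w ᵥ* D') (a' • c + D *ᵥ c') (vecMulVec c w' + D * D') := by
  refine block_ext ?_ (fun j => ?_) (fun i => ?_) (fun i j => ?_) <;>
    simp [Matrix.mul_apply, Fin.sum_univ_succ, dotProduct, vecMul, mulVec, vecMulVec, mul_comm]

theorem block_mulVec (s : ℂ) (v : Fin q → ℂ) :
    block a w c D *ᵥ (Fin.cons s v : Fin (q + 1) → ℂ) =
      (Fin.cons (a * s + w ⬝ᵥ v) (s • c + D *ᵥ v) : Fin (p + 1) → ℂ) := by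
  ext i
  refine Fin.cases ?_ (fun i => ?_) i
  · simp [mulVec, dotProduct, Fin.sum_univ_succ]
  · simp [mulVec, dotProduct, Fin.sum_univ_succ, mul_comm]

theorem block_one : block 1 0 0 1 = (1 : Matrix (Fin (p + 1)) (Fin (p + 1)) ℂ) := by
  refine block_ext ?_ (fun j => ?_) (fun i => ?_) (fun i j => ?_)
  · simp
  · simp [(Fin.succ_ne_zero j).symm]
  · simp
  · simp [Matrix.one_apply]

theorem charpoly_block (w c : Fin p → ℂ) (hc : c = 0) (D : Matrix (Fin p) (Fin p) ℂ) :
    (block a w c D).charpoly = (Polynomial.X - Polynomial.C a) * D.charpoly := by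
  subst hc
  rw [Matrix.charpoly, Matrix.det_succ_column_zero, Fin.sum_univ_succ]
  have h0 : ∀ i : Fin p, (block a w 0 D).charmatrix i.succ 0 = 0 := fun i => by
    rw [Matrix.charmatrix_apply_ne _ _ _ (Fin.succ_ne_zero i)]
    simp
  have h1 : (block a w 0 D).charmatrix.submatrix (Fin.succAbove 0) Fin.succ = D.charmatrix := by
    ext1 i j
    simp [Matrix.charmatrix_apply, Matrix.diagonal_apply]
  simp only [h0, mul_zero, zero_mul, Finset.sum_const_zero, add_zero, h1]
  simp [Matrix.charpoly]

/-- The lower unipotent matrix with first column `(1, v)`. -/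
def shear {p : ℕ} (v : Fin p → ℂ) : Matrix (Fin (p + 1)) (Fin (p + 1)) ℂ := block 1 0 v 1

theorem shear_neg_mul_shear (v : Fin p → ℂ) : shear (-v) * shear v = 1 := by
  rw [shear, shear, block_mul, ← block_one]
  congr 1 <;> simp

/-- This identifies the bordered matrices that shears bring to triangular form: equating the lower
left block with a prescribed first column is the equation behind `fiberMap`. -/
theorem shear_mul_block_mul_shear (x : ℂ) (u : Fin p → ℂ) (v : Fin q → ℂ) :
    shear u * block x w 0 D * shear (-v) =
      block (x - w ⬝ᵥ v) w (x • u - (vecMulVec u w + D) *ᵥ v) (vecMulVec u w + D) := by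
  have h0 : vecMulVec u (0 : Fin q → ℂ) = 0 := by
    ext i j
    simp [vecMulVec]
  rw [shear, shear, block_mul, block_mul]
  congr 1 <;> simp [sub_eq_add_neg, Matrix.mulVec_neg, h0]

end block

section triangular

variable {k : ℕ} {n : Fin (k + 1) → ℕ}

theorem suffixProd_block
    (x : Fin k → ℂ) (w : (i : Fin k) → Fin (n i.succ) → ℂ)
    (D : (i : Fin k) → Matrix (Fin (n i.castSucc)) (Fin (n i.succ)) ℂ) (j : Fin (k + 1)) :
    ∃ w' : Fin (n (Fin.last k)) → ℂ,
      suffixProd (n := fun j => n j + 1) (fun i => block (x i) (w i) 0 (D i)) j =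
        block (∏ i with j ≤ i.castSucc, x i) w' 0 (suffixProd D j) := by
  induction j using Fin.reverseInduction with
  | last =>
    refine ⟨0, ?_⟩
    have : (Finset.univ.filter fun i : Fin k => Fin.last k ≤ i.castSucc) = ∅ := by
      refine Finset.filter_eq_empty_iff.2 fun i _ h => ?_
      exact absurd (Fin.castSucc_lt_last i) (not_lt.2 h)
    rw [suffixProd_last, this, Finset.prod_empty]
    exact (block_one).symm.trans (by rw [suffixProd_last])
  | cast i ih =>
    obtain ⟨w', hw'⟩ := ih
    have : (Finset.univ.filter fun l : Fin k => i.castSucc ≤ l.castSucc) =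
        insert i (Finset.univ.filter fun l : Fin k => i.succ ≤ l.castSucc) := by
      ext l
      simp only [Finset.mem_filter, Finset.mem_univ, true_and, Finset.mem_insert,
        Fin.castSucc_le_castSucc_iff, Fin.succ_le_castSucc_iff]
      rw [le_iff_eq_or_lt, eq_comm]
    rw [suffixProd_castSucc, hw', block_mul, suffixProd_castSucc, this, Finset.prod_insert
      (by simp [Fin.succ_le_castSucc_iff])]
    refine ⟨x i • w' + w i ᵥ* suffixProd D i.succ, ?_⟩
    congr 1 <;> simp

theorem charpoly_squareProd_block (h : n (Fin.last k) = n 0)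
    (h' : (fun j => n j + 1) (Fin.last k) = (fun j => n j + 1) 0)
    (x : Fin k → ℂ) (w : (i : Fin k) → Fin (n i.succ) → ℂ)
    (D : (i : Fin k) → Matrix (Fin (n i.castSucc)) (Fin (n i.succ)) ℂ) :
    (squareProd (n := fun j => n j + 1) h' (fun i => block (x i) (w i) 0 (D i))).charpoly =
      (Polynomial.X - Polynomial.C (∏ i, x i)) * (squareProd h D).charpoly := by
  obtain ⟨w', hw'⟩ := suffixProd_block x w D 0
  have h1 : squareProd (n := fun j => n j + 1) h' (fun i => block (x i) (w i) 0 (D i)) =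
      block (∏ i, x i) (fun j => w' (Fin.cast h.symm j)) 0 (squareProd h D) := by
    rw [squareProd_eq, hw', squareProd_eq]
    have : (Finset.univ.filter fun i : Fin k => 0 ≤ i.castSucc) = Finset.univ := by simp
    rw [this]
    exact block_ext rfl (fun _ => rfl) (fun _ => rfl) (fun _ _ => rfl)
  rw [h1]
  exact charpoly_block _ _ 0 rfl _

end triangular

/-- Index set of the entries of a chain of matrices. -/
abbrev ChainIdx {k : ℕ} (n : Fin (k + 1) → ℕ) := Σ i : Fin k, Fin (n i.castSucc) × Fin (n i.succ)

/-- Index set of the first columns (below the corner) of a chain of bordered matrices. -/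
abbrev ColIdx {k : ℕ} (n : Fin (k + 1) → ℕ) := Σ i : Fin k, Fin (n i.castSucc)

/-- Index set of the first rows (right of the corner) of a chain of bordered matrices. -/
abbrev RowIdx {k : ℕ} (n : Fin (k + 1) → ℕ) := Σ i : Fin k, Fin (n i.succ)

/-- The chain of matrices with given entries. -/
def chainMat {k : ℕ} {n : Fin (k + 1) → ℕ} (A : ChainIdx n → ℂ) (i : Fin k) :
    Matrix (Fin (n i.castSucc)) (Fin (n i.succ)) ℂ :=
  Matrix.of fun a b => A ⟨i, a, b⟩

section tailProd

variable {k : ℕ}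

/-- The product `x j * ⋯ * x (k-1)`. -/
def tailProd (x : Fin k → ℂ) (j : Fin (k + 1)) : ℂ := ∏ i with j ≤ i.castSucc, x i

theorem tailProd_last (x : Fin k → ℂ) : tailProd x (Fin.last k) = 1 := by
  have : (Finset.univ.filter fun i : Fin k => Fin.last k ≤ i.castSucc) = ∅ := by
    refine Finset.filter_eq_empty_iff.2 fun i _ h => ?_
    exact absurd (Fin.castSucc_lt_last i) (not_lt.2 h)
  rw [tailProd, this, Finset.prod_empty]

theorem tailProd_castSucc (x : Fin k → ℂ) (i : Fin k) :
    tailProd x i.castSucc = x i * tailProd x i.succ := by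
  have : (Finset.univ.filter fun l : Fin k => i.castSucc ≤ l.castSucc) =
      insert i (Finset.univ.filter fun l : Fin k => i.succ ≤ l.castSucc) := by
    ext l
    simp only [Finset.mem_filter, Finset.mem_univ, true_and, Finset.mem_insert,
      Fin.castSucc_le_castSucc_iff, Fin.succ_le_castSucc_iff]
    rw [le_iff_eq_or_lt, eq_comm]
  rw [tailProd, this, Finset.prod_insert (by simp [Fin.succ_le_castSucc_iff]), tailProd]

theorem tailProd_zero (x : Fin k → ℂ) : tailProd x 0 = ∏ i, x i := by
  simp [tailProd]

end tailProd

/-! ### The Jacobian determinant of the parametrisation by eigenvectors. -/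

section derivative

variable {κ : ℕ} {n : Fin (κ + 1 + 1) → ℕ} (h : n (Fin.last (κ + 1)) = n 0)

/-- The column index attached to a position at a vertex, the last vertex being identified with
the first. -/
def vertexIdx (j : Fin (κ + 1 + 1)) : Fin (n j) → ColIdx n :=
  Fin.lastCases (motive := fun j => Fin (n j) → ColIdx n) (fun a => ⟨0, Fin.cast h a⟩)
    (fun i a => ⟨i, a⟩) j

@[simp] theorem vertexIdx_castSucc (i : Fin (κ + 1)) (a : Fin (n i.castSucc)) :
    vertexIdx h i.castSucc a = ⟨i, a⟩ := by
  simp [vertexIdx]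

@[simp] theorem vertexIdx_last (a : Fin (n (Fin.last (κ + 1)))) :
    vertexIdx h (Fin.last (κ + 1)) a = ⟨0, Fin.cast h a⟩ := by
  simp [vertexIdx]

/-- The vector at a vertex, with cyclic identification of the last and first vertices. -/
def vertexVec (u : ColIdx n → ℂ) (j : Fin (κ + 1 + 1)) : Fin (n j) → ℂ :=
  fun a => u (vertexIdx h j a)

theorem vertexVec_castSucc (u : ColIdx n → ℂ) (i : Fin (κ + 1)) :
    vertexVec h u i.castSucc = fun a => u ⟨i, a⟩ := by
  ext a; simp [vertexVec]

theorem vertexVec_last (u : ColIdx n → ℂ) (a : Fin (n (Fin.last (κ + 1)))) :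
    vertexVec h u (Fin.last (κ + 1)) a = u ⟨0, Fin.cast h a⟩ := by
  simp [vertexVec]

/-- The linear map `du ↦ (x_i du_i - A_i du_{i+1})_i`. -/
def fiberDeriv (x : Fin (κ + 1) → ℂ)
    (A : (i : Fin (κ + 1)) → Matrix (Fin (n i.castSucc)) (Fin (n i.succ)) ℂ) :
    (ColIdx n → ℂ) →ₗ[ℂ] (ColIdx n → ℂ) where
  toFun du e := x e.1 * du e - (A e.1 *ᵥ vertexVec h du e.1.succ) e.2
  map_add' u v := by
    ext e
    have : vertexVec h (u + v) e.1.succ = vertexVec h u e.1.succ + vertexVec h v e.1.succ := rfl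
    rw [this, Matrix.mulVec_add]
    simp only [Pi.add_apply]
    ring
  map_smul' c u := by
    ext e
    have : vertexVec h (c • u) e.1.succ = c • vertexVec h u e.1.succ := rfl
    rw [this, Matrix.mulVec_smul]
    simp only [Pi.smul_apply, smul_eq_mul, RingHom.id_apply]
    ring

variable (x : Fin (κ + 1) → ℂ)
  (A : (i : Fin (κ + 1)) → Matrix (Fin (n i.castSucc)) (Fin (n i.succ)) ℂ)

/-- The transfer matrices `(x_j ⋯ x_{k-1})⁻¹ A_j ⋯ A_{k-1}`. -/
noncomputable def transfer (j : Fin (κ + 1 + 1)) :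
    Matrix (Fin (n j)) (Fin (n (Fin.last (κ + 1)))) ℂ :=
  (tailProd x j)⁻¹ • suffixProd A j

/-- The block unipotent map that decouples the first block from the others. -/
noncomputable def decouple : (ColIdx n → ℂ) →ₗ[ℂ] (ColIdx n → ℂ) where
  toFun du e := du e + if e.1 = 0 then 0 else
    (transfer x A e.1.castSucc *ᵥ vertexVec h du (Fin.last (κ + 1))) e.2
  map_add' u v := by
    ext e
    have : vertexVec h (u + v) (Fin.last (κ + 1)) =
      vertexVec h u (Fin.last (κ + 1)) + vertexVec h v (Fin.last (κ + 1)) := rfl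
    rw [this, Matrix.mulVec_add]
    simp only [Pi.add_apply]
    split_ifs <;> ring
  map_smul' c u := by
    ext e
    have : vertexVec h (c • u) (Fin.last (κ + 1)) = c • vertexVec h u (Fin.last (κ + 1)) := rfl
    rw [this, Matrix.mulVec_smul]
    simp only [Pi.smul_apply, smul_eq_mul, RingHom.id_apply]
    split_ifs <;> ring

theorem vertexVec_single_last_of_ne {q : ColIdx n} (hq : q.1 ≠ 0) :
    vertexVec h (Pi.single q 1) (Fin.last (κ + 1)) = 0 := by
  ext a
  rw [vertexVec_last, Pi.zero_apply, Pi.single_apply, if_neg]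
  rintro rfl
  exact hq rfl

theorem det_decouple : LinearMap.det (decouple h x A) = 1 := by
  classical
  rw [← LinearMap.det_toMatrix']
  have hent : ∀ p q : ColIdx n, LinearMap.toMatrix' (decouple h x A) p q =
      (if p = q then 1 else 0) + if p.1 = 0 then 0 else
        (transfer x A p.1.castSucc *ᵥ vertexVec h (Pi.single q 1) (Fin.last (κ + 1))) p.2 := by
    intro p q
    rw [LinearMap.toMatrix'_apply]
    change (Pi.single q (1 : ℂ) : ColIdx n → ℂ) p + _ = _
    rw [Pi.single_apply]
  have hzero : ∀ p q : ColIdx n, (q.1 ≠ 0 ∨ p.1 = 0) →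
      LinearMap.toMatrix' (decouple h x A) p q = if p = q then 1 else 0 := by
    intro p q hpq
    rw [hent]
    by_cases hp : p.1 = 0
    · rw [if_pos hp, add_zero]
    · rw [if_neg hp, vertexVec_single_last_of_ne h (hpq.resolve_right hp), Matrix.mulVec_zero]
      simp
  -- Off-diagonal entries occur only in the columns of the first block, so the matrix is block lower
  -- triangular, whence the order dual.
  have htri : (LinearMap.toMatrix' (decouple h x A)).BlockTriangular
      (fun p : ColIdx n => OrderDual.toDual p.1) := by
    intro p q hpq
    have hlt : p.1 < q.1 := hpq
    rw [hzero p q (Or.inl (ne_of_gt ((Fin.zero_le _).trans_lt hlt))), if_neg]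
    rintro rfl
    exact lt_irrefl _ hlt
  rw [htri.det_fintype]
  refine Finset.prod_eq_one fun i _ => ?_
  have : (LinearMap.toMatrix' (decouple h x A)).toSquareBlock
      (fun p : ColIdx n => OrderDual.toDual p.1) i = 1 := by
    ext p q
    have hpq : p.1.1 = q.1.1 := OrderDual.toDual.injective (p.2.trans q.2.symm)
    rw [Matrix.toSquareBlock_def, Matrix.of_apply, hzero, Matrix.one_apply]
    · simp only [Subtype.ext_iff]
    · by_cases h0 : p.1.1 = 0
      · exact Or.inr h0
      · exact Or.inl (hpq ▸ h0)
  rw [this, Matrix.det_one]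

variable {x}

theorem transfer_last : transfer x A (Fin.last (κ + 1)) = 1 := by
  rw [transfer, tailProd_last, suffixProd_last, inv_one, one_smul]

theorem mul_transfer_succ {i : Fin (κ + 1)} (hi : x i ≠ 0) :
    A i * transfer x A i.succ = x i • transfer x A i.castSucc := by
  rw [transfer, transfer, tailProd_castSucc, suffixProd_castSucc, Matrix.mul_smul, smul_smul,
    mul_inv, ← mul_assoc, mul_inv_cancel₀ hi, one_mul]

/-- The part of the next vertex vector that lies in a later block. -/
def laterVec (du : ColIdx n → ℂ) (i : Fin (κ + 1)) : Fin (n i.succ) → ℂ :=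
  fun b => if (vertexIdx h i.succ b).1 = 0 then 0 else du (vertexIdx h i.succ b)

/-- The vertex after `i` has a larger index, or is the first vertex again, which `laterVec`
discards. This is what makes the decoupled matrix triangular. -/
theorem laterVec_single_of_le {q : ColIdx n} {i : Fin (κ + 1)} (hq : q.1 ≤ i) :
    laterVec h (Pi.single q 1) i = 0 := by
  ext b
  rw [laterVec, Pi.zero_apply]
  split_ifs with h0
  · rfl
  rw [Pi.single_apply, if_neg]
  rintro rfl
  revert h0 hq b
  refine Fin.lastCases ?_ (fun i => ?_) i
  · intro b h0 _
    rw [Fin.succ_last] at b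
    exact h0 (by rw [show vertexIdx h (Fin.last κ).succ = vertexIdx h (Fin.last (κ + 1)) from rfl,
      vertexIdx_last])
  · intro b h0 hq
    rw [show vertexIdx h i.castSucc.succ = vertexIdx h i.succ.castSucc from rfl,
      vertexIdx_castSucc] at hq
    exact absurd hq (not_le.2 Fin.castSucc_lt_succ)

theorem vertexVec_decouple_succ (du : ColIdx n → ℂ) (i : Fin (κ + 1)) :
    vertexVec h (decouple h x A du) i.succ =
      laterVec h du i + transfer x A i.succ *ᵥ vertexVec h du (Fin.last (κ + 1)) := by
  refine Fin.lastCases ?_ (fun i => ?_) i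
  · ext b
    have h1 := transfer_last (x := x) A
    have h2 : vertexIdx h (Fin.last κ).succ b = ⟨0, Fin.cast h b⟩ := vertexIdx_last h b
    rw [Pi.add_apply]
    change _ = _ + (transfer x A (Fin.last (κ + 1)) *ᵥ _) b
    rw [h1, Matrix.one_mulVec, vertexVec, laterVec, h2, if_pos rfl, zero_add, vertexVec_last]
    change du ⟨0, Fin.cast h b⟩ + (if (0 : Fin (κ + 1)) = 0 then 0 else _) = _
    rw [if_pos rfl, add_zero]
  · ext b
    have h2 : vertexIdx h i.castSucc.succ b = ⟨i.succ, b⟩ := vertexIdx_castSucc h i.succ b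
    rw [Pi.add_apply, vertexVec, laterVec, h2, if_neg (Fin.succ_ne_zero i)]
    change du ⟨i.succ, b⟩ + (if i.succ = 0 then 0 else _) = _
    rw [if_neg (Fin.succ_ne_zero i)]
    rfl

/-- By `mul_transfer_succ`, the transfer terms cancel in every row other than the first. -/
theorem fiberDeriv_decouple_of_ne (du : ColIdx n → ℂ) {e : ColIdx n} (he : e.1 ≠ 0)
    (hx : x e.1 ≠ 0) : fiberDeriv h x A (decouple h x A du) e =
      x e.1 * du e - (A e.1 *ᵥ laterVec h du e.1) e.2 := by
  change x e.1 * (du e + if e.1 = 0 then 0 else _) - (A e.1 *ᵥ vertexVec h _ e.1.succ) e.2 = _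
  rw [if_neg he, vertexVec_decouple_succ, Matrix.mulVec_add, Matrix.mulVec_mulVec,
    mul_transfer_succ A hx, Pi.add_apply, Matrix.smul_mulVec, Pi.smul_apply, smul_eq_mul]
  ring

theorem fiberDeriv_decouple_of_eq (du : ColIdx n → ℂ) (a : Fin (n (Fin.castSucc 0))) :
    fiberDeriv h x A (decouple h x A du) ⟨0, a⟩ =
      x 0 * du ⟨0, a⟩ - (A 0 *ᵥ laterVec h du 0) a -
        ((tailProd x (Fin.succ 0))⁻¹ • (suffixProd A 0 *ᵥ vertexVec h du (Fin.last (κ + 1)))) a := by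
  change x 0 * (du ⟨0, a⟩ + if (0 : Fin (κ + 1)) = 0 then 0 else _) -
    (A 0 *ᵥ vertexVec h _ (Fin.succ 0)) a = _
  rw [if_pos rfl, vertexVec_decouple_succ, Matrix.mulVec_add, Matrix.mulVec_mulVec, transfer,
    Matrix.mul_smul, ← suffixProd_castSucc, Matrix.smul_mulVec, Pi.add_apply]
  simp only [add_zero]
  rw [sub_sub]
  rfl

/-- After composition with a map of determinant one, the matrix is block upper triangular. Going
once around the cycle leaves `(tail)⁻¹ (∏ x_i - A_0 ⋯ A_κ)` in the first diagonal block; the others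
are the scalars `x_i`. Only `x_0` may vanish, since it is never inverted. -/
theorem det_fiberDeriv (hx : ∀ i, i ≠ 0 → x i ≠ 0) :
    LinearMap.det (fiberDeriv h x A) =
      (tailProd x (Fin.succ 0))⁻¹ ^ n 0 * (squareProd h A).charpoly.eval (∏ i, x i) *
        ∏ i : Fin κ, x i.succ ^ n i.succ.castSucc := by
  classical
  have hdet : LinearMap.det (fiberDeriv h x A) =
      LinearMap.det (fiberDeriv h x A ∘ₗ decouple h x A) := by
    rw [LinearMap.det_comp, det_decouple, mul_one]
  set M := LinearMap.toMatrix' (fiberDeriv h x A ∘ₗ decouple h x A) with hM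
  have hent : ∀ p q : ColIdx n,
      M p q = fiberDeriv h x A (decouple h x A (Pi.single q 1)) p := fun p q => by
    rw [hM, LinearMap.toMatrix'_apply]
    rfl
  have hne : ∀ p q : ColIdx n, p.1 ≠ 0 → q.1 ≤ p.1 → M p q = if p = q then x p.1 else 0 := by
    intro p q hp hqp
    rw [hent, fiberDeriv_decouple_of_ne h A _ hp (hx _ hp), laterVec_single_of_le h hqp,
      Matrix.mulVec_zero, Pi.single_apply, Pi.zero_apply, sub_zero, mul_ite, mul_one, mul_zero]
  have htri : M.BlockTriangular (fun p : ColIdx n => p.1) := by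
    intro p q hpq
    have hlt : q.1 < p.1 := hpq
    rw [hne p q (ne_of_gt ((Fin.zero_le _).trans_lt hlt)) hlt.le, if_neg]
    rintro rfl
    exact lt_irrefl _ hlt
  let e : (i : Fin (κ + 1)) → Fin (n i.castSucc) ≃ {p : ColIdx n // p.1 = i} := fun i =>
    { toFun := fun a => ⟨⟨i, a⟩, rfl⟩
      invFun := fun p => p.2 ▸ p.1.2
      left_inv := fun a => rfl
      right_inv := by rintro ⟨⟨i, a⟩, rfl⟩; rfl }
  rw [hdet, ← LinearMap.det_toMatrix', htri.det_fintype, Fin.prod_univ_succ]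
  congr 1
  · let e₀ : Fin (n 0) ≃ {p : ColIdx n // p.1 = 0} := e 0
    have hentry : ∀ a b : Fin (n 0), M ⟨0, a⟩ ⟨0, b⟩ = (tailProd x (Fin.succ 0))⁻¹ *
        ((Matrix.scalar (Fin (n 0)) (∏ i, x i)) a b - squareProd h A a b) := by
      intro a b
      have h1 : vertexVec h (Pi.single ⟨0, b⟩ 1) (Fin.last (κ + 1)) =
          Pi.single (Fin.cast h.symm b) 1 := by
        ext c
        rw [vertexVec_last, Pi.single_apply, Pi.single_apply]
        refine if_congr ?_ rfl rfl
        constructor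
        · intro hc
          have : Fin.cast h c = b := eq_of_heq (Sigma.mk.inj hc).2
          rw [← this]
          rfl
        · rintro rfl
          rfl
      have h2 : M ⟨0, a⟩ ⟨0, b⟩ = x 0 * (if a = b then 1 else 0) -
          (tailProd x (Fin.succ 0))⁻¹ * squareProd h A a b := by
        refine (hent _ _).trans ((fiberDeriv_decouple_of_eq h A _ a).trans ?_)
        have h4 : (A 0 *ᵥ laterVec h (Pi.single ⟨0, b⟩ 1) 0) a = 0 := by
          have := laterVec_single_of_le h (q := ⟨0, b⟩) (i := 0) le_rfl
          rw [this, Matrix.mulVec_zero]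
          rfl
        rw [h4, sub_zero, h1, Matrix.mulVec_single_one, Pi.single_apply, squareProd_eq]
        by_cases hab : a = b
        · subst hab
          rw [if_pos rfl, if_pos rfl]
          rfl
        · have hab' : ¬ (⟨0, a⟩ : ColIdx n) = ⟨0, b⟩ := fun hc =>
            hab (eq_of_heq (Sigma.mk.inj hc).2)
          rw [if_neg hab, if_neg hab']
          rfl
      have h3 : x 0 = (tailProd x (Fin.succ 0))⁻¹ * ∏ i, x i := by
        have hne0 : tailProd x (Fin.succ 0) ≠ 0 := by
          refine Finset.prod_ne_zero_iff.2 fun i hi => hx i ?_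
          rintro rfl
          exact absurd (Finset.mem_filter.1 hi).2 (not_le.2 Fin.castSucc_lt_succ)
        rw [← tailProd_zero]
        have := tailProd_castSucc x 0
        rw [Fin.castSucc_zero] at this
        rw [this, mul_comm (x 0), inv_mul_cancel_left₀ hne0]
      rw [h2, Matrix.scalar_apply, Matrix.diagonal_apply, mul_sub, mul_ite, mul_ite, mul_one,
        mul_zero, mul_zero, ← h3]
    have hblock : (M.toSquareBlock (fun p : ColIdx n => p.1) 0).submatrix e₀ e₀ =
        (tailProd x (Fin.succ 0))⁻¹ •
          (Matrix.scalar (Fin (n 0)) (∏ i, x i) - squareProd h A) :=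
      Matrix.ext fun a b => hentry a b
    rw [← Matrix.det_submatrix_equiv_self e₀, hblock, Matrix.det_smul, Fintype.card_fin,
      Matrix.eval_charpoly]
  · refine Finset.prod_congr rfl fun i _ => ?_
    rw [← Matrix.det_submatrix_equiv_self (e i.succ)]
    have hblock : (M.toSquareBlock (fun p : ColIdx n => p.1) i.succ).submatrix (e i.succ)
        (e i.succ) = Matrix.diagonal fun _ => x i.succ := by
      refine Matrix.ext fun a b => (hne ⟨i.succ, a⟩ ⟨i.succ, b⟩ (Fin.succ_ne_zero i) le_rfl).trans ?_
      rw [Matrix.diagonal_apply]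
      simp
    rw [hblock, Matrix.det_diagonal]
    simp

/-- The power of the inverse tail product lowers each exponent `n_i` with `i ≠ 0` to `n_i - n_0`,
and at `i = 0` the exponent is zero. This is the source of the powers `|x_j|^(2 (n_j - n_0))` in the
weight. -/
theorem norm_det_fiberDeriv_sq (hx : ∀ i, i ≠ 0 → x i ≠ 0) (hmin : ∀ j, n 0 ≤ n j) :
    ‖LinearMap.det (fiberDeriv h x A)‖ ^ 2 =
      (∏ i : Fin (κ + 1), ‖x i‖ ^ (2 * (n i.castSucc - n 0))) *
        ‖(squareProd h A).charpoly.eval (∏ i, x i)‖ ^ 2 := by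
  rw [det_fiberDeriv h A hx, Fin.prod_univ_succ]
  have h1 : tailProd x (Fin.succ 0) = ∏ i : Fin κ, x i.succ := by
    have hset : (Finset.univ.filter fun i : Fin (κ + 1) => Fin.succ 0 ≤ i.castSucc) =
        Finset.univ.image Fin.succ := by
      ext i
      refine Fin.cases ?_ (fun i => ?_) i <;> simp [Fin.le_def, Fin.succ_ne_zero]
    rw [tailProd, hset, Finset.prod_image fun a _ b _ hab => Fin.succ_injective _ hab]
  have h2 : ∀ i : Fin κ, ‖x i.succ‖ ^ n i.succ.castSucc =
      ‖x i.succ‖ ^ n 0 * ‖x i.succ‖ ^ (n i.succ.castSucc - n 0) := fun i => by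
    rw [← pow_add, Nat.add_sub_cancel' (hmin _)]
  have h3 : ∏ i : Fin κ, ‖x i.succ‖ ≠ 0 :=
    Finset.prod_ne_zero_iff.2 fun i _ => norm_ne_zero_iff.2 (hx _ (Fin.succ_ne_zero i))
  rw [norm_mul, norm_mul, norm_pow, norm_inv, h1, norm_prod, norm_prod]
  simp_rw [norm_pow, h2, Finset.prod_mul_distrib, Finset.prod_pow, mul_comm 2, pow_mul]
  rw [Finset.prod_pow]
  rw [Fin.prod_univ_succ fun i => ‖x i‖ ^ (n i.castSucc - n 0),
    show n (Fin.castSucc 0) - n 0 = 0 from Nat.sub_self _, pow_zero, one_mul, mul_pow, mul_pow,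
    mul_pow]
  have h4 : ((∏ i : Fin κ, ‖x i.succ‖)⁻¹ ^ n 0) ^ 2 * ((∏ i : Fin κ, ‖x i.succ‖) ^ n 0) ^ 2 = 1 := by
    rw [← mul_pow, ← mul_pow, inv_mul_cancel₀ h3, one_pow, one_pow]
  linear_combination ‖Polynomial.eval (x 0 * ∏ i : Fin κ, x i.succ) (squareProd h A).charpoly‖ ^ 2 *
    (∏ i : Fin κ, ‖x i.succ‖ ^ (n i.succ.castSucc - n 0)) ^ 2 * h4

end derivative

/-! ### The fibre of the parametrisation and its bijection with the eigenvalues. -/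

/-- The entries other than the first columns of a chain of bordered matrices: corners, first rows
and remaining blocks. -/
abbrev Params {k : ℕ} (n : Fin (k + 1) → ℕ) :=
  (Fin k → ℂ) × (RowIdx n → ℂ) × (ChainIdx n → ℂ)

/-- The chain of bordered matrices with given first columns and other entries. -/
def assemble {k : ℕ} {n : Fin (k + 1) → ℕ} (c : ColIdx n → ℂ) (p : Params n) :
    ChainIdx (fun j => n j + 1) → ℂ :=
  fun e => block (p.1 e.1) (fun b => p.2.1 ⟨e.1, b⟩) (fun a => c ⟨e.1, a⟩) (chainMat p.2.2 e.1)
    e.2.1 e.2.2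

theorem chainMat_assemble {k : ℕ} {n : Fin (k + 1) → ℕ} (c : ColIdx n → ℂ) (p : Params n)
    (i : Fin k) : chainMat (assemble c p) i =
      block (p.1 i) (fun b => p.2.1 ⟨i, b⟩) (fun a => c ⟨i, a⟩) (chainMat p.2.2 i) := rfl

/-- Splitting a chain of bordered matrices into its blocks. -/
def assembleEquiv {k : ℕ} (n : Fin (k + 1) → ℕ) :
    ((ColIdx n → ℂ) × Params n) ≃ₗ[ℂ] (ChainIdx (fun j => n j + 1) → ℂ) where
  toFun z := assemble z.1 z.2
  invFun A := (fun e => A ⟨e.1, Fin.succ e.2, 0⟩, fun i => A ⟨i, 0, 0⟩,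
    fun e => A ⟨e.1, 0, Fin.succ e.2⟩, fun e => A ⟨e.1, Fin.succ e.2.1, Fin.succ e.2.2⟩)
  map_add' z z' := by
    ext ⟨i, a, b⟩
    revert a b
    refine Fin.cases (Fin.cases ?_ fun b => ?_) fun a => Fin.cases ?_ fun b => ?_ <;> rfl
  map_smul' r z := by
    ext ⟨i, a, b⟩
    revert a b
    refine Fin.cases (Fin.cases ?_ fun b => ?_) fun a => Fin.cases ?_ fun b => ?_ <;> rfl
  left_inv z := rfl
  right_inv A := by
    ext ⟨i, a, b⟩
    revert a b
    refine Fin.cases (Fin.cases ?_ fun b => ?_) fun a => Fin.cases ?_ fun b => ?_ <;> rfl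

section fiber

variable {κ : ℕ} {n : Fin (κ + 1 + 1) → ℕ} (h : n (Fin.last (κ + 1)) = n 0)

/-- The corner entries after conjugation by shears. -/
def cornerVal (u : ColIdx n → ℂ) (p : Params n) (i : Fin (κ + 1)) : ℂ :=
  p.1 i + (fun b => p.2.1 ⟨i, b⟩) ⬝ᵥ vertexVec h u i.succ

/-- The parameters of the block triangular chain obtained by conjugation with shears. -/
def triangularize (u : ColIdx n → ℂ) (p : Params n) : Params n :=
  (cornerVal h u p, p.2.1, fun e => p.2.2 e - u ⟨e.1, e.2.1⟩ * p.2.1 ⟨e.1, e.2.2⟩)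

/-- The first columns of the chain that is conjugate by shears to a block triangular one. -/
def fiberMap (p : Params n) (u : ColIdx n → ℂ) : ColIdx n → ℂ :=
  fun e => cornerVal h u p e.1 * u e - (chainMat p.2.2 e.1 *ᵥ vertexVec h u e.1.succ) e.2

theorem chainMat_assemble_fiberMap (p : Params n) (u : ColIdx n → ℂ) (i : Fin (κ + 1)) :
    chainMat (assemble (fiberMap h p u) p) i =
      shear (vertexVec h u i.castSucc) * chainMat (assemble 0 (triangularize h u p)) i *
        shear (-vertexVec h u i.succ) := by
  have h1 : vecMulVec (vertexVec h u i.castSucc) (fun b => p.2.1 ⟨i, b⟩) +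
      chainMat (triangularize h u p).2.2 i = chainMat p.2.2 i := by
    ext a b
    simp [vecMulVec, vertexVec_castSucc, chainMat, triangularize]
  rw [chainMat_assemble, chainMat_assemble]
  change _ = shear _ * block _ _ 0 _ * shear _
  rw [shear_mul_block_mul_shear]
  change _ = block _ _ (_ - (vecMulVec (vertexVec h u i.castSucc) (fun b => p.2.1 ⟨i, b⟩) +
      chainMat (triangularize h u p).2.2 i) *ᵥ _) (vecMulVec (vertexVec h u i.castSucc)
      (fun b => p.2.1 ⟨i, b⟩) + chainMat (triangularize h u p).2.2 i)
  rw [h1]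
  congr 1
  · simp [triangularize, cornerVal]
  · ext a
    simp [fiberMap, triangularize, vertexVec_castSucc]

theorem succ_dims (h : n (Fin.last (κ + 1)) = n 0) :
    (fun j => n j + 1) (Fin.last (κ + 1)) = (fun j => n j + 1) 0 := congrArg (· + 1) h

/-- Cyclic conjugation by shears leaves the characteristic polynomial unchanged, and for a block
triangular chain the corner product splits off as a root. -/
theorem charpoly_squareProd_assemble_fiberMap (p : Params n) (u : ColIdx n → ℂ) :
    (squareProd (n := fun j => n j + 1) (succ_dims h)
      (chainMat (assemble (fiberMap h p u) p))).charpoly =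
      (Polynomial.X - Polynomial.C (∏ i, cornerVal h u p i)) *
        (squareProd h (chainMat (triangularize h u p).2.2)).charpoly := by
  let B : (i : Fin (κ + 1)) → Matrix (Fin (n i.castSucc + 1)) (Fin (n i.succ + 1)) ℂ := fun i =>
    block (cornerVal h u p i) (fun b => p.2.1 ⟨i, b⟩) 0 (chainMat (triangularize h u p).2.2 i)
  have h1 := charpoly_squareProd_conj (n := fun j => n j + 1) B (succ_dims h)
    (P := fun j => shear (vertexVec h u j)) (P' := fun j => shear (-vertexVec h u j))
    (fun j => shear_neg_mul_shear _) (by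
      have h2 : ∀ a : Fin (n 0), vertexVec h u (Fin.last (κ + 1)) (Fin.cast h.symm a) =
          vertexVec h u 0 a := fun a => by
        rw [vertexVec_last]
        exact (congrFun (vertexVec_castSucc h u 0) a).symm
      refine block_ext rfl (fun _ => rfl) (fun a => ?_) (fun a b => ?_)
      · exact congrArg Neg.neg (h2 a)
      · change (1 : Matrix _ _ ℂ) (Fin.cast h.symm a) (Fin.cast h.symm b) = (1 : Matrix _ _ ℂ) a b
        simp [Matrix.one_apply, Fin.ext_iff])
  have h3 : chainMat (assemble (fiberMap h p u) p) = fun i =>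
      shear (vertexVec h u i.castSucc) * B i * shear (-vertexVec h u i.succ) :=
    funext fun i => chainMat_assemble_fiberMap h p u i
  exact (congrArg (fun C => (squareProd (n := fun j => n j + 1) (succ_dims h) C).charpoly) h3).trans
    (h1.trans (charpoly_squareProd_block h (succ_dims h) (cornerVal h u p)
      (fun i b => p.2.1 ⟨i, b⟩) (chainMat (triangularize h u p).2.2)))

/-- The homogeneous vector `(1, u_j)` at a vertex. -/
def homVec (u : ColIdx n → ℂ) (j : Fin (κ + 1 + 1)) : Fin (n j + 1) → ℂ :=
  Fin.cons 1 (vertexVec h u j)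

theorem homVec_last (u : ColIdx n → ℂ) (a : Fin (n (Fin.last (κ + 1)) + 1)) :
    homVec h u (Fin.last (κ + 1)) a = homVec h u 0 (Fin.cast (succ_dims h) a) := by
  refine Fin.cases rfl (fun a => ?_) a
  change vertexVec h u (Fin.last (κ + 1)) a = vertexVec h u 0 (Fin.cast h a)
  rw [vertexVec_last]
  exact (congrFun (vertexVec_castSucc h u 0) (Fin.cast h a)).symm

/-- A fibre point is a cyclic chain of vectors normalised to first coordinate `1`, each mapped to a
multiple of the preceding one; the multipliers are the corner values. -/
theorem chainMat_mulVec_homVec {p : Params n} {u c : ColIdx n → ℂ} (hu : fiberMap h p u = c)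
    (i : Fin (κ + 1)) : chainMat (assemble c p) i *ᵥ homVec h u i.succ =
      cornerVal h u p i • homVec h u i.castSucc := by
  subst hu
  rw [chainMat_assemble, homVec]
  refine (block_mulVec _ _ _ _ _ _).trans ?_
  ext a
  refine Fin.cases ?_ (fun a => ?_) a
  · simp [cornerVal, homVec]
  · simp [fiberMap, homVec, vertexVec_castSucc]

theorem suffixProd_mulVec_homVec {p : Params n} {u c : ColIdx n → ℂ} (hu : fiberMap h p u = c)
    (j : Fin (κ + 1 + 1)) :
    suffixProd (n := fun j => n j + 1) (chainMat (assemble c p)) j *ᵥ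
        homVec h u (Fin.last (κ + 1)) =
      tailProd (cornerVal h u p) j • homVec h u j := by
  induction j using Fin.reverseInduction with
  | last => rw [suffixProd_last, tailProd_last, Matrix.one_mulVec, one_smul]
  | cast i ih =>
    rw [suffixProd_castSucc, ← Matrix.mulVec_mulVec, ih, Matrix.mulVec_smul,
      chainMat_mulVec_homVec h hu, smul_smul, tailProd_castSucc, mul_comm]

theorem squareProd_mulVec {k : ℕ} {m : Fin (k + 1) → ℕ} (hm : m (Fin.last k) = m 0)
    (A : (i : Fin k) → Matrix (Fin (m i.castSucc)) (Fin (m i.succ)) ℂ) (v : Fin (m 0) → ℂ) :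
    squareProd hm A *ᵥ v = suffixProd A 0 *ᵥ (fun b => v (Fin.cast hm b)) := by
  rw [squareProd_eq]
  have := Matrix.submatrix_mulVec_equiv (suffixProd A 0) v id (finCongr hm.symm)
  exact this

theorem squareProd_mulVec_homVec {p : Params n} {u c : ColIdx n → ℂ} (hu : fiberMap h p u = c) :
    squareProd (n := fun j => n j + 1) (succ_dims h) (chainMat (assemble c p)) *ᵥ homVec h u 0 =
      (∏ i, cornerVal h u p i) • homVec h u 0 := by
  have h1 := suffixProd_mulVec_homVec h hu 0
  have h2 : homVec h u (Fin.last (κ + 1)) =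
      fun b => homVec h u 0 (Fin.cast (succ_dims h) b) := funext fun a => homVec_last h u a
  rw [tailProd_zero, h2] at h1
  rw [squareProd_mulVec, h1]

/-- No eigenvector of the product is mapped by a nontrivial tail of the chain to a vector with
vanishing first coordinate. -/
def IsGenericChain (A : ChainIdx (fun j => n j + 1) → ℂ) : Prop :=
  ∀ j : Fin (κ + 1 + 1), j ≠ 0 → ∀ (v : Fin (n 0 + 1) → ℂ) (e : ℂ), v ≠ 0 →
    squareProd (n := fun j => n j + 1) (succ_dims h) (chainMat A) *ᵥ v = e • v →
    (suffixProd (n := fun j => n j + 1) (chainMat A) j *ᵥ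
      (fun b => v (Fin.cast (succ_dims h) b))) 0 ≠ 0

theorem homVec_zero_ne_zero (u : ColIdx n → ℂ) : homVec h u 0 ≠ 0 := fun hc =>
  one_ne_zero (α := ℂ) (congrFun hc 0)

/-- The tail product is the first coordinate of the image of an eigenvector under a tail of the
chain, so genericity applies. -/
theorem IsGenericChain.tailProd_ne_zero {p : Params n} {u c : ColIdx n → ℂ}
    (hg : IsGenericChain h (assemble c p)) (hu : fiberMap h p u = c) {j : Fin (κ + 1 + 1)}
    (hj : j ≠ 0) : tailProd (cornerVal h u p) j ≠ 0 := by
  have h1 := hg j hj (homVec h u 0) _ (homVec_zero_ne_zero h u) (squareProd_mulVec_homVec h hu)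
  have h2 : homVec h u (Fin.last (κ + 1)) =
      fun b => homVec h u 0 (Fin.cast (succ_dims h) b) := funext fun a => homVec_last h u a
  rw [← h2, suffixProd_mulVec_homVec h hu] at h1
  simpa [homVec] using h1

theorem IsGenericChain.cornerVal_ne_zero {p : Params n} {u c : ColIdx n → ℂ}
    (hg : IsGenericChain h (assemble c p)) (hu : fiberMap h p u = c) {i : Fin (κ + 1)}
    (hi : i ≠ 0) : cornerVal h u p i ≠ 0 := by
  have := hg.tailProd_ne_zero h hu (j := i.castSucc) fun hc => hi (Fin.castSucc_injective _ hc)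
  rw [tailProd_castSucc] at this
  exact left_ne_zero_of_mul this

/-- Two normalised eigenvectors for the same eigenvalue differ by a vector with first coordinate
`0`; genericity at the last vertex makes it zero. The vectors at the other vertices follow by
applying tails of the chain. -/
theorem IsGenericChain.eq_of_prod_cornerVal_eq {p : Params n} {u u' c : ColIdx n → ℂ}
    (hg : IsGenericChain h (assemble c p)) (hu : fiberMap h p u = c) (hu' : fiberMap h p u' = c)
    (he : ∏ i, cornerVal h u p i = ∏ i, cornerVal h u' p i) : u = u' := by
  have h0 : homVec h u 0 = homVec h u' 0 := by
    by_contra hne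
    have h1 := hg (Fin.last (κ + 1)) (Fin.last_pos.ne') (homVec h u 0 - homVec h u' 0)
      (∏ i, cornerVal h u p i) (sub_ne_zero.2 hne) (by
        rw [Matrix.mulVec_sub, squareProd_mulVec_homVec h hu, squareProd_mulVec_homVec h hu', he,
          smul_sub])
    rw [suffixProd_last, Matrix.one_mulVec] at h1
    apply h1
    change homVec h u 0 0 - homVec h u' 0 0 = 0
    simp [homVec]
  have hlast : homVec h u (Fin.last (κ + 1)) = homVec h u' (Fin.last (κ + 1)) := by
    ext a
    rw [homVec_last, homVec_last, h0]
  have hall : ∀ j, homVec h u j = homVec h u' j := by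
    intro j
    by_cases hj : j = 0
    · rw [hj, h0]
    have h1 := suffixProd_mulVec_homVec h hu j
    rw [hlast, suffixProd_mulVec_homVec h hu' j] at h1
    have h2 : tailProd (cornerVal h u' p) j = tailProd (cornerVal h u p) j := by
      have := congrFun h1 0
      simpa [homVec] using this
    rw [h2] at h1
    exact (smul_right_injective _ (hg.tailProd_ne_zero h hu hj) h1).symm
  ext ⟨i, a⟩
  have := congrFun (hall i.castSucc) (Fin.succ a)
  simpa [homVec, vertexVec_castSucc] using this

theorem IsGenericChain.exists_of_isRoot {p : Params n} {c : ColIdx n → ℂ}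
    (hg : IsGenericChain h (assemble c p)) {e : ℂ}
    (he : (squareProd (n := fun j => n j + 1) (succ_dims h)
      (chainMat (assemble c p))).charpoly.eval e = 0) :
    ∃ u, fiberMap h p u = c ∧ ∏ i, cornerVal h u p i = e := by
  set A := chainMat (assemble c p) with hA
  obtain ⟨v, hv0, hv⟩ := Matrix.exists_mulVec_eq_zero_iff.2 ((Matrix.eval_charpoly _ _).symm.trans he)
  have hMv : squareProd (n := fun j => n j + 1) (succ_dims h) A *ᵥ v = e • v := by
    rw [Matrix.sub_mulVec, sub_eq_zero] at hv
    rw [← hv, Matrix.scalar_apply, ← Matrix.smul_one_eq_diagonal, Matrix.smul_mulVec,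
      Matrix.one_mulVec]
  let vl : Fin (n (Fin.last (κ + 1)) + 1) → ℂ := fun b => v (Fin.cast (succ_dims h) b)
  let V : (j : Fin (κ + 1 + 1)) → Fin (n j + 1) → ℂ := fun j =>
    suffixProd (n := fun j => n j + 1) A j *ᵥ vl
  have hV0 : ∀ j, j ≠ 0 → V j 0 ≠ 0 := fun j hj => hg j hj v e hv0 hMv
  have hVs : ∀ i : Fin (κ + 1), V i.castSucc = A i *ᵥ V i.succ := fun i => by
    change suffixProd (n := fun j => n j + 1) A i.castSucc *ᵥ vl = _
    rw [suffixProd_castSucc, ← Matrix.mulVec_mulVec]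
  have hVl : V (Fin.last (κ + 1)) = vl := by
    change suffixProd (n := fun j => n j + 1) A (Fin.last (κ + 1)) *ᵥ vl = _
    rw [suffixProd_last, Matrix.one_mulVec]
  have hVz : V 0 = e • v := by
    rw [← hMv, squareProd_mulVec]
  have hlz : Fin.last (κ + 1) ≠ 0 := Fin.last_pos.ne'
  have hv00 : v 0 ≠ 0 := by
    have := hV0 _ hlz
    rw [hVl] at this
    exact this
  -- Every image of the eigenvector is normalised by its first coordinate. At vertex `0` the vector
  -- `v` itself is used, because `V 0 = e • v` vanishes when `e = 0`.
  let W : (j : Fin (κ + 1 + 1)) → Fin (n j + 1) → ℂ :=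
    Function.update (fun j => (V j 0)⁻¹ • V j) 0 ((v 0)⁻¹ • v)
  have hW0 : W 0 = (v 0)⁻¹ • v := Function.update_self _ _ _
  have hWj : ∀ j, j ≠ 0 → W j = (V j 0)⁻¹ • V j := fun j hj => Function.update_of_ne hj _ _
  have hW1 : ∀ j, W j 0 = 1 := by
    intro j
    by_cases hj : j = 0
    · subst hj
      rw [hW0]
      exact inv_mul_cancel₀ hv00
    · rw [hWj j hj]
      exact inv_mul_cancel₀ (hV0 j hj)
  let u : ColIdx n → ℂ := fun q => W q.1.castSucc (Fin.succ q.2)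
  have hhom : ∀ j, homVec h u j = W j := by
    intro j
    ext a
    refine Fin.cases ?_ (fun a => ?_) a
    · rw [hW1]; rfl
    · change vertexVec h u j a = _
      revert a
      refine Fin.lastCases (fun a => ?_) (fun i a => ?_) j
      · rw [vertexVec_last]
        change W 0 (Fin.succ (Fin.cast h a)) = _
        rw [hW0, hWj _ hlz, hVl]
        rfl
      · rw [vertexVec_castSucc]
  have hx : ∀ i : Fin (κ + 1), ∃ s : ℂ, A i *ᵥ W i.succ = s • W i.castSucc := by
    intro i
    rw [hWj _ (Fin.succ_ne_zero i), Matrix.mulVec_smul, ← hVs]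
    by_cases hi : i = 0
    · subst hi
      refine ⟨(V (Fin.succ 0) 0)⁻¹ * (e * v 0), ?_⟩
      have h1 : ∀ t : ℂ, t • V 0 = (t * (e * v 0)) • W 0 := fun t => by
        rw [hVz, hW0, smul_smul, smul_smul, mul_assoc, mul_assoc, mul_inv_cancel₀ hv00, mul_one]
      exact h1 _
    · have hi' : i.castSucc ≠ 0 := fun hc => hi (Fin.castSucc_injective _ hc)
      refine ⟨(V i.succ 0)⁻¹ * V i.castSucc 0, ?_⟩
      rw [hWj _ hi', smul_smul, mul_assoc, mul_inv_cancel₀ (hV0 _ hi'), mul_one]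
  have hblock : ∀ i : Fin (κ + 1), A i *ᵥ W i.succ = (Fin.cons (cornerVal h u p i)
      ((fun a => c ⟨i, a⟩) + chainMat p.2.2 i *ᵥ vertexVec h u i.succ) :
        Fin (n i.castSucc + 1) → ℂ) := by
    intro i
    rw [← hhom, hA, chainMat_assemble, homVec]
    refine (block_mulVec _ _ _ _ _ _).trans ?_
    rw [mul_one, one_smul]
    rfl
  have hxi : ∀ i : Fin (κ + 1), A i *ᵥ W i.succ = cornerVal h u p i • W i.castSucc := by
    intro i
    obtain ⟨s, hs⟩ := hx i
    have h1 := congrFun hs 0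
    rw [hblock, Fin.cons_zero, Pi.smul_apply, hW1, smul_eq_mul, mul_one] at h1
    rw [hs, h1]
  have hfib : fiberMap h p u = c := by
    ext ⟨i, a⟩
    have h1 := congrFun ((hblock i).symm.trans (hxi i)) (Fin.succ a)
    rw [Fin.cons_succ, Pi.add_apply, Pi.smul_apply, smul_eq_mul] at h1
    change cornerVal h u p i * W i.castSucc (Fin.succ a) - _ = _
    rw [← h1]
    simp
  refine ⟨u, hfib, ?_⟩
  have h1 := squareProd_mulVec_homVec h hfib
  rw [hhom, hW0, Matrix.mulVec_smul, ← hA, hMv] at h1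
  have h2 := congrFun h1 0
  simp only [Pi.smul_apply, smul_eq_mul] at h2
  rw [mul_left_comm, inv_mul_cancel₀ hv00] at h2
  simpa using h2.symm

end fiber

/-! ### Splitting off one eigenvalue in sums over orderings. -/

/-- The sum of a function over all orderings of the eigenvalues of a matrix. -/
noncomputable def orderingSum {N : ℕ} (f : (Fin N → ℂ) → ENNReal) (M : Matrix (Fin N) (Fin N) ℂ) :
    ENNReal := ∑ σ : Equiv.Perm (Fin N), f (eigVec M ∘ σ)

theorem orderingSum_congr {N : ℕ} (f : (Fin N → ℂ) → ENNReal) {M M' : Matrix (Fin N) (Fin N) ℂ}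
    (h : M.charpoly = M'.charpoly) : orderingSum f M = orderingSum f M' := by
  obtain ⟨σ, hσ⟩ := exists_perm_of_map_univ_eq (z := eigVec M) (z' := eigVec M') (by
    rw [map_eigVec, map_eigVec, eigenvalueMultiset, eigenvalueMultiset, h])
  rw [orderingSum, orderingSum, hσ]
  refine (Fintype.sum_equiv (Equiv.mulLeft σ) _ _ fun τ => ?_).symm
  rfl

theorem map_univ_cons {N : ℕ} (e : ℂ) (z : Fin N → ℂ) :
    (Finset.univ : Finset (Fin (N + 1))).val.map (Fin.cons e z : Fin (N + 1) → ℂ) =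
      e ::ₘ (Finset.univ : Finset (Fin N)).val.map z := by
  rw [Fin.univ_val_map, Fin.univ_val_map, List.ofFn_cons, Multiset.cons_coe]

theorem eigenvalueMultiset_eq_cons {N : ℕ} {M : Matrix (Fin (N + 1)) (Fin (N + 1)) ℂ}
    {M' : Matrix (Fin N) (Fin N) ℂ} {e : ℂ}
    (h : M.charpoly = (Polynomial.X - Polynomial.C e) * M'.charpoly) :
    eigenvalueMultiset M = e ::ₘ eigenvalueMultiset M' := by
  rw [eigenvalueMultiset, h, Polynomial.roots_mul (h ▸ M.charpoly_monic.ne_zero),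
    Polynomial.roots_X_sub_C]
  rfl

/-- Each eigenvalue is not a root of its cofactor, hence has multiplicity one. -/
theorem injective_eigVec_of_factor {N : ℕ} {M : Matrix (Fin (N + 1)) (Fin (N + 1)) ℂ}
    (h : ∀ l, ∃ M' : Matrix (Fin N) (Fin N) ℂ,
      M.charpoly = (Polynomial.X - Polynomial.C (eigVec M l)) * M'.charpoly ∧
        M'.charpoly.eval (eigVec M l) ≠ 0) : Function.Injective (eigVec M) := by
  have hnd : ((Finset.univ : Finset (Fin (N + 1))).val.map (eigVec M)).Nodup := by
    rw [Multiset.nodup_iff_count_le_one]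
    intro a
    by_cases ha : a ∈ (Finset.univ : Finset (Fin (N + 1))).val.map (eigVec M)
    · obtain ⟨l, -, rfl⟩ := Multiset.mem_map.1 ha
      obtain ⟨M', h1, h2⟩ := h l
      rw [map_eigVec, eigenvalueMultiset_eq_cons h1, Multiset.count_cons_self,
        Multiset.count_eq_zero_of_notMem]
      exact fun hc => h2 (Polynomial.isRoot_of_mem_roots hc)
    · rw [Multiset.count_eq_zero_of_notMem ha]
      exact Nat.zero_le _
  intro a b hab
  exact Multiset.inj_on_of_nodup_map hnd a (Finset.mem_univ a) b (Finset.mem_univ b) hab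

/-- Orderings are grouped by their first element `l`. Simplicity of the spectrum gives `σ l 0 = l`,
and the remaining freedom is a permutation fixing `0`, encoded by `decomposeFin`. -/
theorem orderingSum_eq_sum_factor {N : ℕ} {M : Matrix (Fin (N + 1)) (Fin (N + 1)) ℂ}
    (f : (Fin (N + 1) → ℂ) → ENNReal) (hM : Function.Injective (eigVec M))
    (M' : Fin (N + 1) → Matrix (Fin N) (Fin N) ℂ)
    (h : ∀ l, M.charpoly = (Polynomial.X - Polynomial.C (eigVec M l)) * (M' l).charpoly) :
    orderingSum f M = ∑ l, orderingSum (fun z => f (Fin.cons (eigVec M l) z)) (M' l) := by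
  have hσ : ∀ l, ∃ σ : Equiv.Perm (Fin (N + 1)),
      (Fin.cons (eigVec M l) (eigVec (M' l)) : Fin (N + 1) → ℂ) = eigVec M ∘ σ := fun l =>
    exists_perm_of_map_univ_eq (by
      rw [map_univ_cons, map_eigVec, map_eigVec, eigenvalueMultiset_eq_cons (h l)])
  choose σ hσ using hσ
  have hσ0 : ∀ l, σ l 0 = l := fun l => hM (congrFun (hσ l) 0).symm
  let e : Fin (N + 1) × Equiv.Perm (Fin N) → Equiv.Perm (Fin (N + 1)) := fun q =>
    σ q.1 * Equiv.Perm.decomposeFin.symm (0, q.2)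
  have he : Function.Bijective e := by
    refine (Fintype.bijective_iff_injective_and_card e).2 ⟨?_, ?_⟩
    · rintro ⟨l, τ⟩ ⟨l', τ'⟩ hq
      have h0 : l = l' := by
        have := congrArg (fun s : Equiv.Perm (Fin (N + 1)) => s 0) hq
        simpa [e, hσ0] using this
      subst h0
      have := Equiv.Perm.decomposeFin.symm.injective (mul_left_cancel hq)
      exact Prod.ext rfl (Prod.ext_iff.1 this).2
    · rw [Fintype.card_prod, Fintype.card_perm, Fintype.card_perm, Fintype.card_fin,
        Fintype.card_fin, Nat.factorial_succ]
  simp only [orderingSum]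
  rw [← Fintype.sum_prod_type']
  refine (Fintype.sum_bijective e he _ _ fun q => ?_).symm
  congr 1
  have h1 : eigVec M ∘ e q =
      (Fin.cons (eigVec M q.1) (eigVec (M' q.1)) : Fin (N + 1) → ℂ) ∘
        Equiv.Perm.decomposeFin.symm (0, q.2) := by
    rw [hσ]
    rfl
  rw [h1]
  ext i
  refine Fin.cases ?_ (fun i => ?_) i <;> simp

section fiber

variable {κ : ℕ} {n : Fin (κ + 1 + 1) → ℕ} (h : n (Fin.last (κ + 1)) = n 0)

/-- A root of the characteristic polynomial determines a unique fibre point and conversely, so the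
sum over the first eigenvalue becomes a sum over the fibre. -/
theorem IsGenericChain.orderingSum_eq {p : Params n} {c : ColIdx n → ℂ}
    (hg : IsGenericChain h (assemble c p)) {s : Set (ColIdx n → ℂ)}
    (hs : ∀ u, u ∈ s ↔ fiberMap h p u = c)
    (hne : ∀ u ∈ s, (squareProd h (chainMat (triangularize h u p).2.2)).charpoly.eval
      (∏ i, cornerVal h u p i) ≠ 0) (f : (Fin (n 0 + 1) → ℂ) → ENNReal) :
    orderingSum f (squareProd (n := fun j => n j + 1) (succ_dims h) (chainMat (assemble c p))) =
      ∑' u : s, orderingSum (fun z => f (Fin.cons (∏ i, cornerVal h u p i) z))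
        (squareProd h (chainMat (triangularize h u p).2.2)) := by
  set M := squareProd (n := fun j => n j + 1) (succ_dims h) (chainMat (assemble c p)) with hM
  have hfac : ∀ u ∈ s, M.charpoly = (Polynomial.X - Polynomial.C (∏ i, cornerVal h u p i)) *
      (squareProd h (chainMat (triangularize h u p).2.2)).charpoly := fun u hu => by
    rw [hM, ← (hs u).1 hu]
    exact charpoly_squareProd_assemble_fiberMap h p u
  have hex : ∀ l, ∃ u : s, ∏ i, cornerVal h u p i = eigVec M l := fun l => by
    obtain ⟨u, hu, hl⟩ := hg.exists_of_isRoot h (e := eigVec M l) (by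
      rw [charpoly_eval_eq_prod_eigVec]
      exact Finset.prod_eq_zero (Finset.mem_univ l) (sub_self _))
    exact ⟨⟨u, (hs u).2 hu⟩, hl⟩
  choose U hU using hex
  have hinj : Function.Injective (eigVec M) := injective_eigVec_of_factor fun l =>
    ⟨squareProd h (chainMat (triangularize h (U l) p).2.2), by
      rw [← hU]; exact hfac _ (U l).2, by rw [← hU]; exact hne _ (U l).2⟩
  rw [orderingSum_eq_sum_factor f hinj
    (fun l => squareProd h (chainMat (triangularize h (U l) p).2.2)) fun l => by
      rw [← hU]; exact hfac _ (U l).2]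
  have hUb : Function.Bijective U := by
    refine ⟨fun l l' hl => hinj (by rw [← hU, ← hU, hl]), fun u => ?_⟩
    have hroot : M.charpoly.eval (∏ i, cornerVal h u p i) = 0 := by
      rw [hfac u u.2, Polynomial.eval_mul, Polynomial.eval_sub, Polynomial.eval_X,
        Polynomial.eval_C, sub_self, zero_mul]
    rw [charpoly_eval_eq_prod_eigVec, Finset.prod_eq_zero_iff] at hroot
    obtain ⟨l, -, hl⟩ := hroot
    refine ⟨l, Subtype.ext (hg.eq_of_prod_cornerVal_eq h ((hs _).1 (U l).2) ((hs _).1 u.2) ?_)⟩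
    rw [hU, sub_eq_zero.1 hl]
  rw [← (Equiv.ofBijective U hUb).tsum_eq, tsum_fintype]
  refine Finset.sum_congr rfl fun l _ => ?_
  simp only [Equiv.ofBijective_apply, hU]

end fiber

/-! ### The area formula applied to the parametrisation. -/

section derivative

variable {κ : ℕ} {n : Fin (κ + 1 + 1) → ℕ} (h : n (Fin.last (κ + 1)) = n 0)

/-- The complex derivative of the map between first columns. -/
noncomputable def fiberMapDeriv (p : Params n) (u : ColIdx n → ℂ) :
    (ColIdx n → ℂ) →L[ℂ] (ColIdx n → ℂ) :=
  LinearMap.toContinuousLinearMap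
    (fiberDeriv h (cornerVal h u p) (chainMat (triangularize h u p).2.2))

theorem continuous_cornerVal :
    Continuous fun q : (ColIdx n → ℂ) × Params n => cornerVal h q.1 q.2 := by
  unfold cornerVal vertexVec dotProduct
  fun_prop

theorem continuous_triangularize :
    Continuous fun q : (ColIdx n → ℂ) × Params n => triangularize h q.1 q.2 := by
  have := continuous_cornerVal h
  unfold triangularize
  fun_prop

theorem hasFDerivAt_fiberMap (p : Params n) (u : ColIdx n → ℂ) :
    HasFDerivAt (fiberMap h p) (fiberMapDeriv h p u) u := by
  rw [hasFDerivAt_pi']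
  intro e
  have hv : ∀ j (a : Fin (n j)), HasFDerivAt (fun u : ColIdx n → ℂ => vertexVec h u j a)
      (ContinuousLinearMap.proj (R := ℂ) (φ := fun _ : ColIdx n => ℂ) (vertexIdx h j a)) u :=
    fun j a => hasFDerivAt_apply _ _
  have hc : HasFDerivAt (fun u : ColIdx n → ℂ => cornerVal h u p e.1)
      (∑ b, p.2.1 ⟨e.1, b⟩ • ContinuousLinearMap.proj (R := ℂ) (φ := fun _ : ColIdx n => ℂ)
        (vertexIdx h e.1.succ b)) u :=
    (HasFDerivAt.fun_sum fun b _ => (hv e.1.succ b).const_mul (p.2.1 ⟨e.1, b⟩)).const_add _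
  have h1 := (hc.mul (hasFDerivAt_apply e u)).sub
    (HasFDerivAt.fun_sum fun b (_ : b ∈ Finset.univ) =>
      (hv e.1.succ b).const_mul (chainMat p.2.2 e.1 e.2 b))
  refine h1.congr_fderiv ?_
  ext du
  simp only [fiberMapDeriv, fiberDeriv, triangularize, chainMat, mulVec, dotProduct, vertexVec,
    ContinuousLinearMap.comp_apply, ContinuousLinearMap.proj_apply,
    LinearMap.coe_toContinuousLinearMap', LinearMap.coe_mk, AddHom.coe_mk]
  simp [sub_mul, Finset.sum_sub_distrib, Finset.mul_sum, mul_assoc]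
  ring

/-- The real determinant of a complex-linear map is the field norm of its complex determinant. -/
theorem det_restrictScalars_eq {E : Type*} [NormedAddCommGroup E] [NormedSpace ℂ E]
    [FiniteDimensional ℂ E] (L : E →L[ℂ] E) :
    (L.restrictScalars ℝ).det = ‖LinearMap.det (L : E →ₗ[ℂ] E)‖ ^ 2 := by
  rw [← Complex.normSq_eq_norm_sq, ← Algebra.norm_complex_apply, ← LinearMap.det_restrictScalars]
  rfl

/-- The squared modulus of the Jacobian determinant of the map between first columns, in terms of
the parameters of the block triangular chain. -/
noncomputable def jacobianSq (q : Params n) : ℝ :=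
  ‖LinearMap.det (fiberDeriv h q.1 (chainMat q.2.2))‖ ^ 2

theorem det_fiberMapDeriv (p : Params n) (u : ColIdx n → ℂ) :
    ((fiberMapDeriv h p u).restrictScalars ℝ).det = jacobianSq h (triangularize h u p) := by
  rw [det_restrictScalars_eq]
  rfl

theorem continuous_fiberMapDeriv (p : Params n) :
    Continuous fun u => (fiberMapDeriv h p u).restrictScalars ℝ := by
  rw [continuous_clm_apply]
  intro v
  have h1 : Continuous fun u => triangularize h u p :=
    (continuous_triangularize h).comp (by fun_prop : Continuous fun u => (u, p))
  have h2 : Continuous fun u => cornerVal h u p := h1.fst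
  have h3 : Continuous fun u => (triangularize h u p).2.2 := h1.snd.snd
  refine continuous_pi fun e => ?_
  change Continuous fun u => cornerVal h u p e.1 * v e -
    ∑ b, (triangularize h u p).2.2 ⟨e.1, e.2, b⟩ * vertexVec h v e.1.succ b
  fun_prop

/-- This is Sard's theorem in equal dimensions: the image of the critical set is null. -/
theorem ae_jacobianSq_ne_zero (p : Params n) :
    ∀ᵐ c, ∀ u, fiberMap h p u = c → jacobianSq h (triangularize h u p) ≠ 0 := by
  have h1 := addHaar_image_eq_zero_of_det_fderivWithin_eq_zero (volume : Measure (ColIdx n → ℂ))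
    (f := fiberMap h p) (s := {u | jacobianSq h (triangularize h u p) = 0})
    (f' := fun u => (fiberMapDeriv h p u).restrictScalars ℝ)
    (fun u _ => ((hasFDerivAt_fiberMap h p u).restrictScalars ℝ).hasFDerivWithinAt)
    (fun u hu => (det_fiberMapDeriv h p u).trans hu)
  filter_upwards [measure_eq_zero_iff_ae_notMem.1 h1] with c hc u hu h0
  exact hc ⟨u, h0, hu⟩

theorem lintegral_jacobianSq_mul (p : Params n) {G : (ColIdx n → ℂ) → ENNReal}
    (hG : Measurable G) :
    ∫⁻ u, ENNReal.ofReal (jacobianSq h (triangularize h u p)) * G u =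
      ∫⁻ c, ∑' u : {u | fiberMap h p u = c ∧ jacobianSq h (triangularize h u p) ≠ 0}, G u := by
  have h1 := lintegral_abs_det_fderiv_mul_eq_lintegral_tsum_fiber
    (volume : Measure (ColIdx n → ℂ)) (f := fiberMap h p)
    (fun u => (hasFDerivAt_fiberMap h p u).restrictScalars ℝ) (continuous_fiberMapDeriv h p) hG
  refine Eq.trans (lintegral_congr fun u => ?_) (h1.trans (lintegral_congr fun c => ?_))
  · rw [det_fiberMapDeriv, abs_of_nonneg (sq_nonneg _)]
  · have hset : {u | fiberMap h p u = c ∧ ((fiberMapDeriv h p u).restrictScalars ℝ).det ≠ 0} =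
        {u | fiberMap h p u = c ∧ jacobianSq h (triangularize h u p) ≠ 0} :=
      Set.ext fun u => and_congr_right fun _ => not_congr (by rw [det_fiberMapDeriv])
    rw [hset]

end derivative

/-! ### Almost every chain is generic. -/

section generic

variable {κ : ℕ} {n : Fin (κ + 1 + 1) → ℕ} (h : n (Fin.last (κ + 1)) = n 0)

theorem differentiable_suffixProd {k : ℕ} {m : Fin (k + 1) → ℕ} (j : Fin (k + 1)) (a b) :
    Differentiable ℂ fun A : ChainIdx m → ℂ => suffixProd (chainMat A) j a b := by
  induction j using Fin.reverseInduction with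
  | last => simp only [suffixProd_last]; fun_prop
  | cast i ih =>
    simp only [suffixProd_castSucc, Matrix.mul_apply]
    have h1 : ∀ c, Differentiable ℂ fun A : ChainIdx m → ℂ => chainMat A i a c := fun c => by
      simp only [chainMat, Matrix.of_apply]
      fun_prop
    have h2 := fun c => ih c b
    fun_prop

/-- The row vectors `r, r M, r M², …`. -/
def krylov {N : ℕ} (r : Fin N → ℂ) (M : Matrix (Fin N) (Fin N) ℂ) : Matrix (Fin N) (Fin N) ℂ :=
  Matrix.of fun t => r ᵥ* M ^ (t : ℕ)

theorem differentiable_det_krylov {E : Type*} [NormedAddCommGroup E] [NormedSpace ℂ E] {N : ℕ}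
    {r : E → Fin N → ℂ} {M : E → Matrix (Fin N) (Fin N) ℂ}
    (hr : ∀ a, Differentiable ℂ fun x => r x a) (hM : ∀ a b, Differentiable ℂ fun x => M x a b) :
    Differentiable ℂ fun x => (krylov (r x) (M x)).det := by
  have h1 : ∀ (t : ℕ) (b : Fin N), Differentiable ℂ fun x => (r x ᵥ* M x ^ t) b := by
    intro t
    induction t with
    | zero => simpa using hr
    | succ t ih =>
      intro b
      simp only [pow_succ, ← Matrix.vecMul_vecMul]
      change Differentiable ℂ fun x => ∑ c, (r x ᵥ* M x ^ t) c * M x c b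
      fun_prop
  simp only [Matrix.det_apply, krylov, Matrix.of_apply]
  fun_prop

/-- If `r` annihilates an eigenvector `v`, then so does every `r M^t`, and `v` is a null vector of
the Krylov matrix. -/
theorem dotProduct_ne_zero_of_det_krylov_ne_zero {N : ℕ} {r : Fin N → ℂ}
    {M : Matrix (Fin N) (Fin N) ℂ} (hdet : (krylov r M).det ≠ 0) {v : Fin N → ℂ} {e : ℂ}
    (hv : v ≠ 0) (hMv : M *ᵥ v = e • v) : r ⬝ᵥ v ≠ 0 := by
  intro h0
  refine hdet (Matrix.exists_mulVec_eq_zero_iff.1 ⟨v, hv, funext fun t => ?_⟩)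
  have hpow : ∀ t : ℕ, M ^ t *ᵥ v = e ^ t • v := by
    intro t
    induction t with
    | zero => simp
    | succ t ih =>
      rw [pow_succ, ← Matrix.mulVec_mulVec, hMv, Matrix.mulVec_smul, ih, smul_smul, pow_succ,
        mul_comm]
  change (r ᵥ* M ^ (t : ℕ)) ⬝ᵥ v = 0
  rw [← Matrix.dotProduct_mulVec, hpow, dotProduct_smul, h0, smul_zero]

/-- The first row of the tail of the product of a chain. -/
def firstRow (A : ChainIdx (fun j => n j + 1) → ℂ) (j : Fin (κ + 1 + 1)) : Fin (n 0 + 1) → ℂ :=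
  fun b => suffixProd (n := fun j => n j + 1) (chainMat A) j 0 (Fin.cast (succ_dims h).symm b)

theorem isGenericChain_of_det_krylov_ne_zero {A : ChainIdx (fun j => n j + 1) → ℂ}
    (hA : ∀ j : Fin (κ + 1 + 1), j ≠ 0 → (krylov (firstRow h A j)
      (squareProd (n := fun j => n j + 1) (succ_dims h) (chainMat A))).det ≠ 0) :
    IsGenericChain h A := by
  intro j hj v e hv hMv
  have := dotProduct_ne_zero_of_det_krylov_ne_zero (hA j hj) hv hMv
  refine fun hc => this (Eq.trans ?_ hc)
  exact Fintype.sum_equiv (finCongr (succ_dims h).symm) _ _ fun b => rfl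

/-- The chain whose first matrix is a shift and whose other matrices are truncated identities. -/
def shiftChain {k : ℕ} (m : Fin (k + 1 + 1) → ℕ) : ChainIdx m → ℂ :=
  fun e => if e.1 = 0 then if (e.2.2 : ℕ) = e.2.1 + 1 then 1 else 0
    else if (e.2.1 : ℕ) = e.2.2 then 1 else 0

theorem suffixProd_shiftChain {k : ℕ} {m : Fin (k + 1 + 1) → ℕ} (hm : m (Fin.last (k + 1)) = m 0)
    (hmin : ∀ j, m 0 ≤ m j) (j : Fin (k + 1 + 1)) (hj : j ≠ 0) (a : Fin (m j)) (b) :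
    suffixProd (chainMat (shiftChain m)) j a b = if (a : ℕ) = b then 1 else 0 := by
  induction j using Fin.reverseInduction with
  | last => rw [suffixProd_last, Matrix.one_apply]; simp only [Fin.ext_iff]
  | cast i ih =>
    have hb : (b : ℕ) < m i.succ := (hm ▸ b.2 : (b : ℕ) < m 0).trans_le (hmin _)
    have hi : i ≠ 0 := fun hc => hj (by rw [hc]; rfl)
    rw [suffixProd_castSucc, Matrix.mul_apply, Finset.sum_eq_single ⟨b, hb⟩]
    · rw [ih (Fin.succ_ne_zero i)]
      simp [chainMat, shiftChain, hi]
    · intro c _ hc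
      rw [ih (Fin.succ_ne_zero i), if_neg (fun hcb => hc (Fin.ext hcb)), mul_zero]
    · simp

theorem squareProd_shiftChain {k : ℕ} {m : Fin (k + 1 + 1) → ℕ} (hm : m (Fin.last (k + 1)) = m 0)
    (hmin : ∀ j, m 0 ≤ m j) (a b : Fin (m 0)) :
    squareProd hm (chainMat (shiftChain m)) a b = if (b : ℕ) = a + 1 then 1 else 0 := by
  have key : ∀ (a : Fin (m (Fin.castSucc 0))) (b : Fin (m (Fin.last (k + 1)))),
      suffixProd (chainMat (shiftChain m)) (Fin.castSucc 0) a b =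
        if (b : ℕ) = a + 1 then 1 else 0 := by
    intro a b
    have hb : (b : ℕ) < m (Fin.succ 0) := (hm ▸ b.2 : (b : ℕ) < m 0).trans_le (hmin _)
    rw [suffixProd_castSucc, Matrix.mul_apply, Finset.sum_eq_single ⟨b, hb⟩]
    · rw [suffixProd_shiftChain hm hmin _ (Fin.succ_ne_zero 0)]
      simp [chainMat, shiftChain]
      rfl
    · intro c _ hc
      rw [suffixProd_shiftChain hm hmin _ (Fin.succ_ne_zero 0),
        if_neg (fun hcb => hc (Fin.ext hcb)), mul_zero]
    · exact fun hc => absurd (Finset.mem_univ _) hc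
  rw [squareProd_eq]
  exact key a (Fin.cast hm.symm b)

theorem krylov_shift {N : ℕ} {r : Fin N → ℂ} {M : Matrix (Fin N) (Fin N) ℂ}
    (hr : ∀ b, r b = if (b : ℕ) = 0 then 1 else 0)
    (hM : ∀ a b, M a b = if (b : ℕ) = a + 1 then 1 else 0) : krylov r M = 1 := by
  have h1 : ∀ (t : ℕ) (b : Fin N), (r ᵥ* M ^ t) b = if (b : ℕ) = t then 1 else 0 := by
    intro t
    induction t with
    | zero => simpa using hr
    | succ t ih =>
      intro b
      rw [pow_succ, ← Matrix.vecMul_vecMul]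
      simp only [vecMul, dotProduct] at ih ⊢
      simp only [ih, hM]
      by_cases hb : (b : ℕ) = t + 1
      · rw [if_pos hb, Finset.sum_eq_single ⟨t, by omega⟩]
        · simp [hb]
        · intro c _ hc
          rw [if_neg (fun hct => hc (Fin.ext hct)), zero_mul]
        · simp
      · rw [if_neg hb]
        refine Finset.sum_eq_zero fun c _ => ?_
        split_ifs <;> first | omega | simp
  ext t b
  rw [krylov, Matrix.of_apply, h1, Matrix.one_apply]
  simp only [Fin.ext_iff, eq_comm]

/-- Genericity follows from finitely many holomorphic functions of the entries being nonzero. At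
`shiftChain` the product is the nilpotent shift and each relevant first row is the first basis
vector, so the Krylov matrices are the identity. The minimality of `n 0` ensures that the truncated
identities lose nothing. -/
theorem ae_isGenericChain (hmin : ∀ j, n 0 ≤ n j) :
    ∀ᵐ A : ChainIdx (fun j => n j + 1) → ℂ, IsGenericChain h A := by
  have h1 : ∀ j : Fin (κ + 1 + 1), j ≠ 0 → ∀ᵐ A : ChainIdx (fun j => n j + 1) → ℂ,
      (krylov (firstRow h A j)
        (squareProd (n := fun j => n j + 1) (succ_dims h) (chainMat A))).det ≠ 0 := by
    intro j hj
    have hmin' : ∀ j, (fun j => n j + 1) 0 ≤ (fun j => n j + 1) j := fun j =>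
      Nat.succ_le_succ (hmin j)
    refine ae_ne_zero_of_differentiable volume (x₀ := shiftChain fun j => n j + 1)
      (differentiable_det_krylov (fun a => ?_) fun a b => ?_) ?_
    · exact differentiable_suffixProd (m := fun j => n j + 1) j _ _
    · simp only [squareProd_eq]
      exact differentiable_suffixProd (m := fun j => n j + 1) 0 _ _
    · rw [krylov_shift (fun b => ?_)
        (squareProd_shiftChain (m := fun j => n j + 1) (succ_dims h) hmin'), Matrix.det_one]
      · exact one_ne_zero
      · refine (suffixProd_shiftChain (succ_dims h) hmin' j hj _ _).trans ?_
        exact if_congr ⟨fun hb => hb.symm, fun hb => hb.symm⟩ rfl rfl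
  filter_upwards [ae_all_iff.2 fun j => ae_all_iff.2 (h1 j)] with A hA
  exact isGenericChain_of_det_krylov_ne_zero h hA

end generic

/-! ### The Gaussian integral over chains in the new coordinates. -/

/-- The unnormalised standard complex Gaussian density. -/
noncomputable def gaussDensity {ι : Type*} [Fintype ι] (A : ι → ℂ) : ENNReal :=
  ENNReal.ofReal (Real.exp (-∑ e, ‖A e‖ ^ 2))

theorem measurable_gaussDensity {ι : Type*} [Fintype ι] :
    Measurable (gaussDensity : (ι → ℂ) → ENNReal) := by
  unfold gaussDensity
  fun_prop

theorem measurable_fin_cons {X : Type*} [MeasurableSpace X] {N : ℕ} {g : X → ℂ}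
    {v : X → Fin N → ℂ} (hg : Measurable g) (hv : Measurable v) :
    Measurable fun x => (Fin.cons (g x) (v x) : Fin (N + 1) → ℂ) := by
  refine measurable_pi_lambda _ fun i => ?_
  refine Fin.cases ?_ (fun i => ?_) i
  · exact hg
  · exact (measurable_pi_apply i).comp hv

theorem measurable_orderingSum {X : Type*} [MeasurableSpace X] {N : ℕ}
    {f : X → (Fin N → ℂ) → ENNReal} (hf : Measurable fun q : X × (Fin N → ℂ) => f q.1 q.2)
    {M : X → Matrix (Fin N) (Fin N) ℂ} (hM : ∀ a b, Measurable fun x => M x a b) :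
    Measurable fun x => orderingSum (f x) (M x) := by
  unfold orderingSum
  refine Finset.measurable_sum _ fun σ _ => ?_
  have h1 : Measurable fun x => eigVec (M x) ∘ σ := measurable_pi_lambda _ fun i =>
    (measurable_pi_apply (σ i)).comp (measurable_eigVec_comp hM)
  exact hf.comp (measurable_id.prodMk h1)

theorem continuous_squareProd {k : ℕ} {m : Fin (k + 1) → ℕ} (hm : m (Fin.last k) = m 0)
    (a b : Fin (m 0)) :
    Continuous fun A : ChainIdx m → ℂ => squareProd hm (chainMat A) a b := by
  simp only [squareProd_eq]
  exact (differentiable_suffixProd (m := m) 0 _ _).continuous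

section peel

variable {κ : ℕ} {n : Fin (κ + 1 + 1) → ℕ} (h : n (Fin.last (κ + 1)) = n 0)

theorem continuous_jacobianSq : Continuous (jacobianSq h) := by
  unfold jacobianSq
  simp only [← LinearMap.det_toMatrix']
  refine (Continuous.matrix_det (continuous_matrix fun e e' => ?_)).norm.pow 2
  simp only [LinearMap.toMatrix'_apply]
  change Continuous fun q : Params n => q.1 e.1 * _ -
    ∑ b, q.2.2 ⟨e.1, e.2, b⟩ * vertexVec h _ e.1.succ b
  fun_prop

/-- The Jacobian factor times the sum over the orderings of the remaining eigenvalues. -/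
noncomputable def peeled (f : (Fin (n 0 + 1) → ℂ) → ENNReal) (q : Params n) : ENNReal :=
  ENNReal.ofReal (jacobianSq h q) *
    orderingSum (fun z => f (Fin.cons (∏ i, q.1 i) z)) (squareProd h (chainMat q.2.2))

theorem measurable_orderingSum_cons {f : (Fin (n 0 + 1) → ℂ) → ENNReal} (hf : Measurable f) :
    Measurable fun q : Params n =>
      orderingSum (fun z => f (Fin.cons (∏ i, q.1 i) z)) (squareProd h (chainMat q.2.2)) := by
  refine measurable_orderingSum
    (f := fun (q : Params n) z => f (Fin.cons (∏ i, q.1 i) z)) ?_ fun a b => ?_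
  · refine hf.comp (measurable_fin_cons ?_ measurable_snd)
    exact Finset.measurable_prod _ fun i _ => (measurable_pi_apply i).comp
      (measurable_fst.comp measurable_fst)
  · exact (continuous_squareProd h a b).measurable.comp (measurable_snd.comp measurable_snd)

theorem measurable_peeled {f : (Fin (n 0 + 1) → ℂ) → ENNReal} (hf : Measurable f) :
    Measurable (peeled h f) :=
  (continuous_jacobianSq h).measurable.ennreal_ofReal.mul (measurable_orderingSum_cons h hf)

theorem continuous_assemble :
    Continuous fun q : (ColIdx n → ℂ) × Params n => assemble q.1 q.2 := by
  refine continuous_pi fun ⟨i, a, b⟩ => ?_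
  revert a b
  refine Fin.cases (Fin.cases ?_ fun b => ?_) fun a => Fin.cases ?_ fun b => ?_
  · change Continuous fun q : (ColIdx n → ℂ) × Params n => q.2.1 i
    fun_prop
  · change Continuous fun q : (ColIdx n → ℂ) × Params n => q.2.2.1 ⟨i, b⟩
    fun_prop
  · change Continuous fun q : (ColIdx n → ℂ) × Params n => q.1 ⟨i, a⟩
    fun_prop
  · change Continuous fun q : (ColIdx n → ℂ) × Params n => q.2.2.2 ⟨i, a, b⟩
    fun_prop

theorem continuous_assemble_fiberMap :
    Continuous fun q : (ColIdx n → ℂ) × Params n => assemble (fiberMap h q.2 q.1) q.2 := by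
  have h1 : Continuous fun q : (ColIdx n → ℂ) × Params n => fiberMap h q.2 q.1 := by
    have := continuous_cornerVal h
    refine continuous_pi fun e => ?_
    change Continuous fun q : (ColIdx n → ℂ) × Params n => cornerVal h q.1 q.2 e.1 * q.1 e -
      ∑ b, q.2.2.2 ⟨e.1, e.2, b⟩ * q.1 (vertexIdx h e.1.succ b)
    fun_prop
  exact continuous_assemble.comp (h1.prodMk continuous_snd)

/-- The contribution of the chart point `u` to the integral over chains. -/
noncomputable def chartIntegral (f : (Fin (n 0 + 1) → ℂ) → ENNReal) (u : ColIdx n → ℂ) : ENNReal :=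
  ∫⁻ p : Params n, peeled h f (triangularize h u p) * gaussDensity (assemble (fiberMap h p u) p)

theorem measurable_chartIntegrand {f : (Fin (n 0 + 1) → ℂ) → ENNReal} (hf : Measurable f) :
    Measurable fun q : (ColIdx n → ℂ) × Params n =>
      peeled h f (triangularize h q.1 q.2) * gaussDensity (assemble (fiberMap h q.2 q.1) q.2) :=
  ((measurable_peeled h hf).comp (continuous_triangularize h).measurable).mul
    (measurable_gaussDensity.comp (continuous_assemble_fiberMap h).measurable)

theorem measurable_chartIntegral {f : (Fin (n 0 + 1) → ℂ) → ENNReal} (hf : Measurable f) :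
    Measurable (chartIntegral h f) :=
  (measurable_chartIntegrand h hf).lintegral_prod_right'

/-- For almost every `c` all fibre points are noncritical. Nonvanishing of the Jacobian there
includes nonvanishing of the cofactor at the split-off eigenvalue, which is the simplicity needed to
identify the ordering sum with the sum over the fibre. -/
theorem lintegral_assemble_eq (hmin : ∀ j, n 0 ≤ n j) {f : (Fin (n 0 + 1) → ℂ) → ENNReal}
    (hf : Measurable f) {p : Params n} (hp : ∀ᵐ c, IsGenericChain h (assemble c p)) :
    ∫⁻ c, gaussDensity (assemble c p) * orderingSum f
        (squareProd (n := fun j => n j + 1) (succ_dims h) (chainMat (assemble c p))) =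
      ∫⁻ u, peeled h f (triangularize h u p) * gaussDensity (assemble (fiberMap h p u) p) := by
  have hpair : Measurable fun u : ColIdx n → ℂ => (u, p) := measurable_id.prodMk measurable_const
  have hasm : Measurable fun u => assemble (fiberMap h p u) p :=
    (continuous_assemble_fiberMap h).measurable.comp hpair
  have htri : Measurable fun u => triangularize h u p :=
    (continuous_triangularize h).measurable.comp hpair
  let G : (ColIdx n → ℂ) → ENNReal := fun u => gaussDensity (assemble (fiberMap h p u) p) *
    orderingSum (fun z => f (Fin.cons (∏ i, (triangularize h u p).1 i) z))
      (squareProd h (chainMat (triangularize h u p).2.2))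
  have hG : Measurable G :=
    (measurable_gaussDensity.comp hasm).mul ((measurable_orderingSum_cons h hf).comp htri)
  have h1 : ∀ u, peeled h f (triangularize h u p) * gaussDensity (assemble (fiberMap h p u) p) =
      ENNReal.ofReal (jacobianSq h (triangularize h u p)) * G u := fun u => by
    simp only [peeled, G]
    rw [mul_assoc, mul_comm (gaussDensity _)]
  simp_rw [h1]
  rw [lintegral_jacobianSq_mul h p hG]
  refine lintegral_congr_ae ?_
  filter_upwards [hp, ae_jacobianSq_ne_zero h p] with c hg hc
  rw [hg.orderingSum_eq h
    (s := {u | fiberMap h p u = c ∧ jacobianSq h (triangularize h u p) ≠ 0})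
    (fun u => ⟨fun hu => hu.1, fun hu => ⟨hu, hc u hu⟩⟩) ?_ f, ← ENNReal.tsum_mul_left]
  · refine tsum_congr fun u => ?_
    change _ = gaussDensity (assemble (fiberMap h p u) p) * _
    rw [u.2.1]
    rfl
  · rintro u ⟨hu, hne⟩ h0
    refine hne ?_
    rw [jacobianSq, norm_det_fiberDeriv_sq h (x := (triangularize h u p).1) _
      (fun i hi => hg.cornerVal_ne_zero h hu hi) hmin]
    change _ * ‖Polynomial.eval (∏ i, cornerVal h u p i) _‖ ^ 2 = 0
    rw [h0]
    simp

set_option synthInstance.maxSize 2000 in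
-- For fixed `p` the first columns are traded for `u`, and Tonelli then puts `u` outermost, so that
-- the inner integral over `p` can be simplified for each `u` separately.
theorem exists_lintegral_chain_eq (hmin : ∀ j, n 0 ≤ n j) :
    ∃ C : ENNReal, C ≠ 0 ∧ C ≠ ⊤ ∧ ∀ f : (Fin (n 0 + 1) → ℂ) → ENNReal, Measurable f →
      ∫⁻ A : ChainIdx (fun j => n j + 1) → ℂ, gaussDensity A * orderingSum f
          (squareProd (n := fun j => n j + 1) (succ_dims h) (chainMat A)) =
        C * ∫⁻ u, chartIntegral h f u := by
  let L : (Params n × (ColIdx n → ℂ)) ≃ₗ[ℝ] (ChainIdx (fun j => n j + 1) → ℂ) :=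
    ((LinearEquiv.prodComm ℂ (Params n) (ColIdx n → ℂ)).trans (assembleEquiv n)).restrictScalars ℝ
  have hL : ∀ q, L q = assemble q.2 q.1 := fun q => rfl
  obtain ⟨C, hC0, hC1, hC⟩ := exists_lintegral_linearEquiv_eq L.symm volume volume
  refine ⟨C, hC0, hC1, fun f hf => ?_⟩
  let F : (ChainIdx (fun j => n j + 1) → ℂ) → ENNReal := fun A => gaussDensity A * orderingSum f
    (squareProd (n := fun j => n j + 1) (succ_dims h) (chainMat A))
  have hF : Measurable F := measurable_gaussDensity.mul
    (measurable_orderingSum (f := fun _ => f) (hf.comp measurable_snd)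
      fun a b => (continuous_squareProd (m := fun j => n j + 1) (succ_dims h) a b).measurable)
  have h1 := hC fun q => F (L q)
  simp only [LinearEquiv.apply_symm_apply] at h1
  have hLm : Measurable L := by
    have : Measurable fun q : Params n × (ColIdx n → ℂ) => assemble q.2 q.1 :=
      continuous_assemble.measurable.comp measurable_swap
    exact this
  have hgen : ∀ᵐ q : Params n × (ColIdx n → ℂ), IsGenericChain h (L q) :=
    ae_of_ae_linearEquiv L volume volume (ae_isGenericChain h hmin)
  refine h1.trans ?_
  congr 1
  rw [Measure.volume_eq_prod] at hgen ⊢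
  rw [lintegral_prod (fun q => F (L q)) (hF.comp hLm).aemeasurable]
  refine Eq.trans (lintegral_congr_ae ?_)
    (lintegral_lintegral_swap (measurable_chartIntegrand h hf).aemeasurable).symm
  filter_upwards [Measure.ae_ae_of_ae_prod hgen] with p hp
  exact lintegral_assemble_eq h hmin hf hp

end peel

/-! ### Replacing shears by block upper triangular matrices. -/

section polar

variable {p : ℕ}

/-- The positive number `√(1 + ‖v‖²)`. -/
noncomputable def polarScale (v : Fin p → ℂ) : ℝ := Real.sqrt (1 + ∑ a, ‖v a‖ ^ 2)

theorem polarScale_pos (v : Fin p → ℂ) : 0 < polarScale v :=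
  Real.sqrt_pos.2 (add_pos_of_pos_of_nonneg one_pos (Finset.sum_nonneg fun _ _ => sq_nonneg _))

theorem star_dotProduct_eq (v : Fin p → ℂ) : star v ⬝ᵥ v = (polarScale v : ℂ) ^ 2 - 1 := by
  have h1 : polarScale v ^ 2 = 1 + ∑ a, ‖v a‖ ^ 2 :=
    Real.sq_sqrt (add_nonneg zero_le_one (Finset.sum_nonneg fun _ _ => sq_nonneg _))
  rw [← Complex.ofReal_pow, h1]
  push_cast
  rw [add_sub_cancel_left]
  refine Finset.sum_congr rfl fun a _ => ?_
  rw [Pi.star_apply, Complex.star_def, Complex.conj_mul']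

/-- The lower right block of the block upper triangular factor of `shear v`. -/
noncomputable def polarBlock (v : Fin p → ℂ) : Matrix (Fin p) (Fin p) ℂ :=
  1 - ((polarScale v : ℂ) * (polarScale v + 1))⁻¹ • vecMulVec v (star v)

/-- The inverse of `polarBlock v`. -/
noncomputable def polarBlockInv (v : Fin p → ℂ) : Matrix (Fin p) (Fin p) ℂ :=
  1 + ((polarScale v : ℂ) + 1)⁻¹ • vecMulVec v (star v)

/-- The block upper triangular matrix whose product with its adjoint is that of `shear v`. -/
noncomputable def polarTri (v : Fin p → ℂ) : Matrix (Fin (p + 1)) (Fin (p + 1)) ℂ :=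
  block (polarScale v) ((polarScale v : ℂ)⁻¹ • star v) 0 (polarBlock v)

/-- The inverse of `polarTri v`. -/
noncomputable def polarTriInv (v : Fin p → ℂ) : Matrix (Fin (p + 1)) (Fin (p + 1)) ℂ :=
  block (polarScale v : ℂ)⁻¹ (-((polarScale v : ℂ)⁻¹ • star v)) 0 (polarBlockInv v)

theorem polarScale_ne_zero (v : Fin p → ℂ) : (polarScale v : ℂ) ≠ 0 :=
  Complex.ofReal_ne_zero.2 (polarScale_pos v).ne'

theorem polarScale_add_one_ne_zero (v : Fin p → ℂ) : (polarScale v : ℂ) + 1 ≠ 0 := by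
  have := polarScale_pos v
  exact_mod_cast (by positivity : polarScale v + 1 ≠ 0)

/-- With `s = polarScale v` one has `‖v‖² = s² - 1`. It follows that `polarBlock v` has eigenvalue
`1 / s` on `v` and `1` on its orthogonal complement, which explains its coefficients. -/
theorem vecMulVec_star_mul_self (v : Fin p → ℂ) :
    vecMulVec v (star v) * vecMulVec v (star v) =
      ((polarScale v : ℂ) ^ 2 - 1) • vecMulVec v (star v) := by
  rw [Matrix.vecMulVec_mul_vecMulVec, star_dotProduct_eq]
  ext a b
  simp [vecMulVec]
  ring

theorem polarBlockInv_mul (v : Fin p → ℂ) : polarBlockInv v * polarBlock v = 1 := by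
  have h0 := polarScale_ne_zero v
  have h1 := polarScale_add_one_ne_zero v
  rw [polarBlockInv, polarBlock, add_mul, one_mul, mul_sub, mul_one, smul_mul_smul_comm,
    vecMulVec_star_mul_self, smul_smul, sub_add_eq_add_sub, sub_eq_iff_eq_add]
  rw [← sub_smul, add_right_inj]
  congr 1
  field_simp
  ring

theorem star_vecMul_polarBlock (v : Fin p → ℂ) :
    star v ᵥ* polarBlock v = (polarScale v : ℂ)⁻¹ • star v := by
  have h0 := polarScale_ne_zero v
  have h1 := polarScale_add_one_ne_zero v
  rw [polarBlock, Matrix.vecMul_sub, Matrix.vecMul_one, Matrix.vecMul_smul,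
    Matrix.vecMul_vecMulVec, star_dotProduct_eq, smul_smul]
  ext a
  simp only [Pi.sub_apply, Pi.smul_apply, smul_eq_mul]
  field_simp
  ring

theorem polarTriInv_mul (v : Fin p → ℂ) : polarTriInv v * polarTri v = 1 := by
  have h0 := polarScale_ne_zero v
  rw [polarTriInv, polarTri, block_mul, ← block_one, polarBlockInv_mul, Matrix.neg_vecMul,
    Matrix.smul_vecMul, star_vecMul_polarBlock]
  congr 1
  · simp [h0]
  · simp
  · simp
  · simp

theorem polarBlock_conjTranspose (v : Fin p → ℂ) : (polarBlock v)ᴴ = polarBlock v := by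
  ext a b
  simp [polarBlock, vecMulVec, Matrix.one_apply, eq_comm, mul_comm, Complex.conj_ofReal]

theorem block_conjTranspose {q : ℕ} (a : ℂ) (w : Fin q → ℂ) (c : Fin p → ℂ)
    (D : Matrix (Fin p) (Fin q) ℂ) : (block a w c D)ᴴ = block (star a) (star c) (star w) Dᴴ :=
  block_ext rfl (fun _ => rfl) (fun _ => rfl) (fun _ _ => rfl)

/-- Equal Gram matrices mean that `shear v` and `polarTri v` differ by a unitary left factor. -/
theorem polarTri_conjTranspose_mul (v : Fin p → ℂ) :
    (polarTri v)ᴴ * polarTri v = (shear v)ᴴ * shear v := by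
  have h0 := polarScale_ne_zero v
  have h1 := polarScale_add_one_ne_zero v
  have hstar : star (polarScale v : ℂ) = polarScale v := Complex.conj_ofReal _
  rw [polarTri, shear, block_conjTranspose, block_conjTranspose, block_mul, block_mul,
    polarBlock_conjTranspose, hstar]
  congr 1
  · simp [star_dotProduct_eq]
    ring
  · ext a
    simp [h0]
  · ext a
    simp [h0]
  · have h2 : polarBlock v * polarBlock v =
        1 - ((polarScale v : ℂ) ^ 2)⁻¹ • vecMulVec v (star v) := by
      rw [polarBlock, sub_mul, one_mul, mul_sub, mul_one, smul_mul_smul_comm,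
        vecMulVec_star_mul_self, smul_smul]
      ext a b
      simp only [Matrix.sub_apply, Matrix.smul_apply, smul_eq_mul]
      field_simp
      ring
    rw [h2]
    ext a b
    simp [vecMulVec, Matrix.one_apply]
    field_simp
    ring

end polar

section frobenius

theorem sum_norm_sq_eq_trace {p q : ℕ} (Y : Matrix (Fin p) (Fin q) ℂ) :
    ((∑ a, ∑ b, ‖Y a b‖ ^ 2 : ℝ) : ℂ) = (Yᴴ * Y).trace := by
  simp only [Matrix.trace, Matrix.diag, Matrix.mul_apply, Matrix.conjTranspose_apply]
  rw [Finset.sum_comm]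
  push_cast
  refine Finset.sum_congr rfl fun a _ => Finset.sum_congr rfl fun b _ => ?_
  rw [Complex.star_def, Complex.conj_mul']

theorem mul_conjTranspose_eq_of_conjTranspose_mul_eq {p : ℕ} {S S' R R' : Matrix (Fin p) (Fin p) ℂ}
    (hS : S' * S = 1) (hR : R' * R = 1) (h : Sᴴ * S = Rᴴ * R) : S' * S'ᴴ = R' * R'ᴴ := by
  have key : ∀ {S S' : Matrix (Fin p) (Fin p) ℂ}, S' * S = 1 → (S' * S'ᴴ) * (Sᴴ * S) = 1 := by
    intro S S' hS
    have h1 : S'ᴴ * Sᴴ = 1 := by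
      rw [← Matrix.conjTranspose_mul, mul_eq_one_comm.1 hS, Matrix.conjTranspose_one]
    rw [Matrix.mul_assoc, ← Matrix.mul_assoc S'ᴴ, h1, Matrix.one_mul, hS]
  have h2 := key hR
  rw [← h] at h2
  calc S' * S'ᴴ = S' * S'ᴴ * ((Sᴴ * S) * (R' * R'ᴴ)) := by
        rw [mul_eq_one_comm.1 h2, Matrix.mul_one]
    _ = R' * R'ᴴ := by rw [← Matrix.mul_assoc, key hS, Matrix.one_mul]

/-- By cyclicity of the trace, the Frobenius norm of `S X S'` depends on `S` and `S'` only through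
`Sᴴ S` and `S' S'ᴴ`. -/
theorem sum_norm_sq_conj_eq {p q : ℕ} {S R : Matrix (Fin p) (Fin p) ℂ}
    {S' R' : Matrix (Fin q) (Fin q) ℂ} (h : Sᴴ * S = Rᴴ * R) (h' : S' * S'ᴴ = R' * R'ᴴ)
    (X : Matrix (Fin p) (Fin q) ℂ) :
    ∑ a, ∑ b, ‖(S * X * S') a b‖ ^ 2 = ∑ a, ∑ b, ‖(R * X * R') a b‖ ^ 2 := by
  have key : ∀ (S : Matrix (Fin p) (Fin p) ℂ) (S' : Matrix (Fin q) (Fin q) ℂ),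
      ((S * X * S')ᴴ * (S * X * S')).trace = (Xᴴ * (Sᴴ * S) * X * (S' * S'ᴴ)).trace := by
    intro S S'
    rw [Matrix.conjTranspose_mul, Matrix.conjTranspose_mul, Matrix.mul_assoc,
      Matrix.trace_mul_comm]
    simp only [Matrix.mul_assoc]
  have h1 := key S S'
  rw [h, h', ← key R R', ← sum_norm_sq_eq_trace, ← sum_norm_sq_eq_trace] at h1
  exact_mod_cast h1

end frobenius

/-- The linear map `A_i ↦ P_i A_i P'_{i+1}` on chains. -/
def conjChain {k : ℕ} {m : Fin (k + 1) → ℕ}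
    (P P' : (j : Fin (k + 1)) → Matrix (Fin (m j)) (Fin (m j)) ℂ) :
    (ChainIdx m → ℂ) →ₗ[ℂ] (ChainIdx m → ℂ) where
  toFun A e := (P e.1.castSucc * chainMat A e.1 * P' e.1.succ) e.2.1 e.2.2
  map_add' A A' := by
    ext e
    have : chainMat (A + A') e.1 = chainMat A e.1 + chainMat A' e.1 := rfl
    rw [this, Matrix.mul_add, Matrix.add_mul]
    rfl
  map_smul' c A := by
    ext e
    have : chainMat (c • A) e.1 = c • chainMat A e.1 := rfl
    rw [this, Matrix.mul_smul, Matrix.smul_mul]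
    rfl

section conjChain

variable {k : ℕ} {m : Fin (k + 1) → ℕ}
  (P P' : (j : Fin (k + 1)) → Matrix (Fin (m j)) (Fin (m j)) ℂ)

theorem chainMat_conjChain (A : ChainIdx m → ℂ) (i : Fin k) :
    chainMat (conjChain P P' A) i = P i.castSucc * chainMat A i * P' i.succ := rfl

theorem conjChain_conjChain (hP : ∀ j, P' j * P j = 1) (A : ChainIdx m → ℂ) :
    conjChain P' P (conjChain P P' A) = A := by
  ext ⟨i, a, b⟩
  have h1 : P' i.castSucc * (P i.castSucc * chainMat A i * P' i.succ) * P i.succ =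
      chainMat A i := by
    rw [Matrix.mul_assoc, Matrix.mul_assoc (P i.castSucc * _), hP, Matrix.mul_one,
      ← Matrix.mul_assoc, hP, Matrix.one_mul]
  exact congrFun (congrFun h1 a) b

theorem gaussDensity_eq (A : ChainIdx m → ℂ) :
    gaussDensity A = ENNReal.ofReal (Real.exp (-∑ i, ∑ a, ∑ b, ‖chainMat A i a b‖ ^ 2)) := by
  rw [gaussDensity, Fintype.sum_sigma]
  simp only [Fintype.sum_prod_type]
  rfl

theorem gaussDensity_conjChain_eq {P P'} {R R' : (j : Fin (k + 1)) → Matrix (Fin (m j)) (Fin (m j)) ℂ}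
    (hP : ∀ j, P' j * P j = 1) (hR : ∀ j, R' j * R j = 1) (h : ∀ j, (P j)ᴴ * P j = (R j)ᴴ * R j)
    (A : ChainIdx m → ℂ) : gaussDensity (conjChain P P' A) = gaussDensity (conjChain R R' A) := by
  rw [gaussDensity_eq, gaussDensity_eq]
  simp only [chainMat_conjChain]
  congr 3
  exact Finset.sum_congr rfl fun i _ => sum_norm_sq_conj_eq (h _)
    (mul_conjTranspose_eq_of_conjTranspose_mul_eq (hP _) (hR _) (h _)) _

end conjChain

/-! ### The chart point contributes only a constant. -/

section scaling

variable {κ : ℕ} {n : Fin (κ + 1 + 1) → ℕ} (h : n (Fin.last (κ + 1)) = n 0)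

theorem assemble_fiberMap_eq_conjChain (p : Params n) (u : ColIdx n → ℂ) :
    assemble (fiberMap h p u) p = conjChain (m := fun j => n j + 1)
      (fun j => shear (vertexVec h u j)) (fun j => shear (-vertexVec h u j))
      (assemble 0 (triangularize h u p)) := by
  ext ⟨i, a, b⟩
  exact congrFun (congrFun (chainMat_assemble_fiberMap h p u i) a) b

theorem gaussDensity_assemble_fiberMap (p : Params n) (u : ColIdx n → ℂ) :
    gaussDensity (assemble (fiberMap h p u) p) = gaussDensity (conjChain (m := fun j => n j + 1)
      (fun j => polarTri (vertexVec h u j)) (fun j => polarTriInv (vertexVec h u j))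
      (assemble 0 (triangularize h u p))) := by
  rw [assemble_fiberMap_eq_conjChain]
  exact gaussDensity_conjChain_eq (m := fun j => n j + 1) (fun j => shear_neg_mul_shear _)
    (fun j => polarTriInv_mul _) (fun j => (polarTri_conjTranspose_mul _).symm) _

/-- The passage to the block triangular chain as a linear map. -/
def triangularizeLin (u : ColIdx n → ℂ) : Params n →ₗ[ℂ] Params n where
  toFun := triangularize h u
  map_add' p p' := by
    refine Prod.ext (funext fun i => ?_) (Prod.ext rfl (funext fun e => ?_))
    · simp [triangularize, cornerVal, dotProduct, add_mul, Finset.sum_add_distrib]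
      ring
    · simp [triangularize]
      ring
  map_smul' c p := by
    refine Prod.ext (funext fun i => ?_) (Prod.ext rfl (funext fun e => ?_))
    · simp [triangularize, cornerVal, dotProduct, mul_add, Finset.mul_sum, mul_assoc]
    · simp [triangularize]
      ring

theorem injective_triangularizeLin (u : ColIdx n → ℂ) :
    Function.Injective (triangularizeLin h u) := by
  rw [← LinearMap.ker_eq_bot, LinearMap.ker_eq_bot']
  intro p hp
  have h1 : p.2.1 = 0 := congrArg (fun q : Params n => q.2.1) hp
  have h2 : cornerVal h u p = 0 := congrArg (fun q : Params n => q.1) hp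
  have h3 : (triangularize h u p).2.2 = 0 := congrArg (fun q : Params n => q.2.2) hp
  refine Prod.ext (funext fun i => ?_) (Prod.ext h1 (funext fun e => ?_))
  · have := congrFun h2 i
    simpa [cornerVal, h1, dotProduct] using this
  · have := congrFun h3 e
    simpa [triangularize, h1] using this

/-- The block triangular chains' parameters after multiplication by the block upper triangular
matrices `polarTri`. -/
noncomputable def polarLin (u : ColIdx n → ℂ) : Params n →ₗ[ℂ] Params n :=
  LinearMap.snd ℂ _ _ ∘ₗ (assembleEquiv n).symm.toLinearMap ∘ₗ
    conjChain (m := fun j => n j + 1) (fun j => polarTri (vertexVec h u j))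
      (fun j => polarTriInv (vertexVec h u j)) ∘ₗ (assembleEquiv n).toLinearMap ∘ₗ
        LinearMap.inr ℂ (ColIdx n → ℂ) (Params n)

variable (u : ColIdx n → ℂ) (q : Params n)

theorem polarTri_mul_block_mul {p r : ℕ} (v : Fin p → ℂ) (v' : Fin r → ℂ) (x : ℂ) (w : Fin r → ℂ)
    (D : Matrix (Fin p) (Fin r) ℂ) :
    ∃ w', polarTri v * block x w 0 D * polarTriInv v' =
      block (polarScale v * x * (polarScale v' : ℂ)⁻¹) w' 0
        (polarBlock v * D * polarBlockInv v') := by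
  rw [polarTri, polarTriInv, block_mul, block_mul]
  refine ⟨(polarScale v * x) • -((polarScale v' : ℂ)⁻¹ • star v') +
    ((polarScale v : ℂ) • w + ((polarScale v : ℂ)⁻¹ • star v) ᵥ* D) ᵥ* polarBlockInv v', ?_⟩
  have h0 : vecMulVec (0 : Fin p → ℂ) w = 0 := Matrix.zero_vecMulVec _
  have h1 : vecMulVec (0 : Fin p → ℂ) (-((polarScale v' : ℂ)⁻¹ • star v')) = 0 :=
    Matrix.zero_vecMulVec _
  simp only [smul_zero, Matrix.mulVec_zero, add_zero, dotProduct_zero, zero_add, h0, h1]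

theorem chainMat_conjChain_polar (i : Fin (κ + 1)) :
    ∃ w', chainMat (conjChain (m := fun j => n j + 1) (fun j => polarTri (vertexVec h u j))
      (fun j => polarTriInv (vertexVec h u j)) (assemble 0 q)) i =
      block (polarScale (vertexVec h u i.castSucc) * q.1 i *
          (polarScale (vertexVec h u i.succ) : ℂ)⁻¹) w' 0
        (polarBlock (vertexVec h u i.castSucc) * chainMat q.2.2 i *
          polarBlockInv (vertexVec h u i.succ)) := by
  obtain ⟨w', hw'⟩ := polarTri_mul_block_mul (vertexVec h u i.castSucc) (vertexVec h u i.succ)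
    (q.1 i) (fun b => q.2.1 ⟨i, b⟩) (chainMat q.2.2 i)
  exact ⟨w', hw'⟩

/-- Conjugation by block upper triangular matrices keeps the first columns zero, so discarding them
in `polarLin` loses nothing. -/
theorem assemble_polarLin :
    assemble 0 (polarLin h u q) = conjChain (m := fun j => n j + 1)
      (fun j => polarTri (vertexVec h u j)) (fun j => polarTriInv (vertexVec h u j))
      (assemble 0 q) := by
  set B := conjChain (m := fun j => n j + 1)
      (fun j => polarTri (vertexVec h u j)) (fun j => polarTriInv (vertexVec h u j))
      (assemble 0 q) with hB
  have h1 : (assembleEquiv n).symm B = (0, polarLin h u q) := by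
    refine Prod.ext (funext fun ⟨i, a⟩ => ?_) rfl
    obtain ⟨w', hw'⟩ := chainMat_conjChain_polar h u q i
    exact congrFun (congrFun hw' a.succ) 0
  exact ((LinearEquiv.symm_apply_eq _).1 h1).symm

theorem polarLin_fst (i : Fin (κ + 1)) : (polarLin h u q).1 i =
    polarScale (vertexVec h u i.castSucc) * q.1 i * (polarScale (vertexVec h u i.succ) : ℂ)⁻¹ := by
  obtain ⟨w', hw'⟩ := chainMat_conjChain_polar h u q i
  exact congrFun (congrFun hw' 0) 0

theorem chainMat_polarLin (i : Fin (κ + 1)) : chainMat (polarLin h u q).2.2 i =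
    polarBlock (vertexVec h u i.castSucc) * chainMat q.2.2 i *
      polarBlockInv (vertexVec h u i.succ) := by
  obtain ⟨w', hw'⟩ := chainMat_conjChain_polar h u q i
  ext a b
  exact congrFun (congrFun hw' a.succ) b.succ

theorem injective_polarLin : Function.Injective (polarLin h u) := by
  intro q q' hq
  have h1 := assemble_polarLin h u q
  rw [hq, assemble_polarLin] at h1
  have h2 := congrArg (conjChain (m := fun j => n j + 1)
      (fun j => polarTriInv (vertexVec h u j)) (fun j => polarTri (vertexVec h u j))) h1
  rw [conjChain_conjChain (m := fun j => n j + 1) _ _ (fun j => polarTriInv_mul _),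
    conjChain_conjChain (m := fun j => n j + 1) _ _ (fun j => polarTriInv_mul _)] at h2
  have h3 : assembleEquiv n (0, q') = assembleEquiv n (0, q) := h2
  exact (Prod.ext_iff.1 ((assembleEquiv n).injective h3)).2.symm

theorem vertexVec_last_cast (a : Fin (n 0)) :
    vertexVec h u (Fin.last (κ + 1)) (Fin.cast h.symm a) = vertexVec h u 0 a := by
  rw [vertexVec_last]
  exact (congrFun (vertexVec_castSucc h u 0) a).symm

theorem polarScale_last :
    polarScale (vertexVec h u (Fin.last (κ + 1))) = polarScale (vertexVec h u 0) := by
  rw [polarScale, polarScale]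
  congr 2
  refine (Fintype.sum_equiv (finCongr h.symm) _ _ fun a => ?_).symm
  rw [← vertexVec_last_cast]
  rfl

theorem charpoly_squareProd_polarLin :
    (squareProd h (chainMat (polarLin h u q).2.2)).charpoly =
      (squareProd h (chainMat q.2.2)).charpoly := by
  have h1 := charpoly_squareProd_conj (chainMat q.2.2) h
    (P := fun j => polarBlock (vertexVec h u j)) (P' := fun j => polarBlockInv (vertexVec h u j))
    (fun j => polarBlockInv_mul _) (by
      ext a b
      simp only [Matrix.submatrix_apply, polarBlockInv, polarScale_last, Matrix.add_apply,
        Matrix.smul_apply, vecMulVec, Matrix.of_apply, Pi.star_apply, vertexVec_last_cast,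
        Matrix.one_apply, Fin.ext_iff, Fin.val_cast])
  rw [← h1]
  congr 2
  exact funext fun i => chainMat_polarLin h u q i

/-- The scale ratios telescope around the cycle, the scales at the last and first vertices being
equal. -/
theorem prod_polarLin : ∏ i, (polarLin h u q).1 i = ∏ i, q.1 i := by
  simp only [polarLin_fst]
  rw [Finset.prod_mul_distrib, Finset.prod_mul_distrib, Finset.prod_inv_distrib]
  have h1 : ∏ i : Fin (κ + 1), (polarScale (vertexVec h u i.castSucc) : ℂ) =
      ∏ i : Fin (κ + 1), (polarScale (vertexVec h u i.succ) : ℂ) := by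
    have h2 := (Fin.prod_univ_castSucc fun j => (polarScale (vertexVec h u j) : ℂ)).symm.trans
      (Fin.prod_univ_succ fun j => (polarScale (vertexVec h u j) : ℂ))
    rw [polarScale_last, mul_comm] at h2
    exact mul_left_cancel₀ (polarScale_ne_zero _) h2
  rw [h1, mul_right_comm, mul_inv_cancel₀ (Finset.prod_ne_zero_iff.2 fun i _ =>
    polarScale_ne_zero _), one_mul]

/-- The corner product and the characteristic polynomial of the reduced chain are preserved, so only
the monomial in the `|x_i|` rescales, by a factor independent of `q` and `f`. -/
theorem peeled_polarLin (hmin : ∀ j, n 0 ≤ n j) :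
    ∃ K : ℝ, 0 < K ∧ ∀ (f : (Fin (n 0 + 1) → ℂ) → ENNReal) (q : Params n),
      (∀ i, (polarLin h u q).1 i ≠ 0) →
        peeled h f q = ENNReal.ofReal K * peeled h f (polarLin h u q) := by
  let K : ℝ := ∏ i : Fin (κ + 1), (polarScale (vertexVec h u i.castSucc) *
    (polarScale (vertexVec h u i.succ))⁻¹) ^ (2 * (n i.castSucc - n 0))
  have hK : 0 < K := Finset.prod_pos fun i _ => pow_pos (mul_pos (polarScale_pos _)
    (inv_pos.2 (polarScale_pos _))) _
  refine ⟨K⁻¹, inv_pos.2 hK, fun f q hq => ?_⟩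
  have hq' : ∀ i, q.1 i ≠ 0 := fun i hi => hq i (by rw [polarLin_fst, hi, mul_zero, zero_mul])
  have h1 : jacobianSq h (polarLin h u q) = K * jacobianSq h q := by
    rw [jacobianSq, jacobianSq, norm_det_fiberDeriv_sq h _ (fun i _ => hq i) hmin,
      norm_det_fiberDeriv_sq h _ (fun i _ => hq' i) hmin, prod_polarLin,
      charpoly_squareProd_polarLin, ← mul_assoc, ← Finset.prod_mul_distrib]
    congr 1
    refine Finset.prod_congr rfl fun i _ => ?_
    rw [← mul_pow, polarLin_fst, norm_mul, norm_mul, norm_inv, Complex.norm_real,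
      Complex.norm_real, Real.norm_of_nonneg (polarScale_pos _).le,
      Real.norm_of_nonneg (polarScale_pos _).le]
    ring
  rw [peeled, peeled, h1, ← mul_assoc, ← ENNReal.ofReal_mul (inv_pos.2 hK).le,
    inv_mul_cancel_left₀ hK.ne', prod_polarLin]
  congr 1
  exact orderingSum_congr _ (charpoly_squareProd_polarLin h u q).symm

set_option synthInstance.maxSize 2000 in
-- The substitution `p ↦ polarLin (triangularize p)` is linear and invertible and carries the
-- integrand to the model one. Its Jacobian and the factor from `peeled_polarLin` depend on `u` but
-- not on `f`.
theorem exists_chartIntegral_eq (hmin : ∀ j, n 0 ≤ n j) :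
    ∃ C : ENNReal, C ≠ 0 ∧ C ≠ ⊤ ∧ ∀ f : (Fin (n 0 + 1) → ℂ) → ENNReal,
      chartIntegral h f u = C * ∫⁻ q : Params n, peeled h f q * gaussDensity (assemble 0 q) := by
  let T : Params n →ₗ[ℂ] Params n := polarLin h u ∘ₗ triangularizeLin h u
  have hT : Function.Injective T := (injective_polarLin h u).comp (injective_triangularizeLin h u)
  let L : Params n ≃ₗ[ℝ] Params n := (LinearEquiv.ofInjectiveEndo T hT).restrictScalars ℝ
  have hL : ∀ p, L p = polarLin h u (triangularize h u p) := fun p => rfl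
  obtain ⟨C, hC0, hC1, hC⟩ := exists_lintegral_linearEquiv_eq L volume volume
  obtain ⟨K, hK, hpeel⟩ := peeled_polarLin h u hmin
  refine ⟨ENNReal.ofReal K * C, mul_ne_zero (ENNReal.ofReal_pos.2 hK).ne' hC0,
    ENNReal.mul_ne_top ENNReal.ofReal_ne_top hC1, fun f => ?_⟩
  have hne : ∀ᵐ q : Params n, ∀ i, q.1 i ≠ 0 := ae_all_iff.2 fun i =>
    ae_ne_zero_of_differentiable (volume : Measure (Params n)) (q := fun q : Params n => q.1 i)
      (x₀ := (fun _ => 1, 0, 0)) (by fun_prop) one_ne_zero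
  have hne' := ae_of_ae_linearEquiv L volume volume hne
  rw [mul_assoc, ← hC, ← lintegral_const_mul' _ _ ENNReal.ofReal_ne_top, chartIntegral]
  refine lintegral_congr_ae ?_
  filter_upwards [hne'] with p hp
  rw [hL] at hp ⊢
  rw [hpeel f _ hp, mul_assoc, gaussDensity_assemble_fiberMap, assemble_polarLin]

end scaling

/-! ### The induction on the number of eigenvalues. -/

theorem gaussDensity_eq_prod {ι : Type*} [Fintype ι] (A : ι → ℂ) :
    gaussDensity A = ∏ e, ENNReal.ofReal (Real.exp (-‖A e‖ ^ 2)) := by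
  rw [gaussDensity, ← Finset.sum_neg_distrib, Real.exp_sum,
    ENNReal.ofReal_prod_of_nonneg fun _ _ => (Real.exp_pos _).le]

theorem lintegral_gaussDensity_ne {ι : Type*} [Fintype ι] :
    ∫⁻ A : ι → ℂ, gaussDensity A ≠ 0 ∧ ∫⁻ A : ι → ℂ, gaussDensity A ≠ ⊤ := by
  have hpos := integral_norm_pow_mul_exp_pos 0
  have hint := integrable_norm_pow_mul_exp 0
  simp only [pow_zero, one_mul] at hpos hint
  have h1 : ∫⁻ z : ℂ, ENNReal.ofReal (Real.exp (-‖z‖ ^ 2)) =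
      ENNReal.ofReal (∫ z : ℂ, Real.exp (-‖z‖ ^ 2)) :=
    (ofReal_integral_eq_lintegral_ofReal hint
      (Filter.Eventually.of_forall fun z => (Real.exp_pos _).le)).symm
  simp_rw [gaussDensity_eq_prod]
  rw [lintegral_pi_prod (f := fun _ : ι => fun z : ℂ => ENNReal.ofReal (Real.exp (-‖z‖ ^ 2)))
    fun _ => by fun_prop]
  simp only [h1]
  exact ⟨Finset.prod_ne_zero_iff.2 fun _ _ => (ENNReal.ofReal_pos.2 hpos).ne',
    ENNReal.prod_ne_top fun _ _ => ENNReal.ofReal_ne_top⟩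

theorem weightDensity_cons (w : ℂ → ℝ) {N : ℕ} (x : ℂ) (z : Fin N → ℂ) :
    weightDensity w (Fin.cons x z : Fin (N + 1) → ℂ) =
      w x * ((∏ l, ‖x - z l‖ ^ 2) * weightDensity w z) := by
  simp only [weightDensity, Fin.prod_univ_succ, Fin.cons_zero, Fin.cons_succ, Fin.prod_Ioi_zero,
    Fin.prod_Ioi_succ]
  ring

theorem orderingSum_one {N : ℕ} (M : Matrix (Fin N) (Fin N) ℂ) :
    orderingSum (fun _ => 1) M = N.factorial := by
  simp [orderingSum, Fintype.card_perm]

theorem ofReal_norm_charpoly_mul_orderingSum {N : ℕ} (M : Matrix (Fin N) (Fin N) ℂ) (x : ℂ)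
    (g : (Fin N → ℂ) → ENNReal) :
    ENNReal.ofReal (‖M.charpoly.eval x‖ ^ 2) * orderingSum g M =
      orderingSum (fun z => ENNReal.ofReal (∏ l, ‖x - z l‖ ^ 2) * g z) M := by
  rw [orderingSum, orderingSum, Finset.mul_sum]
  refine Finset.sum_congr rfl fun σ _ => ?_
  congr 2
  rw [charpoly_eval_eq_prod_eigVec, norm_prod, ← Finset.prod_pow]
  exact (Equiv.prod_comp σ fun l => ‖x - eigVec M l‖ ^ 2).symm

section step

variable {κ : ℕ} {n : Fin (κ + 1 + 1) → ℕ} (h : n (Fin.last (κ + 1)) = n 0)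

theorem gaussDensity_assemble_zero (q : Params n) :
    gaussDensity (assemble 0 q) = gaussDensity q.1 * (gaussDensity q.2.1 * gaussDensity q.2.2) := by
  have h1 : ∑ e, ‖assemble 0 q e‖ ^ 2 =
      ∑ e, ‖q.1 e‖ ^ 2 + (∑ e, ‖q.2.1 e‖ ^ 2 + ∑ e, ‖q.2.2 e‖ ^ 2) := by
    simp only [Fintype.sum_sigma, Fintype.sum_prod_type]
    rw [← Finset.sum_add_distrib, ← Finset.sum_add_distrib]
    refine Finset.sum_congr rfl fun i _ => ?_
    have h2 : ∀ a b, assemble 0 q ⟨i, a, b⟩ =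
      block (q.1 i) (fun b => q.2.1 ⟨i, b⟩) 0 (chainMat q.2.2 i) a b := fun a b => rfl
    simp only [h2, Fin.sum_univ_succ, block_zero_zero, block_zero_succ, block_succ_zero,
      block_succ_succ]
    simp [chainMat, add_assoc]
  rw [gaussDensity, h1, neg_add, neg_add, Real.exp_add, Real.exp_add,
    ENNReal.ofReal_mul (Real.exp_pos _).le, ENNReal.ofReal_mul (Real.exp_pos _).le]
  rfl

/-- The function of the remaining eigenvalues obtained by fixing the first one. -/
noncomputable def fixFirst {N : ℕ} (f : (Fin (N + 1) → ℂ) → ENNReal) (x : ℂ) (z : Fin N → ℂ) :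
    ENNReal :=
  ENNReal.ofReal (∏ l, ‖x - z l‖ ^ 2) * f (Fin.cons x z)

theorem measurable_fixFirst {X : Type*} [MeasurableSpace X] {N : ℕ}
    {f : (Fin (N + 1) → ℂ) → ENNReal} (hf : Measurable f) {g : X → ℂ} (hg : Measurable g)
    {v : X → Fin N → ℂ} (hv : Measurable v) : Measurable fun x => fixFirst f (g x) (v x) := by
  have h1 : Measurable fun x => (Fin.cons (g x) (v x) : Fin (N + 1) → ℂ) :=
    measurable_fin_cons hg hv
  have h2 : Measurable fun x => ∏ l, ‖g x - v x l‖ ^ 2 := by fun_prop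
  exact h2.ennreal_ofReal.mul (hf.comp h1)

theorem peeled_mul_gaussDensity (hmin : ∀ j, n 0 ≤ n j) (f : (Fin (n 0 + 1) → ℂ) → ENNReal)
    {q : Params n} (hq : ∀ i, q.1 i ≠ 0) :
    peeled h f q * gaussDensity (assemble 0 q) =
      ENNReal.ofReal (baseDensity (fun i => n i.castSucc - n 0) q.1) * (gaussDensity q.2.1 *
        (gaussDensity q.2.2 *
          orderingSum (fixFirst f (∏ i, q.1 i)) (squareProd h (chainMat q.2.2)))) := by
  have h1 := ofReal_norm_charpoly_mul_orderingSum (squareProd h (chainMat q.2.2)) (∏ i, q.1 i)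
    (fun z => f (Fin.cons (∏ i, q.1 i) z))
  change _ = orderingSum (fixFirst f (∏ i, q.1 i)) (squareProd h (chainMat q.2.2)) at h1
  rw [← h1, gaussDensity_assemble_zero, peeled, jacobianSq,
    norm_det_fiberDeriv_sq h _ (fun i _ => hq i) hmin, baseDensity,
    ENNReal.ofReal_mul (Finset.prod_nonneg fun i _ => by positivity),
    ENNReal.ofReal_mul (Real.exp_pos _).le, gaussDensity]
  ring

theorem measurable_gaussDensity_mul_orderingSum {X : Type*} [MeasurableSpace X]
    {f : (Fin (n 0 + 1) → ℂ) → ENNReal} (hf : Measurable f) {x : X → Fin (κ + 1) → ℂ}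
    (hx : Measurable x) {D : X → ChainIdx n → ℂ} (hD : Measurable D) :
    Measurable fun q : X => gaussDensity (D q) *
      orderingSum (fixFirst f (∏ i, x q i)) (squareProd h (chainMat (D q))) := by
  have hprod : Measurable fun q : X × (Fin (n 0) → ℂ) => ∏ i, x q.1 i :=
    (measurable_finProd (κ + 1)).comp (hx.comp measurable_fst)
  have h1 : Measurable fun q : X × (Fin (n 0) → ℂ) => fixFirst f (∏ i, x q.1 i) q.2 :=
    measurable_fixFirst hf hprod measurable_snd
  have h2 : ∀ a b, Measurable fun q : X => squareProd h (chainMat (D q)) a b := fun a b =>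
    (continuous_squareProd h a b).measurable.comp hD
  exact (measurable_gaussDensity.comp hD).mul
    (measurable_orderingSum (f := fun (q : X) z => fixFirst f (∏ i, x q i) z) h1 h2)

theorem measurable_peeledDensity {f : (Fin (n 0 + 1) → ℂ) → ENNReal} (hf : Measurable f) :
    Measurable fun q : Params n =>
      ENNReal.ofReal (baseDensity (fun i => n i.castSucc - n 0) q.1) * (gaussDensity q.2.1 *
        (gaussDensity q.2.2 *
          orderingSum (fixFirst f (∏ i, q.1 i)) (squareProd h (chainMat q.2.2)))) := by
  have h1 : Measurable fun q : Params n =>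
      ENNReal.ofReal (baseDensity (fun i => n i.castSucc - n 0) q.1) :=
    ((continuous_baseDensity _).measurable.comp measurable_fst).ennreal_ofReal
  have h2 : Measurable fun q : Params n => gaussDensity q.2.1 :=
    measurable_gaussDensity.comp (measurable_fst.comp measurable_snd)
  exact h1.mul (h2.mul (measurable_gaussDensity_mul_orderingSum h hf measurable_fst
    (measurable_snd.comp measurable_snd)))

/-- The base density pushes forward to `w` under the product map, and the factors `‖x - z l‖ ^ 2` in
`fixFirst` complete the Vandermonde product from `N` to `N + 1` points. -/
theorem lintegral_fixFirst {N : ℕ} {w : ℂ → ℝ} {d : Fin (κ + 1) → ℕ} (hw : IsProdWeight d w)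
    {f : (Fin (N + 1) → ℂ) → ENNReal} (hf : Measurable f) :
    ∫⁻ x : Fin (κ + 1) → ℂ, ENNReal.ofReal (baseDensity d x) *
        ∫⁻ z, fixFirst f (∏ i, x i) z * ENNReal.ofReal (weightDensity w z) =
      ∫⁻ z, f z * ENNReal.ofReal (weightDensity w z) := by
  have hwd := (measurable_weightDensity hw.measurable N).ennreal_ofReal
  have hm : Measurable fun q : ℂ × (Fin N → ℂ) =>
      fixFirst f q.1 q.2 * ENNReal.ofReal (weightDensity w q.2) :=
    (measurable_fixFirst hf measurable_fst measurable_snd).mul (hwd.comp measurable_snd)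
  have hwd' := (measurable_weightDensity hw.measurable (N + 1)).ennreal_ofReal
  rw [hw.lintegral_eq (F := fun x => ∫⁻ z, fixFirst f x z * ENNReal.ofReal (weightDensity w z))
    hm.lintegral_prod_right', lintegral_fin_cons (F := fun z => f z * ENNReal.ofReal (weightDensity w z)) (hf.mul hwd')]
  refine lintegral_congr fun x => ?_
  rw [← lintegral_const_mul' _ _ ENNReal.ofReal_ne_top]
  refine lintegral_congr fun z => ?_
  rw [weightDensity_cons, ENNReal.ofReal_mul (hw.nonneg x),
    ENNReal.ofReal_mul (Finset.prod_nonneg fun i _ => by positivity), fixFirst]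
  ring

/-- The formula expressing Gaussian integrals over chains by integrals over eigenvalues. -/
def HasEigenvalueFormula {k : ℕ} {m : Fin (k + 1) → ℕ} (hm : m (Fin.last k) = m 0) (w : ℂ → ℝ)
    (C : ENNReal) : Prop :=
  ∀ f : (Fin (m 0) → ℂ) → ENNReal, Measurable f →
    ∫⁻ A : ChainIdx m → ℂ, gaussDensity A * orderingSum f (squareProd hm (chainMat A)) =
      C * ∫⁻ z, f z * ENNReal.ofReal (weightDensity w z)

set_option synthInstance.maxSize 2000 in
-- The integrand splits: the first rows contribute their Gaussian mass, the reduced chain is covered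
-- by the formula for `n`, and the corners give the weight.
theorem lintegral_peeled_eq (hmin : ∀ j, n 0 ≤ n j) {w : ℂ → ℝ}
    (hw : IsProdWeight (fun i : Fin (κ + 1) => n i.castSucc - n 0) w) {C : ENNReal}
    (hC1 : C ≠ ⊤) (hC : HasEigenvalueFormula h w C) {f : (Fin (n 0 + 1) → ℂ) → ENNReal}
    (hf : Measurable f) :
    ∫⁻ q : Params n, peeled h f q * gaussDensity (assemble 0 q) =
      (∫⁻ A : RowIdx n → ℂ, gaussDensity A) * C *
        ∫⁻ z, f z * ENNReal.ofReal (weightDensity w z) := by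
  have hne : ∀ᵐ q : Params n, ∀ i, q.1 i ≠ 0 := ae_all_iff.2 fun i =>
    ae_ne_zero_of_differentiable (volume : Measure (Params n)) (q := fun q : Params n => q.1 i)
      (x₀ := (fun _ => 1, 0, 0)) (by fun_prop) one_ne_zero
  rw [lintegral_congr_ae (hne.mono fun q hq => peeled_mul_gaussDensity h hmin f hq),
    Measure.volume_eq_prod, lintegral_prod _ (measurable_peeledDensity h hf).aemeasurable, ← lintegral_fixFirst hw hf,
    ← lintegral_const_mul' _ _ (ENNReal.mul_ne_top (lintegral_gaussDensity_ne).2 hC1)]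
  refine lintegral_congr fun x => ?_
  refine (lintegral_const_mul' (ENNReal.ofReal (baseDensity (fun i => n i.castSucc - n 0) x))
    (fun y : (RowIdx n → ℂ) × (ChainIdx n → ℂ) => gaussDensity y.1 * (gaussDensity y.2 *
      orderingSum (fixFirst f (∏ i, x i)) (squareProd h (chainMat y.2))))
    ENNReal.ofReal_ne_top).trans ?_
  rw [Measure.volume_eq_prod,
    lintegral_prod_mul (f := gaussDensity) (g := fun D : ChainIdx n → ℂ => gaussDensity D *
      orderingSum (fixFirst f (∏ i, x i)) (squareProd h (chainMat D)))
      measurable_gaussDensity.aemeasurable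
      (measurable_gaussDensity_mul_orderingSum h hf measurable_const measurable_id).aemeasurable,
    hC (fixFirst f (∏ i, x i)) (measurable_fixFirst hf measurable_const measurable_id)]
  ring

theorem hasEigenvalueFormula_succ (hmin : ∀ j, n 0 ≤ n j) {w : ℂ → ℝ}
    (hw : IsProdWeight (fun i : Fin (κ + 1) => n i.castSucc - n 0) w) {C : ENNReal}
    (hC0 : C ≠ 0) (hC1 : C ≠ ⊤) (hC : HasEigenvalueFormula h w C) :
    ∃ C', HasEigenvalueFormula (m := fun j => n j + 1) (succ_dims h) w C' := by
  obtain ⟨C₁, hC₁0, hC₁1, hC₁⟩ := exists_lintegral_chain_eq h hmin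
  have hZ := hw.lintegral_weightDensity (Nat.succ_pos κ) (n 0 + 1)
  have hZpos : 0 < ∏ l : Fin (n 0 + 1), weightMoment (fun i : Fin (κ + 1) => n i.castSucc - n 0) l :=
    Finset.prod_pos fun l _ => weightMoment_pos _ l
  set J : ((Fin (n 0 + 1) → ℂ) → ENNReal) → ENNReal := fun f =>
    ∫⁻ q : Params n, peeled h f q * gaussDensity (assemble 0 q) with hJ
  have hJf : ∀ f, Measurable f → J f = (∫⁻ A : RowIdx n → ℂ, gaussDensity A) * C *
        ∫⁻ z, f z * ENNReal.ofReal (weightDensity w z) := fun f hf =>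
    lintegral_peeled_eq h hmin hw hC1 hC hf
  have hJ1 : J (fun _ => 1) = (∫⁻ A : RowIdx n → ℂ, gaussDensity A) * C *
      (ENNReal.ofReal (∏ l : Fin (n 0 + 1), weightMoment (fun i : Fin (κ + 1) =>
        n i.castSucc - n 0) l) * (n 0 + 1).factorial) := by
    rw [hJf _ measurable_const, ← hZ]
    simp only [one_mul]
  have hJ0 : J (fun _ => 1) ≠ 0 := by
    rw [hJ1]
    exact mul_ne_zero (mul_ne_zero lintegral_gaussDensity_ne.1 hC0)
      (mul_ne_zero (ENNReal.ofReal_pos.2 hZpos).ne' (by exact_mod_cast Nat.factorial_ne_zero _))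
  have hJt : J (fun _ => 1) ≠ ⊤ := by
    rw [hJ1]
    exact ENNReal.mul_ne_top (ENNReal.mul_ne_top lintegral_gaussDensity_ne.2 hC1)
      (ENNReal.mul_ne_top ENNReal.ofReal_ne_top (ENNReal.natCast_ne_top _))
  -- Testing with `f = 1` eliminates the `u`-dependent constant in favour of a function of `u` that
  -- is measurable. Its integral need not be known to be finite here.
  have hchart : ∀ u f, chartIntegral h f u =
      chartIntegral h (fun _ => 1) u * (J (fun _ => 1))⁻¹ * J f := by
    intro u f
    obtain ⟨c, -, -, hc⟩ := exists_chartIntegral_eq h u hmin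
    rw [hc f, hc (fun _ => 1)]
    change c * J f = c * J (fun _ => 1) * _ * J f
    rw [mul_assoc c, ENNReal.mul_inv_cancel hJ0 hJt, mul_one]
  refine ⟨C₁ * (∫⁻ u, chartIntegral h (fun _ => 1) u * (J (fun _ => 1))⁻¹) *
    ((∫⁻ A : RowIdx n → ℂ, gaussDensity A) * C), fun f hf => ?_⟩
  have hm : Measurable fun u => chartIntegral h (fun _ => 1) u * (J (fun _ => 1))⁻¹ :=
    (measurable_chartIntegral h measurable_const).mul_const _
  refine (hC₁ f hf).trans ?_
  simp_rw [hchart _ f]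
  rw [lintegral_mul_const _ hm, hJf f hf]
  simp only [mul_assoc]

end step

theorem HasEigenvalueFormula.factorial_mul_eq {k : ℕ} {m : Fin (k + 1) → ℕ}
    {hm : m (Fin.last k) = m 0} {w : ℂ → ℝ} {C : ENNReal} (hC : HasEigenvalueFormula hm w C) :
    (∫⁻ A : ChainIdx m → ℂ, gaussDensity A) * (m 0).factorial =
      C * ∫⁻ z : Fin (m 0) → ℂ, ENNReal.ofReal (weightDensity w z) := by
  have h1 := hC (fun _ => 1) measurable_const
  simp only [orderingSum_one, one_mul] at h1
  rwa [lintegral_mul_const _ measurable_gaussDensity] at h1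

/-- With `f = 1` the left side is a positive finite Gaussian mass times a factorial, which rules out
`0` and `⊤` after the fact. -/
theorem HasEigenvalueFormula.ne {k : ℕ} (hk : 1 ≤ k) {m : Fin (k + 1) → ℕ}
    {hm : m (Fin.last k) = m 0} {d : Fin k → ℕ} {w : ℂ → ℝ} (hw : IsProdWeight d w) {C : ENNReal}
    (hC : HasEigenvalueFormula hm w C) : C ≠ 0 ∧ C ≠ ⊤ := by
  have h1 := hC.factorial_mul_eq
  have hfac : ((m 0).factorial : ENNReal) ≠ 0 := by exact_mod_cast Nat.factorial_ne_zero _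
  have hZ : ∫⁻ z : Fin (m 0) → ℂ, ENNReal.ofReal (weightDensity w z) ≠ 0 := by
    have hpos : 0 < ∏ l : Fin (m 0), weightMoment d l :=
      Finset.prod_pos fun l _ => weightMoment_pos d l
    rw [hw.lintegral_weightDensity hk]
    exact mul_ne_zero (ENNReal.ofReal_pos.2 hpos).ne' hfac
  refine ⟨?_, ?_⟩
  · rintro rfl
    rw [zero_mul] at h1
    exact mul_ne_zero lintegral_gaussDensity_ne.1 hfac h1
  · rintro rfl
    rw [ENNReal.top_mul hZ] at h1
    exact ENNReal.mul_ne_top lintegral_gaussDensity_ne.2 (ENNReal.natCast_ne_top _) h1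

theorem hasEigenvalueFormula_of_isEmpty {k : ℕ} {m : Fin (k + 1) → ℕ} (hm : m (Fin.last k) = m 0)
    (h0 : m 0 = 0) (w : ℂ → ℝ) :
    HasEigenvalueFormula hm w (∫⁻ A : ChainIdx m → ℂ, gaussDensity A) := by
  have : IsEmpty (Fin (m 0)) := by rw [h0]; infer_instance
  intro f _
  have h1 : ∀ M : Matrix (Fin (m 0)) (Fin (m 0)) ℂ, orderingSum f M = f isEmptyElim := fun M => by
    rw [orderingSum, Fintype.sum_unique]
    exact congrArg f (Subsingleton.elim _ _)
  have h2 : ∀ z : Fin (m 0) → ℂ, weightDensity w z = 1 := fun z => by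
    simp [weightDensity]
  simp only [h1, h2, ENNReal.ofReal_one, mul_one]
  rw [lintegral_mul_const _ measurable_gaussDensity]
  congr 1
  rw [lintegral_congr fun z => congrArg f (Subsingleton.elim z isEmptyElim), lintegral_const,
    volume_pi, Measure.pi_of_empty _ isEmptyElim]
  simp

/-- The induction lowers all dimensions together, so the differences `d`, and with them the weight,
stay fixed. -/
theorem exists_hasEigenvalueFormula {κ : ℕ} {d : Fin (κ + 1) → ℕ} {w : ℂ → ℝ}
    (hw : IsProdWeight d w) (N : ℕ) : ∀ {n : Fin (κ + 1 + 1) → ℕ}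
      (h : n (Fin.last (κ + 1)) = n 0), n 0 = N → (∀ j, n 0 ≤ n j) →
      (∀ i : Fin (κ + 1), n i.castSucc - n 0 = d i) → ∃ C, HasEigenvalueFormula h w C := by
  induction N with
  | zero => exact fun h h0 _ _ => ⟨_, hasEigenvalueFormula_of_isEmpty h h0 w⟩
  | succ N ih =>
    intro n h h0 hmin hd
    obtain ⟨n', rfl⟩ : ∃ n' : Fin (κ + 1 + 1) → ℕ, n = fun j => n' j + 1 :=
      ⟨fun j => n j - 1, funext fun j => by
        have := hmin j
        change n j = n j - 1 + 1
        omega⟩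
    have h' : n' (Fin.last (κ + 1)) = n' 0 := Nat.succ_injective h
    have hmin' : ∀ j, n' 0 ≤ n' j := fun j => Nat.succ_le_succ_iff.1 (hmin j)
    have hd' : ∀ i : Fin (κ + 1), n' i.castSucc - n' 0 = d i := fun i => by
      rw [← hd i]
      exact (Nat.succ_sub_succ _ _).symm
    obtain rfl : (fun i : Fin (κ + 1) => n' i.castSucc - n' 0) = d := funext hd'
    obtain ⟨C, hC⟩ := ih h' (Nat.succ_injective h0) hmin' hd'
    obtain ⟨hC0, hC1⟩ := hC.ne (Nat.succ_pos κ) hw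
    exact hasEigenvalueFormula_succ h' hmin' hw hC0 hC1 hC

/-! ### From Gaussian integrals to the point process. -/

theorem exists_lintegral_eq_gaussDensity {Ω : Type*} [MeasurableSpace Ω] {P : Measure Ω}
    [IsProbabilityMeasure P] {ι : Type*} [Fintype ι] {X : ι → Ω → ℂ}
    (hX : ∀ e, HasLaw (X e) stdComplexGaussian P) (hind : iIndepFun X P) :
    ∃ c : ENNReal, c ≠ 0 ∧ c ≠ ⊤ ∧ ∀ F : (ι → ℂ) → ENNReal, Measurable F →
      ∫⁻ ω, F (fun e => X e ω) ∂P = c * ∫⁻ A, gaussDensity A * F A := by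
  have hlaw := (iIndepFun_iff_map_fun_eq_pi_map fun e => (hX e).aemeasurable).1 hind
  have hpi : 0 < Real.pi⁻¹ := inv_pos.2 Real.pi_pos
  have hg : Measurable fun z : ℂ => ENNReal.ofReal (Real.pi⁻¹ * Real.exp (-‖z‖ ^ 2)) := by
    fun_prop
  have hdens : ∀ A : ι → ℂ, ∏ e, ENNReal.ofReal (Real.pi⁻¹ * Real.exp (-‖A e‖ ^ 2)) =
      ENNReal.ofReal Real.pi⁻¹ ^ Fintype.card ι * gaussDensity A := fun A => by
    simp_rw [ENNReal.ofReal_mul hpi.le]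
    rw [Finset.prod_mul_distrib, gaussDensity_eq_prod, Finset.prod_const, Finset.card_univ]
  refine ⟨ENNReal.ofReal Real.pi⁻¹ ^ Fintype.card ι,
    pow_ne_zero _ (ENNReal.ofReal_pos.2 hpi).ne', ENNReal.pow_ne_top ENNReal.ofReal_ne_top,
    fun F hF => ?_⟩
  have hmap : P.map (fun ω e => X e ω) = (volume : Measure (ι → ℂ)).withDensity fun A =>
      ENNReal.ofReal Real.pi⁻¹ ^ Fintype.card ι * gaussDensity A := by
    rw [hlaw]
    simp_rw [fun e => (hX e).map_eq, stdComplexGaussian]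
    rw [pi_withDensity_eq hg]
    simp_rw [hdens]
  rw [← lintegral_map' hF.aemeasurable
    (aemeasurable_pi_lambda _ fun e => (hX e).aemeasurable), hmap,
    lintegral_withDensity_eq_lintegral_mul _ (measurable_gaussDensity.const_mul _) hF,
    ← lintegral_const_mul (f := fun A => gaussDensity A * F A) _ (measurable_gaussDensity.mul hF)]
  refine lintegral_congr fun A => ?_
  simp only [Pi.mul_apply, mul_assoc]

/-- The random matrix `M` has, up to the constant `D`, the eigenvalue density
`weightDensity w`. -/
structure HasEigenvalueDensity {Ω : Type*} [MeasurableSpace Ω] (P : Measure Ω) {N : ℕ}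
    (M : Ω → Matrix (Fin N) (Fin N) ℂ) (w : ℂ → ℝ) (D : ENNReal) : Prop where
  aemeasurable : AEMeasurable (fun ω => eigVec (M ω)) P
  lintegral_eq : ∀ f : (Fin N → ℂ) → ENNReal, Measurable f →
    ∫⁻ ω, orderingSum f (M ω) ∂P = D * ∫⁻ z, f z * ENNReal.ofReal (weightDensity w z)

theorem orderingSum_eq_of_map_eq {N : ℕ} {M : Matrix (Fin N) (Fin N) ℂ} {z : Fin N → ℂ}
    (hz : (Finset.univ : Finset (Fin N)).val.map z = eigenvalueMultiset M)
    (f : (Fin N → ℂ) → ENNReal) : orderingSum f M = ∑ σ : Equiv.Perm (Fin N), f (z ∘ σ) := by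
  obtain ⟨τ, hτ⟩ := exists_perm_of_map_univ_eq (z := z) (z' := eigVec M) (by rw [hz, map_eigVec])
  rw [orderingSum, hτ]
  exact Fintype.sum_equiv (Equiv.mulLeft τ) _ _ fun σ => rfl

theorem orderingSum_eq_factorial_mul {N : ℕ} (M : Matrix (Fin N) (Fin N) ℂ)
    {f : (Fin N → ℂ) → ENNReal} (hf : ∀ (z : Fin N → ℂ) (σ : Equiv.Perm (Fin N)), f (z ∘ σ) = f z) :
    orderingSum f M = N.factorial * f (eigVec M) := by
  simp [orderingSum, hf, Fintype.card_perm]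

theorem le_orderingSum {N : ℕ} (f : (Fin N → ℂ) → ENNReal) (M : Matrix (Fin N) (Fin N) ℂ) :
    f (eigVec M) ≤ orderingSum f M := by
  have h1 := Finset.single_le_sum (f := fun σ : Equiv.Perm (Fin N) => f (eigVec M ∘ σ))
    (fun _ _ => zero_le) (Finset.mem_univ 1)
  rwa [Equiv.Perm.coe_one, Function.comp_id] at h1

theorem pointCount_eq_sum {Ω : Type*} {N : ℕ} {X : Ω → Multiset ℂ} {ω : Ω} {z : Fin N → ℂ}
    (hz : (Finset.univ : Finset (Fin N)).val.map z = X ω) (B : Set ℂ) :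
    pointCount X B ω = ∑ l, B.indicator (1 : ℂ → ℕ) (z l) := by
  classical
  rw [pointCount, ← hz, Multiset.countP_map, ← Finset.filter_val, Finset.card_val,
    Finset.card_filter]
  refine Finset.sum_congr rfl fun l _ => ?_
  rw [Set.indicator_apply]
  exact if_congr Iff.rfl rfl rfl

namespace HasEigenvalueDensity

variable {Ω : Type*} [MeasurableSpace Ω] {P : Measure Ω} {N : ℕ}
  {M : Ω → Matrix (Fin N) (Fin N) ℂ} {w : ℂ → ℝ} {D : ENNReal}

theorem isEnumeration (hM : HasEigenvalueDensity P M w D) :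
    IsEnumeration P (fun ω => eigenvalueMultiset (M ω)) (fun ω => eigVec (M ω)) :=
  ⟨hM.aemeasurable, Filter.Eventually.of_forall fun _ => map_eigVec _⟩

/-- Averaging over permutations forgets which enumeration was chosen: evaluating on a set integrates
the ordering sum of its indicator. -/
theorem symmetrizedLaw_eq (hM : HasEigenvalueDensity P M w D) {Z : Ω → Fin N → ℂ}
    (hZ : IsEnumeration P (fun ω => eigenvalueMultiset (M ω)) Z) (hw : Measurable w) :
    symmetrizedLaw P Z = (volume : Measure (Fin N → ℂ)).withDensity fun z =>
      (N.factorial : ENNReal)⁻¹ * D * ENNReal.ofReal (weightDensity w z) := by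
  have hwd := (measurable_weightDensity hw N).ennreal_ofReal
  have hperm : ∀ σ : Equiv.Perm (Fin N), Measurable fun z : Fin N → ℂ => z ∘ σ := fun σ =>
    measurable_pi_lambda _ fun i => measurable_pi_apply (σ i)
  ext s hs
  have hone : Measurable (s.indicator (1 : (Fin N → ℂ) → ENNReal)) := measurable_one.indicator hs
  have hZσ : ∀ σ : Equiv.Perm (Fin N), AEMeasurable (fun ω => fun i => Z ω (σ i)) P := fun σ =>
    (hperm σ).comp_aemeasurable hZ.1
  have honeσ : ∀ σ : Equiv.Perm (Fin N),
      AEMeasurable (fun ω => s.indicator (1 : (Fin N → ℂ) → ENNReal) (Z ω ∘ σ)) P := fun σ =>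
    hone.comp_aemeasurable (hZσ σ)
  have h1 : ∀ σ : Equiv.Perm (Fin N), P.map (fun ω => fun i => Z ω (σ i)) s =
      ∫⁻ ω, s.indicator 1 (Z ω ∘ σ) ∂P := fun σ => by
    rw [← lintegral_indicator_one hs,
      lintegral_map' hone.aemeasurable (hZσ σ)]
    rfl
  rw [symmetrizedLaw, Measure.smul_apply, Measure.finsetSum_apply, withDensity_apply _ hs,
    lintegral_const_mul _ hwd, smul_eq_mul, mul_assoc]
  congr 1
  simp_rw [h1]
  rw [← lintegral_finsetSum' _ fun σ _ => honeσ σ]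
  have h2 : ∀ᵐ ω ∂P, ∑ σ : Equiv.Perm (Fin N), s.indicator (1 : (Fin N → ℂ) → ENNReal) (Z ω ∘ σ) =
      orderingSum (s.indicator 1) (M ω) := by
    filter_upwards [hZ.2] with ω hω
    exact (orderingSum_eq_of_map_eq hω _).symm
  rw [lintegral_congr_ae h2, hM.lintegral_eq _ hone, ← lintegral_indicator hs]
  congr 1
  refine lintegral_congr fun z => ?_
  by_cases hz : z ∈ s <;> simp [hz]

theorem factorial_eq [IsProbabilityMeasure P] (hM : HasEigenvalueDensity P M w D) :
    (N.factorial : ENNReal) = D * ∫⁻ z : Fin N → ℂ, ENNReal.ofReal (weightDensity w z) := by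
  have h1 := hM.lintegral_eq (fun _ => 1) measurable_const
  simpa [orderingSum_one] using h1

/-- The density vanishes where the Vandermonde factor does, so the indicator of that set has zero
expectation along the eigenvalues. -/
theorem ae_injective (hM : HasEigenvalueDensity P M w D) :
    ∀ᵐ ω ∂P, Function.Injective (eigVec (M ω)) := by
  let V : (Fin N → ℂ) → ℝ := fun z => ∏ i, ∏ j ∈ Finset.Ioi i, ‖z i - z j‖ ^ 2
  have hV : Measurable V := by fun_prop
  let f : (Fin N → ℂ) → ENNReal := {z | V z = 0}.indicator 1
  have hf : Measurable f := measurable_one.indicator (hV (measurableSet_singleton 0))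
  have h1 : ∫⁻ ω, orderingSum f (M ω) ∂P = 0 := by
    rw [hM.lintegral_eq f hf, lintegral_congr (g := fun _ => 0), lintegral_zero, mul_zero]
    intro z
    by_cases hz : V z = 0
    · rw [weightDensity, show (∏ i, ∏ j ∈ Finset.Ioi i, ‖z i - z j‖ ^ 2) = 0 from hz, mul_zero,
        ENNReal.ofReal_zero, mul_zero]
    · simp [f, hz]
  have h2 : ∫⁻ ω, f (eigVec (M ω)) ∂P = 0 := by
    exact le_antisymm ((lintegral_mono fun ω => le_orderingSum f (M ω)).trans h1.le) zero_le
  have hfM : AEMeasurable (fun ω => f (eigVec (M ω))) P := hf.comp_aemeasurable hM.aemeasurable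
  filter_upwards [(lintegral_eq_zero_iff' hfM).1 h2] with ω hω
  have hne : V (eigVec (M ω)) ≠ 0 := fun hc => by simp [f, hc] at hω
  have hlt : ∀ i j, i < j → eigVec (M ω) i ≠ eigVec (M ω) j := fun i j hij hc => hne <|
    Finset.prod_eq_zero (Finset.mem_univ i) <|
      Finset.prod_eq_zero (Finset.mem_Ioi.2 hij) (by rw [hc, sub_self, norm_zero]; norm_num)
  intro i j hij
  rcases lt_trichotomy i j with hlt' | rfl | hlt'
  · exact absurd hij (hlt i j hlt')
  · rfl
  · exact absurd hij.symm (hlt j i hlt')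

theorem isDeterminantal [IsProbabilityMeasure P] (hM : HasEigenvalueDensity P M w D) {k : ℕ}
    (hk : 1 ≤ k) {d : Fin k → ℕ} (hw : IsProdWeight d w) :
    IsDeterminantal P (fun ω => eigenvalueMultiset (M ω)) (projKernel (weightFun d w N)) where
  measurable_kernel := measurable_projKernel (hw.isOrthonormalFamily hk N).measurable
  posSemidef m x := kernelMatrix_posSemidef _ x
  aemeasurable_count B hB := by
    have h1 : pointCount (fun ω => eigenvalueMultiset (M ω)) B =
        fun ω => ∑ l, B.indicator (1 : ℂ → ℕ) (eigVec (M ω) l) :=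
      funext fun ω => pointCount_eq_sum (map_eigVec _) B
    have h2 : Measurable fun z : Fin N → ℂ => ∑ l, B.indicator (1 : ℂ → ℕ) (z l) :=
      Finset.measurable_sum _ fun l _ => (measurable_one.indicator hB).comp (measurable_pi_apply l)
    rw [h1]
    exact h2.comp_aemeasurable hM.aemeasurable
  simple := by
    filter_upwards [hM.ae_injective] with ω hω
    rw [← map_eigVec]
    exact (Multiset.nodup_map_iff_of_injective hω).2 Finset.univ.nodup
  intensity m B hB hd := by
    have hφ := hw.isOrthonormalFamily hk N
    let g : (Fin N → ℂ) → ENNReal := fun z => ∏ i, ∑ l, (B i).indicator 1 (z l)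
    have hg : Measurable g := Finset.measurable_prod _ fun i _ => Finset.measurable_sum _ fun l _ =>
      (measurable_one.indicator (hB i)).comp (measurable_pi_apply l)
    have hsymm : ∀ (z : Fin N → ℂ) (σ : Equiv.Perm (Fin N)), g (z ∘ σ) = g z := fun z σ =>
      Finset.prod_congr rfl fun i _ =>
        Equiv.sum_comp σ fun l => (B i).indicator (1 : ℂ → ENNReal) (z l)
    have hcount : ∀ ω, ∏ i, (pointCount (fun ω => eigenvalueMultiset (M ω)) (B i) ω : ENNReal) =
        g (eigVec (M ω)) := fun ω => by
      refine Finset.prod_congr rfl fun i _ => ?_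
      rw [pointCount_eq_sum (X := fun ω => eigenvalueMultiset (M ω)) (map_eigVec (M ω)) (B i),
        Nat.cast_sum]
      refine Finset.sum_congr rfl fun l _ => ?_
      by_cases hl : eigVec (M ω) l ∈ B i <;> simp [hl]
    have hfac0 : (N.factorial : ENNReal) ≠ 0 := by exact_mod_cast Nat.factorial_ne_zero _
    have hfact : (N.factorial : ENNReal) ≠ ⊤ := ENNReal.natCast_ne_top _
    have h1 := hM.lintegral_eq g hg
    -- A product of counts is a symmetric function, so its ordering sum is `N!` times its value; the
    -- unknown constant `D` is then removed with the total mass identity `factorial_eq`.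
    simp_rw [fun ω => orderingSum_eq_factorial_mul (M ω) hsymm, hw.ofReal_weightDensity,
      mul_left_comm (g _)] at h1
    rw [lintegral_const_mul' _ _ hfact, lintegral_const_mul' _ _ ENNReal.ofReal_ne_top,
      hφ.lintegral_prod_count_mul hB hd] at h1
    have h2 := hM.factorial_eq
    rw [hw.lintegral_weightDensity hk] at h2
    have h3 : (N.factorial : ENNReal) * ∫⁻ ω, g (eigVec (M ω)) ∂P = (N.factorial : ENNReal) *
        ∫⁻ x in Set.univ.pi B, detIntensity (weightFun d w N) x := by
      rw [h1]
      conv_rhs => rw [h2]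
      simp only [mul_assoc]
    simp_rw [hcount]
    exact (ENNReal.mul_right_inj hfac0 hfact).1 h3

theorem hasPointsDensity (hM : HasEigenvalueDensity P M w D) (hD0 : D ≠ 0) (hD1 : D ≠ ⊤)
    (hw : Measurable w) : ∃ c : ℝ, 0 < c ∧
      HasPointsDensity P (fun ω => eigenvalueMultiset (M ω))
        (fun z : Fin N → ℂ => c * weightDensity w z) := by
  have hfac0 : (N.factorial : ENNReal) ≠ 0 := by exact_mod_cast Nat.factorial_ne_zero _
  have hc0 : (N.factorial : ENNReal)⁻¹ * D ≠ 0 :=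
    mul_ne_zero (ENNReal.inv_ne_zero.2 (ENNReal.natCast_ne_top _)) hD0
  have hc1 : (N.factorial : ENNReal)⁻¹ * D ≠ ⊤ :=
    ENNReal.mul_ne_top (ENNReal.inv_ne_top.2 hfac0) hD1
  refine ⟨((N.factorial : ENNReal)⁻¹ * D).toReal, ENNReal.toReal_pos hc0 hc1,
    ⟨_, hM.isEnumeration⟩, fun Z hZ => ?_⟩
  rw [hM.symmetrizedLaw_eq hZ hw]
  congr 1
  ext z
  rw [ENNReal.ofReal_mul ENNReal.toReal_nonneg, ENNReal.ofReal_toReal hc1]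

end HasEigenvalueDensity

theorem exists_hasEigenvalueDensity {Ω : Type*} [MeasurableSpace Ω] {P : Measure Ω}
    [IsProbabilityMeasure P] {k : ℕ} (hk : 1 ≤ k) {n : Fin (k + 1) → ℕ}
    (hlast : n (Fin.last k) = n 0) (hmin : ∀ i, n 0 ≤ n i)
    {A : (i : Fin k) → Ω → Matrix (Fin (n i.castSucc)) (Fin (n i.succ)) ℂ}
    (hlaw : ∀ (i : Fin k) (a : Fin (n i.castSucc)) (b : Fin (n i.succ)),
      HasLaw (fun ω => A i ω a b) stdComplexGaussian P)
    (hindep : iIndepFun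
      (fun (e : Σ i : Fin k, Fin (n i.castSucc) × Fin (n i.succ)) (ω : Ω) =>
        A e.1 ω e.2.1 e.2.2) P) {w : ℂ → ℝ} (hw : IsRectWeight n w) :
    ∃ D : ENNReal, D ≠ 0 ∧ D ≠ ⊤ ∧
      HasEigenvalueDensity P (fun ω => squareProd hlast (fun i => A i ω)) w D := by
  obtain ⟨κ, rfl⟩ := Nat.exists_eq_add_of_le' hk
  have hw' : IsProdWeight (fun i : Fin (κ + 1) => n i.castSucc - n 0) w := hw
  obtain ⟨C, hC⟩ := exists_hasEigenvalueFormula hw' (n 0) hlast rfl hmin fun _ => rfl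
  obtain ⟨hC0, hC1⟩ := hC.ne hk hw'
  let X : ChainIdx n → Ω → ℂ := fun e ω => A e.1 ω e.2.1 e.2.2
  have hX : ∀ e, HasLaw (X e) stdComplexGaussian P := fun e => hlaw e.1 e.2.1 e.2.2
  obtain ⟨c, hc0, hc1, hc⟩ := exists_lintegral_eq_gaussDensity hX hindep
  have hM : ∀ ω, squareProd hlast (fun i => A i ω) =
      squareProd hlast (chainMat fun e => X e ω) := fun ω => rfl
  have hentry : ∀ a b, Measurable fun Y : ChainIdx n → ℂ => squareProd hlast (chainMat Y) a b :=
    fun a b => (continuous_squareProd hlast a b).measurable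
  refine ⟨c * C, mul_ne_zero hc0 hC0, ENNReal.mul_ne_top hc1 hC1, ?_, fun f hf => ?_⟩
  · have hXm : AEMeasurable (fun ω => fun e => X e ω) P :=
      aemeasurable_pi_lambda _ fun e => (hX e).aemeasurable
    have hev : Measurable fun Y : ChainIdx n → ℂ => eigVec (squareProd hlast (chainMat Y)) :=
      measurable_eigVec_comp hentry
    simp_rw [hM]
    exact hev.comp_aemeasurable hXm
  · have hF : Measurable fun Y : ChainIdx n → ℂ => orderingSum f (squareProd hlast (chainMat Y)) :=
      measurable_orderingSum (f := fun _ => f) (hf.comp measurable_snd) hentry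
    simp_rw [hM]
    rw [mul_assoc, ← hC f hf]
    exact hc _ hF

end chains

theorem theorem2 {Ω : Type*} [MeasurableSpace Ω] (P : Measure Ω) [IsProbabilityMeasure P]
    (k : ℕ) (hk : 1 ≤ k) (n : Fin (k + 1) → ℕ)
    (hlast : n (Fin.last k) = n 0) (hmin : ∀ i, n 0 ≤ n i)
    (A : (i : Fin k) → Ω → Matrix (Fin (n i.castSucc)) (Fin (n i.succ)) ℂ)
    (hlaw : ∀ (i : Fin k) (a : Fin (n i.castSucc)) (b : Fin (n i.succ)),
      HasLaw (fun ω => A i ω a b) stdComplexGaussian P)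
    (hindep : iIndepFun
      (fun (e : Σ i : Fin k, Fin (n i.castSucc) × Fin (n i.succ)) (ω : Ω) =>
        A e.1 ω e.2.1 e.2.2) P) :
    (∃ K : ℂ → ℂ → ℂ,
      IsDeterminantal P
        (fun ω => eigenvalueMultiset (squareProd hlast (fun i => A i ω))) K) ∧
    (∃ w : ℂ → ℝ, IsRectWeight n w) ∧
    ∀ w : ℂ → ℝ, IsRectWeight n w →
      ∃ c : ℝ, 0 < c ∧
        HasPointsDensity P
          (fun ω => eigenvalueMultiset (squareProd hlast (fun i => A i ω)))
          (fun z : Fin (n 0) → ℂ =>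
            c * ((∏ l, w (z l)) * ∏ i, ∏ j ∈ Finset.Ioi i, ‖z i - z j‖ ^ 2)) := by
  have hex : ∃ w : ℂ → ℝ, IsRectWeight n w :=
    exists_isProdWeight hk fun i => n i.castSucc - n 0
  refine ⟨?_, hex, fun w hw => ?_⟩
  · obtain ⟨w, hw⟩ := hex
    obtain ⟨D, -, -, hD⟩ := exists_hasEigenvalueDensity hk hlast hmin hlaw hindep hw
    exact ⟨_, hD.isDeterminantal hk (d := fun i => n i.castSucc - n 0) hw⟩
  · obtain ⟨D, hD0, hD1, hD⟩ := exists_hasEigenvalueDensity hk hlast hmin hlaw hindep hw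
    exact hD.hasPointsDensity hD0 hD1 hw.measurable
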